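/- Let $N\ge 3$ be an integer and let $q>0$ be real, $q\ne 1$. For $1\le i\le N$ put $i'=N+1-i$, and let $\varrho_i=\frac N2-i$ for $i<\frac{N+1}2$, $\varrho_i=0$ for $i=\frac{N+1}2$, $\varrho_i=\frac N2-i+1$ for $i>\frac{N+1}2$. With $(P)=1$ if $P$ is true and $(P)=0$ otherwise, put $$C^{ij}=C_{ij}=q^{-\varrho_i}(i=j'),\qquad K^{kl}_{ij}=C^{ij}C_{kl},$$ $$R^{kl}_{ij}=q^{(k=l)-(k=l')}(i=l)(j=k)+(q-q^{-1})(i<l)\bigl((i=k)(j=l)-K^{kl}_{ij}\bigr),$$ $$(R^-)^{kl}_{ij}=R^{kl}_{ij}-(q-q^{-1})(i=k)(j=l)+(q-q^{-1})K^{kl}_{ij}.$$ Repeated upper and lower indices are summed from $1$ to $N$. Work over $\mathbb R$ or $\mathbb C$. Let $X$ be the coordinate algebra of the quantum Euclidean sphere $S_q^{N-1}$, generated by $x_1,\dots,x_N$ with the relations $$(R^-)^{kl}_{ij}x_kx_l=q^{-1}x_ix_j+\frac{q^{N-1}-q^{N-3}}{1+q^{N-2}}K^{kl}_{ij}x_kx_l,\qquad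 C^{kl}x_kx_l=1.$$ Let $(\Gamma_+,\mathrm d)$ be the first order differential calculus on $X$ (an $X$-bimodule with a linear map $\mathrm d:X\to\Gamma_+$ that satisfies the Leibniz rule and whose image generates $\Gamma_+$ as a left module) with bimodule structure $$\mathrm dx_i\cdot x_j=(R^-)^{kl}_{ij}x_k\,\mathrm dx_l+(q-1)x_i\,\mathrm dx_j+\frac{q^N-q^{N-2}}{1-q^{N-1}}K^{kl}_{ij}x_k\,\mathrm dx_l+\frac{(1-q)(1+q^{N-2})}{1-q^{N-1}}C^{kl}x_ix_jx_k\,\mathrm dx_l ,$$ that is, the bimodule of one-forms of $X$ subject to these relations, and let $\eta=C^{kl}x_k\,\mathrm dx_l$. Let $(\Gamma^\wedge_u,\mathrm d)$ be the universal higher order differential calculus extending $\Gamma_+$, that is, the quotient of the tensor algebra of the bimodule $\Gamma_+$ over $X$ by the two-sided ideal generated by all $\sum_k\mathrm da_k\otimes\mathrm db_k$ with $\sum_k a_k\,\mathrm db_k=0$ in $\Gamma_+$. Then the left $X$-module $\Gamma_+\wedge\Gamma_+$ of two-forms in $\Gamma^\wedge_u$ is generated by the $\mathrm dx_i\wedge\mathrm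 dx_j$ ($1\le i,j\le N$), the relations $$\begin{aligned}0={}&(R^-)^{kl}_{ij}\,\mathrm dx_k\wedge\mathrm dx_l+q\,\mathrm dx_i\wedge\mathrm dx_j-q\frac{(1-q)(1+q^{N-2})}{1-q^{N-1}}x_i\,\eta\wedge\mathrm dx_j\\&-\frac{(1-q)(1+q^{N-2})}{1-q^{N-1}}(R^-)^{kl}_{ij}x_k\,\eta\wedge\mathrm dx_l-\frac{(1+q^2)(1+q^{N-2})^2}{(1-q^{N-1})^2}x_ix_jC^{kl}x_k\,\eta\wedge\mathrm dx_l\\&+q^{N-2}\frac{(1+q)(1+q^2)(1+q^{N-2})}{(1-q^{N-1})^2}K^{kl}_{ij}x_k\,\eta\wedge\mathrm dx_l\qquad(1\le i,j\le N),\end{aligned}$$ $$0=\mathrm d\eta+2q\frac{1+q^{N-2}}{(1-q)(1-q^{N-1})}C^{kl}x_k\,\eta\wedge\mathrm dx_l$$ hold in it, and all left-module relations among the $\mathrm dx_i\wedge\mathrm dx_j$ are generated by these: the kernel of the map $X^{N\times N}\to\Gamma_+\wedge\Gamma_+$, $(a_{ij})\mapsto\sum_{i,j}a_{ij}\,\mathrm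 dx_i\wedge\mathrm dx_j$, is the left submodule generated by the coefficient vectors of these relations, where $\eta=C^{mn}x_m\,\mathrm dx_n$ and $\mathrm d\eta=C^{kl}\,\mathrm dx_k\wedge\mathrm dx_l$ are inserted. -/

import Mathlib

open scoped TensorProduct

/-! ### Structure constants

Indices `1, …, N` are modelled by `Fin N`, so the index represented by `i : Fin N` is `i + 1`,
and `i.rev` is the index `N + 1 - i`. -/

/-- `ϱ_i = N/2 - i` for `i < (N+1)/2`, `0` for `i = (N+1)/2`, `N/2 - i + 1` for `i > (N+1)/2`. -/
noncomputable def rho {N : ℕ} (i : Fin N) : ℝ :=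
  if 2 * ((i : ℕ) + 1) < N + 1 then (N : ℝ) / 2 - ((i : ℕ) + 1)
  else if 2 * ((i : ℕ) + 1) = N + 1 then 0
  else (N : ℝ) / 2 - ((i : ℕ) + 1) + 1

/-- `C^{ij} = C_{ij} = q^{-ϱ_i} (i = j')`. -/
noncomputable def metC {N : ℕ} (q : ℝ) (i j : Fin N) : ℝ :=
  if i = j.rev then q ^ (-(rho i)) else 0

/-- `K^{kl}_{ij} = C^{ij} C_{kl}`. -/
noncomputable def matK {N : ℕ} (q : ℝ) (k l i j : Fin N) : ℝ := metC q i j * metC q k l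

/-- The `R`-matrix `R^{kl}_{ij}` of `O_q(N)`. -/
noncomputable def matR {N : ℕ} (q : ℝ) (k l i j : Fin N) : ℝ :=
  q ^ ((if k = l then (1 : ℤ) else 0) - (if k = l.rev then (1 : ℤ) else 0))
      * (if i = l then 1 else 0) * (if j = k then 1 else 0)
    + (q - q⁻¹) * (if i < l then 1 else 0)
      * ((if i = k then 1 else 0) * (if j = l then 1 else 0) - matK q k l i j)

/-- `R⁻ = R - (q - q⁻¹) I + (q - q⁻¹) K`. -/
noncomputable def matRinv {N : ℕ} (q : ℝ) (k l i j : Fin N) : ℝ :=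
  matR q k l i j - (q - q⁻¹) * ((if k = i then 1 else 0) * (if l = j then 1 else 0))
    + (q - q⁻¹) * matK q k l i j

/-! ### The quantum Euclidean sphere -/

section Sphere

variable (𝕜 : Type*) [RCLike 𝕜] (N : ℕ) (q : ℝ)

/-- The defining relations of the coordinate algebra of the quantum Euclidean sphere. -/
inductive SphereRel : FreeAlgebra 𝕜 (Fin N) → FreeAlgebra 𝕜 (Fin N) → Prop
  | comm (i j : Fin N) : SphereRel
      (∑ k, ∑ l, (matRinv q k l i j : 𝕜) • (FreeAlgebra.ι 𝕜 k * FreeAlgebra.ι 𝕜 l))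
      (((q⁻¹ : ℝ) : 𝕜) • (FreeAlgebra.ι 𝕜 i * FreeAlgebra.ι 𝕜 j)
        + (((q ^ ((N : ℤ) - 1) - q ^ ((N : ℤ) - 3)) / (1 + q ^ ((N : ℤ) - 2)) : ℝ) : 𝕜) •
          ∑ k, ∑ l, (matK q k l i j : 𝕜) • (FreeAlgebra.ι 𝕜 k * FreeAlgebra.ι 𝕜 l))
  | unit : SphereRel
      (∑ k, ∑ l, (metC q k l : 𝕜) • (FreeAlgebra.ι 𝕜 k * FreeAlgebra.ι 𝕜 l)) 1

/-- The algebra `X` of the quantum Euclidean sphere `S_q^{N-1}`. -/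
abbrev QSphere : Type _ := RingQuot (SphereRel 𝕜 N q)

/-- The generators `x_1, …, x_N` of `X`. -/
noncomputable def QSphere.x (i : Fin N) : QSphere 𝕜 N q :=
  RingQuot.mkAlgHom 𝕜 (SphereRel 𝕜 N q) (FreeAlgebra.ι 𝕜 i)

end Sphere

/-! ### First order differential calculi

An `X`-bimodule (over `𝕜`) is a module over the enveloping algebra `X ⊗ Xᵐᵒᵖ`. -/

section FirstOrder

/-- The enveloping algebra `X ⊗ Xᵐᵒᵖ` of `X`. -/
def Env (𝕜 : Type*) [CommRing 𝕜] (X : Type*) [Ring X] [Algebra 𝕜 X] : Type _ := X ⊗[𝕜] Xᵐᵒᵖ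

noncomputable instance (𝕜 : Type*) [CommRing 𝕜] (X : Type*) [Ring X] [Algebra 𝕜 X] :
    Ring (Env 𝕜 X) :=
  inferInstanceAs (Ring (X ⊗[𝕜] Xᵐᵒᵖ))

noncomputable instance (𝕜 : Type*) [CommRing 𝕜] (X : Type*) [Ring X] [Algebra 𝕜 X] :
    Algebra 𝕜 (Env 𝕜 X) :=
  inferInstanceAs (Algebra 𝕜 (X ⊗[𝕜] Xᵐᵒᵖ))

/-- The element `a ⊗ b` of the enveloping algebra. -/
noncomputable def Env.tmul (𝕜 : Type*) [CommRing 𝕜] {X : Type*} [Ring X] [Algebra 𝕜 X]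
    (a : X) (b : Xᵐᵒᵖ) : Env 𝕜 X :=
  a ⊗ₜ[𝕜] b

theorem Env.tmul_mul_tmul (𝕜 : Type*) [CommRing 𝕜] {X : Type*} [Ring X] [Algebra 𝕜 X]
    (a a' : X) (b b' : Xᵐᵒᵖ) :
    Env.tmul 𝕜 a b * Env.tmul 𝕜 a' b' = Env.tmul 𝕜 (a * a') (b * b') :=
  Algebra.TensorProduct.tmul_mul_tmul a a' b b'

theorem Env.induction (𝕜 : Type*) [CommRing 𝕜] {X : Type*} [Ring X] [Algebra 𝕜 X]
    {p : Env 𝕜 X → Prop} (zero : p 0) (tmul : ∀ a b, p (Env.tmul 𝕜 a b))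
    (add : ∀ s t, p s → p t → p (s + t)) (t : Env 𝕜 X) : p t :=
  TensorProduct.induction_on t zero tmul add

variable {𝕜 : Type*} [CommRing 𝕜] {X : Type*} [Ring X] [Algebra 𝕜 X]

/-- The left action `a · ω` of `X` on a bimodule. -/
noncomputable def lAct (𝕜 : Type*) [CommRing 𝕜] {X : Type*} [Ring X] [Algebra 𝕜 X]
    {Γ : Type*} [AddCommGroup Γ] [Module (Env 𝕜 X) Γ] (a : X) (ω : Γ) : Γ :=
  Env.tmul 𝕜 a 1 • ω

/-- The right action `ω · b` of `X` on a bimodule. -/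
noncomputable def rAct (𝕜 : Type*) [CommRing 𝕜] {X : Type*} [Ring X] [Algebra 𝕜 X]
    {Γ : Type*} [AddCommGroup Γ] [Module (Env 𝕜 X) Γ] (ω : Γ) (b : X) : Γ :=
  Env.tmul 𝕜 1 (MulOpposite.op b) • ω

theorem lAct_add_left {Γ : Type*} [AddCommGroup Γ] [Module (Env 𝕜 X) Γ] (a b : X) (ω : Γ) :
    lAct 𝕜 (a + b) ω = lAct 𝕜 a ω + lAct 𝕜 b ω := by
  rw [lAct, lAct, lAct, ← add_smul]; congr 1; exact TensorProduct.add_tmul a b 1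

theorem rAct_add_right {Γ : Type*} [AddCommGroup Γ] [Module (Env 𝕜 X) Γ] (ω : Γ) (a b : X) :
    rAct 𝕜 ω (a + b) = rAct 𝕜 ω a + rAct 𝕜 ω b := by
  rw [rAct, rAct, rAct, ← add_smul]; congr 1
  exact TensorProduct.tmul_add (1 : X) (MulOpposite.op a) (MulOpposite.op b)

theorem lAct_lAct {Γ : Type*} [AddCommGroup Γ] [Module (Env 𝕜 X) Γ] (a b : X) (ω : Γ) :
    lAct 𝕜 a (lAct 𝕜 b ω) = lAct 𝕜 (a * b) ω := by
  rw [lAct, lAct, lAct, smul_smul, Env.tmul_mul_tmul, one_mul]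

theorem rAct_lAct {Γ : Type*} [AddCommGroup Γ] [Module (Env 𝕜 X) Γ] (a b : X) (ω : Γ) :
    rAct 𝕜 (lAct 𝕜 a ω) b = lAct 𝕜 a (rAct 𝕜 ω b) := by
  rw [lAct, lAct, rAct, rAct, smul_smul, smul_smul, Env.tmul_mul_tmul, Env.tmul_mul_tmul,
    one_mul, one_mul, mul_one, mul_one]

/-- `(Γ, d)` is a first order differential calculus on `X`. -/
structure IsFirstOrderCalculus {Γ : Type*} [AddCommGroup Γ] [Module 𝕜 Γ] [Module (Env 𝕜 X) Γ]
    (d : X →ₗ[𝕜] Γ) : Prop where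
  leibniz : ∀ a b : X, d (a * b) = rAct 𝕜 (d a) b + lAct 𝕜 a (d b)
  span_eq_top : Submodule.span 𝕜 {ω : Γ | ∃ a b : X, ω = lAct 𝕜 a (d b)} = ⊤

theorem IsFirstOrderCalculus.map_one {Γ : Type*} [AddCommGroup Γ] [Module 𝕜 Γ]
    [Module (Env 𝕜 X) Γ] {d : X →ₗ[𝕜] Γ} (hd : IsFirstOrderCalculus d) : d 1 = 0 := by
  have h := hd.leibniz 1 1
  have h1 : rAct 𝕜 (d 1) (1 : X) = d 1 := one_smul (Env 𝕜 X) (d 1)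
  have h2 : lAct 𝕜 (1 : X) (d 1) = d 1 := one_smul (Env 𝕜 X) (d 1)
  rw [h1, h2, mul_one] at h
  exact left_eq_add.1 h

end FirstOrder

/-! ### The calculus `Γ₊` on the quantum Euclidean sphere -/

section GammaPlus

variable (𝕜 : Type*) [RCLike 𝕜] (N : ℕ) (q : ℝ)

/-- The formal symbol `d a` in the free bimodule on the symbols `d a`, `a ∈ X`. -/
noncomputable def preD (a : QSphere 𝕜 N q) : QSphere 𝕜 N q →₀ Env 𝕜 (QSphere 𝕜 N q) :=
  Finsupp.single a 1

open QSphere in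
/-- The relations imposed on the symbols `d a`: linearity, the Leibniz rule, and the
commutation relations
`dx_i·x_j = R⁻ x_k dx_l + (q-1) x_i dx_j + (q^N-q^{N-2})/(1-q^{N-1}) K x_k dx_l
  + (1-q)(1+q^{N-2})/(1-q^{N-1}) C^{kl} x_i x_j x_k dx_l`. -/
inductive GammaPlusRel : (QSphere 𝕜 N q →₀ Env 𝕜 (QSphere 𝕜 N q)) → Prop
  | add (a b : QSphere 𝕜 N q) : GammaPlusRel
      (preD 𝕜 N q (a + b) - (preD 𝕜 N q a + preD 𝕜 N q b))
  | smul (c : 𝕜) (a : QSphere 𝕜 N q) : GammaPlusRel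
      (preD 𝕜 N q (c • a) - c • preD 𝕜 N q a)
  | leibniz (a b : QSphere 𝕜 N q) : GammaPlusRel
      (preD 𝕜 N q (a * b) - (rAct 𝕜 (preD 𝕜 N q a) b + lAct 𝕜 a (preD 𝕜 N q b)))
  | bimod (i j : Fin N) : GammaPlusRel
      (rAct 𝕜 (preD 𝕜 N q (x 𝕜 N q i)) (x 𝕜 N q j) -
        ((∑ k, ∑ l, (matRinv q k l i j : 𝕜) • lAct 𝕜 (x 𝕜 N q k) (preD 𝕜 N q (x 𝕜 N q l)))
          + ((q - 1 : ℝ) : 𝕜) • lAct 𝕜 (x 𝕜 N q i) (preD 𝕜 N q (x 𝕜 N q j))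
          + (((q ^ (N : ℤ) - q ^ ((N : ℤ) - 2)) / (1 - q ^ ((N : ℤ) - 1)) : ℝ) : 𝕜) •
              ∑ k, ∑ l, (matK q k l i j : 𝕜) •
                lAct 𝕜 (x 𝕜 N q k) (preD 𝕜 N q (x 𝕜 N q l))
          + (((1 - q) * (1 + q ^ ((N : ℤ) - 2)) / (1 - q ^ ((N : ℤ) - 1)) : ℝ) : 𝕜) •
              ∑ k, ∑ l, (metC q k l : 𝕜) •
                lAct 𝕜 (x 𝕜 N q i * x 𝕜 N q j * x 𝕜 N q k) (preD 𝕜 N q (x 𝕜 N q l))))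

/-- The bimodule `Γ₊`: the bimodule of one-forms with the above commutation relations. -/
abbrev GammaPlus : Type _ :=
  (QSphere 𝕜 N q →₀ Env 𝕜 (QSphere 𝕜 N q)) ⧸
    Submodule.span (Env 𝕜 (QSphere 𝕜 N q)) {v | GammaPlusRel 𝕜 N q v}

theorem gammaPlus_mk_eq {v w : QSphere 𝕜 N q →₀ Env 𝕜 (QSphere 𝕜 N q)}
    (h : GammaPlusRel 𝕜 N q (v - w)) :
    (Submodule.Quotient.mk v : GammaPlus 𝕜 N q) = Submodule.Quotient.mk w :=
  (Submodule.Quotient.eq _).2 (Submodule.subset_span h)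

/-- The differential `d : X → Γ₊`. -/
noncomputable def dPlus : QSphere 𝕜 N q →ₗ[𝕜] GammaPlus 𝕜 N q where
  toFun a := Submodule.Quotient.mk (preD 𝕜 N q a)
  map_add' a b := gammaPlus_mk_eq 𝕜 N q (GammaPlusRel.add a b)
  map_smul' c a := gammaPlus_mk_eq 𝕜 N q (GammaPlusRel.smul c a)

theorem dPlus_leibniz (a b : QSphere 𝕜 N q) :
    dPlus 𝕜 N q (a * b) = rAct 𝕜 (dPlus 𝕜 N q a) b + lAct 𝕜 a (dPlus 𝕜 N q b) :=
  gammaPlus_mk_eq 𝕜 N q (GammaPlusRel.leibniz a b)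

theorem dPlus_isFirstOrderCalculus : IsFirstOrderCalculus (dPlus 𝕜 N q) := by
  refine ⟨dPlus_leibniz 𝕜 N q, ?_⟩
  rw [eq_top_iff]
  rintro ω -
  obtain ⟨v, rfl⟩ := Submodule.Quotient.mk_surjective _ ω
  induction v using Finsupp.induction_linear with
  | zero => exact Submodule.zero_mem _
  | add v w hv hw => rw [Submodule.Quotient.mk_add]; exact Submodule.add_mem _ hv hw
  | single a t =>
    induction t using Env.induction with
    | zero => rw [Finsupp.single_zero]; exact Submodule.zero_mem _
    | add s t hs ht =>
      rw [Finsupp.single_add, Submodule.Quotient.mk_add]; exact Submodule.add_mem _ hs ht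
    | tmul u b =>
      have h1 : (Finsupp.single a (Env.tmul 𝕜 u b) : QSphere 𝕜 N q →₀ Env 𝕜 (QSphere 𝕜 N q)) =
          lAct 𝕜 u (rAct 𝕜 (preD 𝕜 N q a) b.unop) := by
        simp [lAct, rAct, preD, Env.tmul_mul_tmul]
      have h2 : (Submodule.Quotient.mk (Finsupp.single a (Env.tmul 𝕜 u b)) : GammaPlus 𝕜 N q) =
          lAct 𝕜 u (dPlus 𝕜 N q (a * b.unop)) - lAct 𝕜 (u * a) (dPlus 𝕜 N q b.unop) := by
        rw [h1, dPlus_leibniz]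
        have h3 : lAct 𝕜 (u * a) (dPlus 𝕜 N q b.unop) =
            lAct 𝕜 u (lAct 𝕜 a (dPlus 𝕜 N q b.unop)) := by
          simp [lAct, smul_smul, Env.tmul_mul_tmul]
        rw [h3]
        simp only [lAct, smul_add]
        rw [add_sub_cancel_right]
        rfl
      rw [h2]
      exact Submodule.sub_mem _ (Submodule.subset_span ⟨_, _, rfl⟩)
        (Submodule.subset_span ⟨_, _, rfl⟩)

end GammaPlus

/-! ### The universal higher order differential calculus -/

section Universal

set_option linter.unusedSectionVars false

variable {𝕜 : Type*} [CommRing 𝕜] {X : Type*} [Ring X] [Algebra 𝕜 X]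
variable {Γ : Type*} [AddCommGroup Γ] [Module 𝕜 Γ] [Module (Env 𝕜 X) Γ]

/-- The relations of the universal higher order calculus extending `(Γ, d)`: those of the tensor
algebra of the bimodule `Γ` over `X`, and `∑ da_k ∧ db_k = 0` whenever `∑ a_k db_k = 0`. -/
inductive UnivRel (d : X →ₗ[𝕜] Γ) :
    FreeAlgebra 𝕜 (X ⊕ Γ) → FreeAlgebra 𝕜 (X ⊕ Γ) → Prop
  | alg_add (a b : X) : UnivRel d (FreeAlgebra.ι 𝕜 (Sum.inl (a + b)))
      (FreeAlgebra.ι 𝕜 (Sum.inl a) + FreeAlgebra.ι 𝕜 (Sum.inl b))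
  | alg_smul (c : 𝕜) (a : X) : UnivRel d (FreeAlgebra.ι 𝕜 (Sum.inl (c • a)))
      (c • FreeAlgebra.ι 𝕜 (Sum.inl a))
  | alg_mul (a b : X) : UnivRel d (FreeAlgebra.ι 𝕜 (Sum.inl (a * b)))
      (FreeAlgebra.ι 𝕜 (Sum.inl a) * FreeAlgebra.ι 𝕜 (Sum.inl b))
  | alg_one : UnivRel d (FreeAlgebra.ι 𝕜 (Sum.inl 1)) 1
  | form_add (ω η : Γ) : UnivRel d (FreeAlgebra.ι 𝕜 (Sum.inr (ω + η)))
      (FreeAlgebra.ι 𝕜 (Sum.inr ω) + FreeAlgebra.ι 𝕜 (Sum.inr η))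
  | form_smul (c : 𝕜) (ω : Γ) : UnivRel d (FreeAlgebra.ι 𝕜 (Sum.inr (c • ω)))
      (c • FreeAlgebra.ι 𝕜 (Sum.inr ω))
  | form_left (a : X) (ω : Γ) : UnivRel d (FreeAlgebra.ι 𝕜 (Sum.inr (lAct 𝕜 a ω)))
      (FreeAlgebra.ι 𝕜 (Sum.inl a) * FreeAlgebra.ι 𝕜 (Sum.inr ω))
  | form_right (ω : Γ) (b : X) : UnivRel d (FreeAlgebra.ι 𝕜 (Sum.inr (rAct 𝕜 ω b)))
      (FreeAlgebra.ι 𝕜 (Sum.inr ω) * FreeAlgebra.ι 𝕜 (Sum.inl b))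
  | diff (n : ℕ) (a b : Fin n → X) (h : ∑ k, lAct 𝕜 (a k) (d (b k)) = 0) : UnivRel d
      (∑ k, FreeAlgebra.ι 𝕜 (Sum.inr (d (a k))) * FreeAlgebra.ι 𝕜 (Sum.inr (d (b k)))) 0

/-- The algebra of differential forms of the universal higher order calculus extending `(Γ, d)`;
its multiplication is the wedge product. -/
def UnivCalc (d : X →ₗ[𝕜] Γ) : Type _ := RingQuot (UnivRel d)

noncomputable instance (d : X →ₗ[𝕜] Γ) : Ring (UnivCalc d) :=
  inferInstanceAs (Ring (RingQuot (UnivRel d)))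

noncomputable instance (d : X →ₗ[𝕜] Γ) : Algebra 𝕜 (UnivCalc d) :=
  inferInstanceAs (Algebra 𝕜 (RingQuot (UnivRel d)))

namespace UnivCalc


variable (d : X →ₗ[𝕜] Γ)

/-- The quotient map onto the algebra of forms. -/
noncomputable def proj : FreeAlgebra 𝕜 (X ⊕ Γ) →ₐ[𝕜] UnivCalc d :=
  RingQuot.mkAlgHom 𝕜 (UnivRel d)

theorem proj_eq {u v : FreeAlgebra 𝕜 (X ⊕ Γ)} (h : UnivRel d u v) : proj d u = proj d v :=
  RingQuot.mkAlgHom_rel 𝕜 h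

theorem proj_surjective : Function.Surjective (proj d) := RingQuot.mkAlgHom_surjective 𝕜 _

/-- The inclusion of `X` as the forms of degree zero. -/
noncomputable def ofAlg : X →ₐ[𝕜] UnivCalc d :=
  AlgHom.ofLinearMap
    { toFun := fun a => proj d (FreeAlgebra.ι 𝕜 (Sum.inl a))
      map_add' := fun a b => by rw [proj_eq d (UnivRel.alg_add a b), map_add]
      map_smul' := fun c a => by rw [proj_eq d (UnivRel.alg_smul c a), map_smul]; rfl }
    (by simp only [LinearMap.coe_mk, AddHom.coe_mk]; rw [proj_eq d UnivRel.alg_one, map_one])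
    (fun a b => by
      simp only [LinearMap.coe_mk, AddHom.coe_mk]; rw [proj_eq d (UnivRel.alg_mul a b), map_mul])

/-- The inclusion of `Γ` as the forms of degree one. -/
noncomputable def ofForm : Γ →ₗ[𝕜] UnivCalc d where
  toFun ω := proj d (FreeAlgebra.ι 𝕜 (Sum.inr ω))
  map_add' ω η := by rw [proj_eq d (UnivRel.form_add ω η), map_add]
  map_smul' c ω := by rw [proj_eq d (UnivRel.form_smul c ω), map_smul]; rfl

theorem ofForm_lAct (a : X) (ω : Γ) : ofForm d (lAct 𝕜 a ω) = ofAlg d a * ofForm d ω :=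
  (proj_eq d (UnivRel.form_left a ω)).trans (map_mul _ _ _)

theorem ofForm_rAct (ω : Γ) (b : X) : ofForm d (rAct 𝕜 ω b) = ofForm d ω * ofAlg d b :=
  (proj_eq d (UnivRel.form_right ω b)).trans (map_mul _ _ _)

theorem sum_ofForm_mul_ofForm {n : ℕ} {a b : Fin n → X}
    (h : ∑ k, lAct 𝕜 (a k) (d (b k)) = 0) :
    ∑ k, ofForm d (d (a k)) * ofForm d (d (b k)) = 0 := by
  have h1 := proj_eq d (UnivRel.diff n a b h)
  rw [map_sum, map_zero] at h1
  rw [← h1]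
  exact Finset.sum_congr rfl fun k _ => (map_mul (proj d) _ _).symm

/-- The left `X`-module structure on forms. -/
noncomputable instance : Module X (UnivCalc d) := Module.compHom _ (ofAlg d).toRingHom

theorem smul_def (a : X) (w : UnivCalc d) : a • w = ofAlg d a * w := rfl

variable {d}

/-- Algebra homomorphisms out of the algebra of forms. -/
noncomputable def lift {B : Type*} [Ring B] [Algebra 𝕜 B] (f : X →ₐ[𝕜] B) (g : Γ →ₗ[𝕜] B)
    (hl : ∀ a ω, g (lAct 𝕜 a ω) = f a * g ω) (hr : ∀ ω b, g (rAct 𝕜 ω b) = g ω * f b)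
    (hd : ∀ (n : ℕ) (a b : Fin n → X), ∑ k, lAct 𝕜 (a k) (d (b k)) = 0 →
      ∑ k, g (d (a k)) * g (d (b k)) = 0) : UnivCalc d →ₐ[𝕜] B :=
  RingQuot.liftAlgHom 𝕜 ⟨FreeAlgebra.lift 𝕜 (Sum.elim f g), by
    intro u v h
    induction h with
    | diff n a b h => simpa [map_sum] using hd n a b h
    | _ => simp [hl, hr]⟩

section lift

variable {B : Type*} [Ring B] [Algebra 𝕜 B] (f : X →ₐ[𝕜] B) (g : Γ →ₗ[𝕜] B)
    (hl : ∀ a ω, g (lAct 𝕜 a ω) = f a * g ω) (hr : ∀ ω b, g (rAct 𝕜 ω b) = g ω * f b)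
    (hd : ∀ (n : ℕ) (a b : Fin n → X), ∑ k, lAct 𝕜 (a k) (d (b k)) = 0 →
      ∑ k, g (d (a k)) * g (d (b k)) = 0)

theorem lift_ofAlg (a : X) : lift f g hl hr hd (ofAlg d a) = f a := by
  change RingQuot.liftAlgHom 𝕜 _ (RingQuot.mkAlgHom 𝕜 (UnivRel d) _) = _
  rw [RingQuot.liftAlgHom_mkAlgHom_apply]; simp

theorem lift_ofForm (ω : Γ) : lift f g hl hr hd (ofForm d ω) = g ω := by
  change RingQuot.liftAlgHom 𝕜 _ (RingQuot.mkAlgHom 𝕜 (UnivRel d) _) = _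
  rw [RingQuot.liftAlgHom_mkAlgHom_apply]; simp

end lift

theorem induction {p : UnivCalc d → Prop} (one : p 1) (add : ∀ v w, p v → p w → p (v + w))
    (smul : ∀ (c : 𝕜) w, p w → p (c • w)) (alg : ∀ a w, p w → p (ofAlg d a * w))
    (form : ∀ ω w, p w → p (ofForm d ω * w)) (w : UnivCalc d) : p w := by
  have key : ∀ u : FreeAlgebra 𝕜 (X ⊕ Γ), ∀ v, p v → p (proj d u * v) := by
    intro u
    induction u using FreeAlgebra.induction with
    | grade0 c => intro v hv; rw [AlgHom.commutes, ← Algebra.smul_def]; exact smul c v hv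
    | grade1 x =>
      intro v hv
      cases x with
      | inl a => exact alg a v hv
      | inr ω => exact form ω v hv
    | mul u u' hu hu' => intro v hv; rw [map_mul, mul_assoc]; exact hu _ (hu' v hv)
    | add u u' hu hu' =>
      intro v hv; rw [map_add, add_mul]; exact add _ _ (hu v hv) (hu' v hv)
  obtain ⟨u, rfl⟩ := proj_surjective d w
  simpa using key u 1 one

theorem algHom_ext {B : Type*} [Ring B] [Algebra 𝕜 B] {F G : UnivCalc d →ₐ[𝕜] B}
    (h0 : ∀ a, F (ofAlg d a) = G (ofAlg d a)) (h1 : ∀ ω, F (ofForm d ω) = G (ofForm d ω)) :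
    F = G := by
  ext w
  induction w using UnivCalc.induction with
  | one => simp
  | add v w hv hw => simp [hv, hw]
  | smul c w hw => simp [hw]
  | alg a w hw => simp [hw, h0]
  | form ω w hw => simp [hw, h1]

variable (d)

/-- The grading involution, `(-1)^n` on forms of degree `n`. -/
noncomputable def signInv : UnivCalc d →ₐ[𝕜] UnivCalc d :=
  lift (ofAlg d) (-ofForm d) (by simp [ofForm_lAct]) (by simp [ofForm_rAct])
    (fun n a b h => by simpa using sum_ofForm_mul_ofForm d h)

theorem signInv_ofAlg (a : X) : signInv d (ofAlg d a) = ofAlg d a := lift_ofAlg _ _ _ _ _ a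

theorem signInv_ofForm (ω : Γ) : signInv d (ofForm d ω) = -ofForm d ω :=
  lift_ofForm _ _ _ _ _ ω

variable [IsScalarTower 𝕜 (Env 𝕜 X) Γ]

theorem lAct_smul_left (c : 𝕜) (a : X) (ω : Γ) : lAct 𝕜 (c • a) ω = c • lAct 𝕜 a ω := by
  rw [lAct, lAct, ← smul_assoc]; congr 1

theorem lAct_smul_right (c : 𝕜) (a : X) (ω : Γ) : lAct 𝕜 a (c • ω) = c • lAct 𝕜 a ω := by
  rw [lAct, lAct, ← algebraMap_smul (Env 𝕜 X) c ω, smul_smul, ← Algebra.commutes, ← smul_smul,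
    algebraMap_smul]

theorem rAct_smul_left (c : 𝕜) (ω : Γ) (b : X) : rAct 𝕜 (c • ω) b = c • rAct 𝕜 ω b := by
  rw [rAct, rAct, ← algebraMap_smul (Env 𝕜 X) c ω, smul_smul, ← Algebra.commutes, ← smul_smul,
    algebraMap_smul]

theorem rAct_smul_right (c : 𝕜) (ω : Γ) (b : X) : rAct 𝕜 ω (c • b) = c • rAct 𝕜 ω b := by
  rw [rAct, rAct, ← smul_assoc]
  congr 1
  exact TensorProduct.tmul_smul c (1 : X) (MulOpposite.op b)

/-- The map `a ⊗ b ↦ a db`. -/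
noncomputable def leftForm : X ⊗[𝕜] X →ₗ[𝕜] Γ :=
  TensorProduct.lift (LinearMap.mk₂ 𝕜 (fun a b => lAct 𝕜 a (d b))
    (fun _ _ _ => lAct_add_left _ _ _) (fun _ _ _ => lAct_smul_left _ _ _)
    (fun a b b' => by simp [lAct]) (fun c a b => by rw [map_smul, lAct_smul_right]))

/-- The map `a ⊗ b ↦ da ∧ db`. -/
noncomputable def wedgeForm : X ⊗[𝕜] X →ₗ[𝕜] UnivCalc d :=
  TensorProduct.lift ((LinearMap.mul 𝕜 (UnivCalc d)).compl₁₂ (ofForm d ∘ₗ d) (ofForm d ∘ₗ d))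

theorem ker_leftForm_le : LinearMap.ker (leftForm d) ≤ LinearMap.ker (wedgeForm d) := by
  intro t ht
  obtain ⟨n, a, b, rfl⟩ := TensorProduct.exists_sum_tmul_eq t
  rw [LinearMap.mem_ker] at ht ⊢
  simp only [map_sum, leftForm, wedgeForm, TensorProduct.lift.tmul] at ht ⊢
  exact sum_ofForm_mul_ofForm d ht

variable {d}

theorem leftForm_tmul (a b : X) : leftForm d (a ⊗ₜ[𝕜] b) = lAct 𝕜 a (d b) :=
  TensorProduct.lift.tmul a b

theorem wedgeForm_tmul (a b : X) :
    wedgeForm d (a ⊗ₜ[𝕜] b) = ofForm d (d a) * ofForm d (d b) :=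
  TensorProduct.lift.tmul a b

theorem leftForm_surjective (hd : IsFirstOrderCalculus d) :
    Function.Surjective (leftForm d) := by
  rw [← LinearMap.range_eq_top, eq_top_iff, ← hd.span_eq_top, Submodule.span_le]
  rintro _ ⟨a, b, rfl⟩
  exact ⟨a ⊗ₜ[𝕜] b, leftForm_tmul a b⟩

/-- The differential on one-forms, `d(a db) = da ∧ db`. -/
noncomputable def oneD (hd : IsFirstOrderCalculus d) : Γ →ₗ[𝕜] UnivCalc d :=
  ((LinearMap.ker (leftForm d)).liftQ (wedgeForm d) (ker_leftForm_le d)) ∘ₗ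
    ((leftForm d).quotKerEquivOfSurjective (leftForm_surjective hd)).symm.toLinearMap

theorem oneD_leftForm (hd : IsFirstOrderCalculus d) (t : X ⊗[𝕜] X) :
    oneD hd (leftForm d t) = wedgeForm d t := by
  have h : ((leftForm d).quotKerEquivOfSurjective (leftForm_surjective hd)).symm (leftForm d t) =
      Submodule.Quotient.mk t := by
    rw [LinearEquiv.symm_apply_eq]; rfl
  simp only [oneD, LinearMap.comp_apply, LinearEquiv.coe_coe, h]
  rfl

theorem oneD_lAct_d (hd : IsFirstOrderCalculus d) (a b : X) :
    oneD hd (lAct 𝕜 a (d b)) = ofForm d (d a) * ofForm d (d b) := by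
  rw [← leftForm_tmul, oneD_leftForm, wedgeForm_tmul]

theorem oneForm_induction (hd : IsFirstOrderCalculus d) {p : Γ → Prop}
    (add : ∀ ω η, p ω → p η → p (ω + η)) (base : ∀ a b : X, p (lAct 𝕜 a (d b))) (ω : Γ) : p ω := by
  obtain ⟨t, rfl⟩ := leftForm_surjective hd ω
  induction t using TensorProduct.induction_on with
  | zero => simpa [lAct] using base 0 0
  | tmul a b => rw [leftForm_tmul]; exact base a b
  | add s t hs ht => rw [map_add]; exact add _ _ hs ht

theorem oneD_lAct (hd : IsFirstOrderCalculus d) (a : X) (ω : Γ) :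
    oneD hd (lAct 𝕜 a ω) = ofForm d (d a) * ofForm d ω + ofAlg d a * oneD hd ω := by
  induction ω using oneForm_induction hd with
  | add ω η h1 h2 =>
    have : lAct 𝕜 a (ω + η) = lAct 𝕜 a ω + lAct 𝕜 a η := smul_add _ _ _
    rw [this, map_add, map_add, map_add, h1, h2]; noncomm_ring
  | base b c =>
    rw [lAct_lAct, oneD_lAct_d, oneD_lAct_d, hd.leibniz, map_add, ofForm_rAct, ofForm_lAct,
      ofForm_lAct]
    noncomm_ring

theorem oneD_rAct (hd : IsFirstOrderCalculus d) (ω : Γ) (b : X) :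
    oneD hd (rAct 𝕜 ω b) = oneD hd ω * ofAlg d b - ofForm d ω * ofForm d (d b) := by
  induction ω using oneForm_induction hd with
  | add ω η h1 h2 =>
    have : rAct 𝕜 (ω + η) b = rAct 𝕜 ω b + rAct 𝕜 η b := smul_add _ _ _
    rw [this, map_add, map_add, map_add, h1, h2]; noncomm_ring
  | base a c =>
    have h1 : rAct 𝕜 (d c) b = d (c * b) - lAct 𝕜 c (d b) := by rw [hd.leibniz]; abel
    have h2 : lAct 𝕜 a (d (c * b) - lAct 𝕜 c (d b)) =
        lAct 𝕜 a (d (c * b)) - lAct 𝕜 a (lAct 𝕜 c (d b)) := smul_sub _ _ _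
    rw [rAct_lAct, h1, h2, map_sub, lAct_lAct, oneD_lAct_d, oneD_lAct_d, oneD_lAct_d,
      hd.leibniz, hd.leibniz, map_add, map_add, ofForm_rAct, ofForm_lAct, ofForm_lAct,
      ofForm_rAct]
    noncomm_ring

/-- The homomorphism `ω ↦ [[(-1)^{deg ω} ω, dω], [0, ω]]`. -/
noncomputable def diffMat (hd : IsFirstOrderCalculus d) :
    UnivCalc d →ₐ[𝕜] Matrix (Fin 2) (Fin 2) (UnivCalc d) :=
  lift
    (AlgHom.ofLinearMap
      { toFun := fun a => !![ofAlg d a, ofForm d (d a); 0, ofAlg d a]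
        map_add' := fun a b => by
          ext i j; fin_cases i <;> fin_cases j <;> simp
        map_smul' := fun c a => by
          ext i j; fin_cases i <;> fin_cases j <;> simp }
      (by ext i j; fin_cases i <;> fin_cases j <;> simp [hd.map_one])
      (fun a b => by
        ext i j; fin_cases i <;> fin_cases j <;>
          simp [hd.leibniz, ofForm_lAct, ofForm_rAct, Matrix.mul_apply, add_comm]))
    { toFun := fun ω => !![-ofForm d ω, oneD hd ω; 0, ofForm d ω]
      map_add' := fun a b => by
        ext i j; fin_cases i <;> fin_cases j <;> simp [add_comm]
      map_smul' := fun c a => by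
        ext i j; fin_cases i <;> fin_cases j <;> simp }
    (fun a ω => by
      ext i j; fin_cases i <;> fin_cases j <;>
        simp [ofForm_lAct, oneD_lAct, Matrix.mul_apply, add_comm])
    (fun ω b => by
      ext i j; fin_cases i <;> fin_cases j <;>
        simp [ofForm_rAct, oneD_rAct, Matrix.mul_apply]; try abel)
    (fun n a b h => by
      have h0 := sum_ofForm_mul_ofForm d h
      have h1 : ∀ c, oneD hd (d c) = 0 := fun c => by
        have : d c = lAct 𝕜 (1 : X) (d c) := (one_smul (Env 𝕜 X) (d c)).symm
        rw [this, oneD_lAct_d, hd.map_one, map_zero, zero_mul]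
      ext i j; fin_cases i <;> fin_cases j <;>
        simp [Matrix.sum_apply, h0, h1])

/-- The differential `d` of the universal higher order calculus. -/
noncomputable def diff (hd : IsFirstOrderCalculus d) : UnivCalc d →ₗ[𝕜] UnivCalc d :=
  Matrix.entryLinearMap 𝕜 (UnivCalc d) 0 1 ∘ₗ (diffMat hd).toLinearMap

theorem diffMat_apply (hd : IsFirstOrderCalculus d) (w : UnivCalc d) :
    diffMat hd w = !![signInv d w, diff hd w; 0, w] := by
  have h : diffMat hd w 0 0 = signInv d w ∧ diffMat hd w 1 0 = 0 ∧ diffMat hd w 1 1 = w := by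
    induction w using UnivCalc.induction with
    | one => simp
    | add v w hv hw => simp [hv, hw]
    | smul c w hw => simp [hw]
    | alg a w hw =>
      have : diffMat hd (ofAlg d a) = !![ofAlg d a, ofForm d (d a); 0, ofAlg d a] :=
        lift_ofAlg _ _ _ _ _ a
      simp [this, hw, Matrix.mul_apply, signInv_ofAlg]
    | form ω w hw =>
      have : diffMat hd (ofForm d ω) = !![-ofForm d ω, oneD hd ω; 0, ofForm d ω] :=
        lift_ofForm _ _ _ _ _ ω
      simp [this, hw, Matrix.mul_apply, signInv_ofForm]
  ext i j; fin_cases i <;> fin_cases j <;> simp [h, diff]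

theorem diff_ofAlg (hd : IsFirstOrderCalculus d) (a : X) :
    diff hd (ofAlg d a) = ofForm d (d a) := by
  have : diffMat hd (ofAlg d a) = !![ofAlg d a, ofForm d (d a); 0, ofAlg d a] :=
    lift_ofAlg _ _ _ _ _ a
  simp [diff, this]

theorem diff_ofForm (hd : IsFirstOrderCalculus d) (ω : Γ) :
    diff hd (ofForm d ω) = oneD hd ω := by
  have : diffMat hd (ofForm d ω) = !![-ofForm d ω, oneD hd ω; 0, ofForm d ω] :=
    lift_ofForm _ _ _ _ _ ω
  simp [diff, this]

/-- The graded Leibniz rule. -/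
theorem diff_mul (hd : IsFirstOrderCalculus d) (v w : UnivCalc d) :
    diff hd (v * w) = diff hd v * w + signInv d v * diff hd w := by
  have h : diffMat hd (v * w) 0 1 = (diffMat hd v * diffMat hd w) 0 1 := by rw [map_mul]
  rw [diffMat_apply, diffMat_apply, diffMat_apply] at h
  simpa [Matrix.mul_apply, add_comm] using h

/-- `(B, δ)`, with grading `𝒜`, is a higher order differential calculus which extends `(Γ, d)`
along the identifications `f`, `g` of `X`, `Γ` with the components of degree `0`, `1`. -/
structure IsHigherOrderCalculus (d : X →ₗ[𝕜] Γ) {B : Type*} [Ring B] [Algebra 𝕜 B]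
    (𝒜 : ℕ → Submodule 𝕜 B) [GradedAlgebra 𝒜] (f : X →ₐ[𝕜] B) (g : Γ →ₗ[𝕜] B)
    (δ : B →ₗ[𝕜] B) : Prop where
  f_injective : Function.Injective f
  f_range : LinearMap.range f.toLinearMap = 𝒜 0
  g_injective : Function.Injective g
  g_range : LinearMap.range g = 𝒜 1
  g_left : ∀ a ω, g (lAct 𝕜 a ω) = f a * g ω
  g_right : ∀ ω b, g (rAct 𝕜 ω b) = g ω * f b
  extends_d : ∀ a, δ (f a) = g (d a)
  degree : ∀ n, ∀ v ∈ 𝒜 n, δ v ∈ 𝒜 (n + 1)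
  leibniz : ∀ n, ∀ v ∈ 𝒜 n, ∀ w, δ (v * w) = δ v * w + (-1 : 𝕜) ^ n • (v * δ w)
  square_zero : ∀ v, δ (δ v) = 0

/-- `UnivCalc d` maps uniquely to every higher order calculus which extends `(Γ, d)`. -/
theorem existsUnique_hom (hd : IsFirstOrderCalculus d) {B : Type*} [Ring B] [Algebra 𝕜 B]
    {𝒜 : ℕ → Submodule 𝕜 B} [GradedAlgebra 𝒜] {f : X →ₐ[𝕜] B} {g : Γ →ₗ[𝕜] B} {δ : B →ₗ[𝕜] B}
    (h : IsHigherOrderCalculus d 𝒜 f g δ) :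
    ∃! F : UnivCalc d →ₐ[𝕜] B, (∀ a, F (ofAlg d a) = f a) ∧ (∀ ω, F (ofForm d ω) = g ω) ∧
      ∀ w, F (diff hd w) = δ (F w) := by
  have hf : ∀ a, f a ∈ 𝒜 0 := fun a => h.f_range ▸ ⟨a, rfl⟩
  have hg : ∀ ω, g ω ∈ 𝒜 1 := fun ω => h.g_range ▸ ⟨ω, rfl⟩
  have l0 : ∀ a w, δ (f a * w) = g (d a) * w + f a * δ w := fun a w => by
    simpa [h.extends_d] using h.leibniz 0 (f a) (hf a) w
  have l1 : ∀ ω w, δ (g ω * w) = δ (g ω) * w - g ω * δ w := fun ω w => by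
    simpa [sub_eq_add_neg] using h.leibniz 1 (g ω) (hg ω) w
  have base : ∀ a b, δ (g (lAct 𝕜 a (d b))) = g (d a) * g (d b) := fun a b => by
    rw [h.g_left, l0, ← h.extends_d b, h.square_zero, mul_zero, add_zero]
  let F := lift (d := d) f g h.g_left h.g_right (fun n a b hab => by
    have := congrArg (fun ω => δ (g ω)) hab
    simpa [base] using this)
  have F0 : ∀ a, F (ofAlg d a) = f a := lift_ofAlg f g _ _ _
  have F1 : ∀ ω, F (ofForm d ω) = g ω := lift_ofForm f g _ _ _
  refine ⟨F, ⟨F0, F1, fun w => ?_⟩, fun G hG => algHom_ext (fun a => by rw [hG.1, F0])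
    (fun ω => by rw [hG.2.1, F1])⟩
  have F2 : ∀ ω, F (oneD hd ω) = δ (g ω) := fun ω => by
    induction ω using oneForm_induction hd with
    | add ω η h1 h2 => simp [h1, h2]
    | base a b => rw [oneD_lAct_d, map_mul, F1, F1, base]
  induction w using UnivCalc.induction with
  | one =>
    have h1 := l0 1 1
    have h2 : diff hd (1 : UnivCalc d) = 0 := by
      rw [← map_one (ofAlg d), diff_ofAlg, hd.map_one, map_zero]
    rw [hd.map_one] at h1
    have h3 : δ 1 = 0 := by
      have := h.extends_d 1
      rwa [hd.map_one, map_zero, map_one] at this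
    rw [h2, map_one, h3, map_zero]
  | add v w hv hw => simp [hv, hw]
  | smul c w hw => simp [hw]
  | alg a w hw =>
    rw [diff_mul, diff_ofAlg, signInv_ofAlg, map_add, map_mul, map_mul, map_mul, F0, F1, hw, l0]
  | form ω w hw =>
    rw [diff_mul, diff_ofForm, signInv_ofForm, map_add, map_mul, map_mul, map_mul, map_neg, F1,
      F2, hw, l1, neg_mul, sub_eq_add_neg]

/-- `d ∘ d = 0`. -/
theorem diff_diff (hd : IsFirstOrderCalculus d) (w : UnivCalc d) : diff hd (diff hd w) = 0 := by
  have hdd : ∀ c : X, oneD hd (d c) = 0 := fun c => by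
    have : d c = lAct 𝕜 (1 : X) (d c) := (one_smul (Env 𝕜 X) (d c)).symm
    rw [this, oneD_lAct_d, hd.map_one, map_zero, zero_mul]
  have hs : ∀ w, signInv d (diff hd w) = -diff hd (signInv d w) := fun w => by
    have hs1 : ∀ ω, signInv d (oneD hd ω) = oneD hd ω := fun ω => by
      induction ω using oneForm_induction hd with
      | add ω η h1 h2 => simp [h1, h2]
      | base a b => rw [oneD_lAct_d, map_mul, signInv_ofForm, signInv_ofForm, neg_mul_neg]
    induction w using UnivCalc.induction with
    | one =>
      have h2 : diff hd (1 : UnivCalc d) = 0 := by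
        rw [← map_one (ofAlg d), diff_ofAlg, hd.map_one, map_zero]
      simp [h2]
    | add v w hv hw => simp [hv, hw, add_comm]
    | smul c w hw => simp [hw]
    | alg a w hw =>
      simp only [diff_mul, map_add, map_mul, diff_ofAlg, signInv_ofAlg, signInv_ofForm, hw]
      noncomm_ring
    | form ω w hw =>
      simp only [diff_mul, map_add, map_mul, map_neg, diff_ofForm, signInv_ofForm, hw, hs1]
      noncomm_ring
  induction w using UnivCalc.induction with
  | one =>
    have h2 : diff hd (1 : UnivCalc d) = 0 := by
      rw [← map_one (ofAlg d), diff_ofAlg, hd.map_one, map_zero]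
    simp [h2]
  | add v w hv hw => simp [hv, hw]
  | smul c w hw => simp [hw]
  | alg a w hw =>
    simp only [diff_mul, map_add, diff_ofAlg, diff_ofForm, signInv_ofAlg, signInv_ofForm, hw, hdd]
    noncomm_ring
  | form ω w hw =>
    have h1 : diff hd (oneD hd ω) = 0 := by
      induction ω using oneForm_induction hd with
      | add ω η h1 h2 => simp [h1, h2]
      | base a b =>
        rw [oneD_lAct_d, diff_mul, diff_ofForm, diff_ofForm, hdd, hdd]; simp
    have h2 : signInv d (oneD hd ω) = oneD hd ω := by
      have := hs (ofForm d ω)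
      rwa [diff_ofForm, signInv_ofForm, map_neg, diff_ofForm, neg_neg] at this
    simp only [diff_mul, map_add, map_neg, diff_ofForm, signInv_ofForm, hw, h1, h2]
    noncomm_ring

variable (d) in
/-- The forms of degree `n`. -/
noncomputable def forms : ℕ → Submodule 𝕜 (UnivCalc d)
  | 0 => LinearMap.range (ofAlg d).toLinearMap
  | n + 1 => Submodule.span 𝕜 {v | ∃ ω : Γ, ∃ w ∈ forms n, v = ofForm d ω * w}

theorem ofForm_mul_mem {n : ℕ} (ω : Γ) {w : UnivCalc d} (hw : w ∈ forms d n) :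
    ofForm d ω * w ∈ forms d (n + 1) := Submodule.subset_span ⟨ω, w, hw, rfl⟩

theorem ofAlg_mul_mem (a : X) {n : ℕ} {w : UnivCalc d} (hw : w ∈ forms d n) :
    ofAlg d a * w ∈ forms d n := by
  cases n with
  | zero =>
    obtain ⟨b, rfl⟩ := hw
    exact ⟨a * b, map_mul (ofAlg d) a b⟩
  | succ n =>
    refine Submodule.span_induction (p := fun w _ => ofAlg d a * w ∈ forms d (n + 1))
      ?_ (by simp) ?_ ?_ hw
    · rintro _ ⟨ω, w, hw, rfl⟩
      rw [← mul_assoc, ← ofForm_lAct]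
      exact ofForm_mul_mem _ hw
    · intro v w _ _ hv hw; rw [mul_add]; exact Submodule.add_mem _ hv hw
    · intro c w _ hw; rw [mul_smul_comm]; exact Submodule.smul_mem _ c hw

instance : SetLike.GradedMonoid (forms d) where
  one_mem := ⟨1, map_one (ofAlg d)⟩
  mul_mem := by
    intro i j v w hv hw
    induction i generalizing v with
    | zero =>
      obtain ⟨b, rfl⟩ := hv
      rw [zero_add]; exact ofAlg_mul_mem b hw
    | succ i ih =>
      rw [add_right_comm]
      refine Submodule.span_induction (p := fun v _ => v * w ∈ forms d (i + j + 1))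
        ?_ (by simp) ?_ ?_ hv
      · rintro _ ⟨ω, u, hu, rfl⟩
        rw [mul_assoc]; exact ofForm_mul_mem _ (ih hu)
      · intro u v _ _ hu hv; rw [add_mul]; exact Submodule.add_mem _ hu hv
      · intro c u _ hu; rw [smul_mul_assoc]; exact Submodule.smul_mem _ c hu

theorem ofForm_mem (ω : Γ) : ofForm d ω ∈ forms d 1 := by
  have h : (1 : UnivCalc d) ∈ forms d 0 := ⟨1, map_one (ofAlg d)⟩
  simpa using ofForm_mul_mem ω h

theorem ofAlg_mem (a : X) : ofAlg d a ∈ forms d 0 := ⟨a, rfl⟩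

open DirectSum in
variable (d) in
/-- The inclusion of `X` as the component of degree zero. -/
noncomputable def algTo : X →ₗ[𝕜] ⨁ n, forms d n :=
  (DirectSum.lof 𝕜 ℕ (fun n => forms d n) 0) ∘ₗ
    (ofAlg d).toLinearMap.codRestrict (forms d 0) ofAlg_mem

theorem algTo_apply (a : X) :
    algTo d a = DirectSum.of (fun n => forms d n) 0 ⟨ofAlg d a, ofAlg_mem a⟩ := rfl

open DirectSum in
variable (d) in
/-- The inclusion of `Γ` as the component of degree one. -/
noncomputable def formTo : Γ →ₗ[𝕜] ⨁ n, forms d n :=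
  (DirectSum.lof 𝕜 ℕ (fun n => forms d n) 1) ∘ₗ (ofForm d).codRestrict (forms d 1) ofForm_mem

theorem formTo_apply (ω : Γ) :
    formTo d ω = DirectSum.of (fun n => forms d n) 1 ⟨ofForm d ω, ofForm_mem ω⟩ := rfl

open DirectSum in
variable (d) in
/-- The decomposition of a form into its homogeneous components. -/
noncomputable def decompose : UnivCalc d →ₐ[𝕜] ⨁ n, forms d n :=
  lift (B := ⨁ n, forms d n)
    (AlgHom.ofLinearMap (algTo d)
      (by
        rw [algTo_apply, DirectSum.one_def]
        congr 1
        exact Subtype.ext (map_one (ofAlg d)))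
      (fun a b => by
        rw [algTo_apply, algTo_apply, algTo_apply, DirectSum.of_mul_of]
        refine DirectSum.of_eq_of_gradedMonoid_eq (Sigma.subtype_ext (zero_add 0).symm ?_)
        exact map_mul (ofAlg d) a b))
    (formTo d)
    (fun a ω => by
      rw [AlgHom.ofLinearMap_apply, algTo_apply, formTo_apply, formTo_apply, DirectSum.of_mul_of]
      refine DirectSum.of_eq_of_gradedMonoid_eq (Sigma.subtype_ext (zero_add 1).symm ?_)
      exact ofForm_lAct d a ω)
    (fun ω b => by
      rw [AlgHom.ofLinearMap_apply, algTo_apply, formTo_apply, formTo_apply, DirectSum.of_mul_of]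
      refine DirectSum.of_eq_of_gradedMonoid_eq (Sigma.subtype_ext (add_zero 1).symm ?_)
      exact ofForm_rAct d ω b)
    (fun n a b h => by
      simp only [formTo_apply, DirectSum.of_mul_of]
      rw [← map_sum, ← map_zero (DirectSum.of (fun n => forms d n) (1 + 1))]
      congr 1
      refine Subtype.ext ?_
      rw [AddSubmonoidClass.coe_finsetSum]
      exact sum_ofForm_mul_ofForm d h)

theorem decompose_ofAlg (a : X) : decompose d (ofAlg d a) =
    DirectSum.of (fun n => forms d n) 0 ⟨ofAlg d a, ofAlg_mem a⟩ := by
  rw [decompose, lift_ofAlg]; rfl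

theorem decompose_ofForm (ω : Γ) : decompose d (ofForm d ω) =
    DirectSum.of (fun n => forms d n) 1 ⟨ofForm d ω, ofForm_mem ω⟩ := by
  rw [decompose, lift_ofForm]; rfl

theorem decompose_coe {n : ℕ} {w : UnivCalc d} (hw : w ∈ forms d n) :
    decompose d w = DirectSum.of (fun n => forms d n) n ⟨w, hw⟩ := by
  induction n generalizing w with
  | zero => obtain ⟨a, rfl⟩ := hw; exact decompose_ofAlg a
  | succ n ih =>
    refine Submodule.span_induction (p := fun w h => decompose d w =
      DirectSum.of (fun n => forms d n) (n + 1) ⟨w, h⟩) ?_ ?_ ?_ ?_ hw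
    · rintro _ ⟨ω, u, hu, rfl⟩
      rw [map_mul, ih hu, decompose_ofForm, DirectSum.of_mul_of]
      exact DirectSum.of_eq_of_gradedMonoid_eq (Sigma.subtype_ext (add_comm 1 n) rfl)
    · rw [map_zero]; exact (map_zero _).symm
    · intro u v hu hv h1 h2
      rw [map_add, h1, h2, ← map_add]; rfl
    · intro c u hu h1
      rw [map_smul, h1]
      exact (map_smul (DirectSum.lof 𝕜 ℕ (fun n => forms d n) (n + 1)) c _).symm

noncomputable instance : GradedAlgebra (forms d) :=
  GradedAlgebra.ofAlgHom (forms d) (decompose d)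
    (algHom_ext
      (fun a => by
        rw [AlgHom.comp_apply, decompose_ofAlg, DirectSum.coeAlgHom_of]; rfl)
      (fun ω => by
        rw [AlgHom.comp_apply, decompose_ofForm, DirectSum.coeAlgHom_of]; rfl))
    (fun _ w => decompose_coe w.2)

variable (d) in
/-- The action of forms on `X ⊕ Γ`, with products of one-forms acting by zero. -/
noncomputable def lowRep : UnivCalc d →ₐ[𝕜] Module.End 𝕜 (X × Γ) :=
  lift
    (AlgHom.ofLinearMap
      (LinearMap.mk₂ 𝕜 (fun (a : X) (v : X × Γ) => (a * v.1, lAct 𝕜 a v.2))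
        (fun a b v => by simp [add_mul, lAct_add_left])
        (fun c a v => by simp [lAct_smul_left])
        (fun a v w => by simp [mul_add, lAct])
        (fun c a v => by simp [lAct_smul_right]))
      (by
        refine LinearMap.ext fun v => Prod.ext (one_mul _) ?_
        exact one_smul (Env 𝕜 X) v.2)
      (fun a b => LinearMap.ext fun v => Prod.ext (mul_assoc _ _ _) (lAct_lAct a b v.2).symm))
    (LinearMap.mk₂ 𝕜 (fun (ω : Γ) (v : X × Γ) => ((0 : X), rAct 𝕜 ω v.1))
        (fun ω η v => Prod.ext (add_zero _).symm (smul_add _ _ _))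
        (fun c ω v => Prod.ext (smul_zero c).symm (rAct_smul_left c ω v.1))
        (fun ω v w => Prod.ext (add_zero _).symm (rAct_add_right ω v.1 w.1))
        (fun c ω v => Prod.ext (smul_zero c).symm (rAct_smul_right c ω v.1)))
    (fun a ω => LinearMap.ext fun v => Prod.ext (mul_zero a).symm (rAct_lAct a v.1 ω))
    (fun ω b => LinearMap.ext fun v => Prod.ext rfl (by
      change rAct 𝕜 (rAct 𝕜 ω b) v.1 = rAct 𝕜 ω (b * v.1)
      rw [rAct, rAct, rAct, smul_smul, Env.tmul_mul_tmul, one_mul, MulOpposite.op_mul]))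
    (fun n a b _ => Finset.sum_eq_zero fun k _ => LinearMap.ext fun v => Prod.ext rfl (by
      change rAct 𝕜 (d (a k)) (0 : X) = 0
      rw [rAct]
      convert zero_smul (Env 𝕜 X) _
      exact TensorProduct.tmul_zero _ _))

theorem ofAlg_injective : Function.Injective (ofAlg d) := by
  intro a b h
  have h1 : ∀ a, (lowRep d (ofAlg d a) ((1 : X), (0 : Γ))).1 = a := fun a => by
    rw [lowRep, lift_ofAlg]; exact mul_one a
  rw [← h1 a, h, h1]

theorem ofForm_injective : Function.Injective (ofForm d) := by
  intro a b h
  have h1 : ∀ ω, (lowRep d (ofForm d ω) ((1 : X), (0 : Γ))).2 = ω := fun ω => by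
    rw [lowRep, lift_ofForm]; exact one_smul (Env 𝕜 X) ω
  rw [← h1 a, h, h1]

theorem signInv_of_mem {n : ℕ} {w : UnivCalc d} (hw : w ∈ forms d n) :
    signInv d w = (-1 : 𝕜) ^ n • w := by
  induction n generalizing w with
  | zero => obtain ⟨a, rfl⟩ := hw; simpa using signInv_ofAlg d a
  | succ n ih =>
    refine Submodule.span_induction (p := fun w _ => signInv d w = (-1 : 𝕜) ^ (n + 1) • w)
      ?_ ?_ ?_ ?_ hw
    · rintro _ ⟨ω, u, hu, rfl⟩
      rw [map_mul, ih hu, signInv_ofForm, pow_succ]; simp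
    · simp
    · intro u v _ _ h1 h2; rw [map_add, h1, h2, smul_add]
    · intro c u _ h1; rw [map_smul, h1, smul_comm]

theorem oneD_mem (hd : IsFirstOrderCalculus d) (ω : Γ) : oneD hd ω ∈ forms d 2 := by
  induction ω using oneForm_induction hd with
  | add ω η h1 h2 => rw [map_add]; exact Submodule.add_mem _ h1 h2
  | base a b => rw [oneD_lAct_d]; exact ofForm_mul_mem _ (ofForm_mem _)

theorem diff_mem (hd : IsFirstOrderCalculus d) {n : ℕ} {w : UnivCalc d} (hw : w ∈ forms d n) :
    diff hd w ∈ forms d (n + 1) := by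
  induction n generalizing w with
  | zero => obtain ⟨a, rfl⟩ := hw; exact (diff_ofAlg hd a) ▸ ofForm_mem _
  | succ n ih =>
    refine Submodule.span_induction (p := fun w _ => diff hd w ∈ forms d (n + 1 + 1))
      ?_ ?_ ?_ ?_ hw
    · rintro _ ⟨ω, u, hu, rfl⟩
      rw [diff_mul, diff_ofForm, signInv_ofForm, neg_mul]
      refine Submodule.add_mem _ ?_ (Submodule.neg_mem _ (ofForm_mul_mem _ (ih hu)))
      have := SetLike.mul_mem_graded (oneD_mem hd ω) hu
      rwa [show 2 + n = n + 1 + 1 by omega] at this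
    · simp
    · intro u v _ _ h1 h2; rw [map_add]; exact Submodule.add_mem _ h1 h2
    · intro c u _ h1; rw [map_smul]; exact Submodule.smul_mem _ c h1

/-- `UnivCalc d` is a higher order calculus which extends `(Γ, d)`. -/
theorem isHigherOrderCalculus (hd : IsFirstOrderCalculus d) :
    IsHigherOrderCalculus d (forms d) (ofAlg d) (ofForm d) (diff hd) where
  f_injective := ofAlg_injective
  f_range := rfl
  g_injective := ofForm_injective
  g_range := by
    refine le_antisymm ?_ (Submodule.span_le.2 ?_)
    · rintro _ ⟨ω, rfl⟩; exact ofForm_mem ω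
    · rintro _ ⟨ω, _, ⟨a, rfl⟩, rfl⟩
      exact ⟨rAct 𝕜 ω a, ofForm_rAct d ω a⟩
  g_left := ofForm_lAct d
  g_right := ofForm_rAct d
  extends_d := diff_ofAlg hd
  degree := fun _ _ hv => diff_mem hd hv
  leibniz := fun _ v hv w => by rw [diff_mul, signInv_of_mem hv, smul_mul_assoc]
  square_zero := diff_diff hd

end UnivCalc

end Universal

/-! ### Two-forms in the universal higher order calculus extending `Γ₊` -/

section TwoForms

variable (𝕜 : Type*) [RCLike 𝕜] (N : ℕ) (q : ℝ)

/-- The algebra of forms of the universal higher order calculus on the sphere extending `Γ₊`. -/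
abbrev SphereForms : Type _ := UnivCalc (dPlus 𝕜 N q)

/-- The differential of the universal higher order calculus on the sphere. -/
noncomputable abbrev dForms : SphereForms 𝕜 N q →ₗ[𝕜] SphereForms 𝕜 N q :=
  UnivCalc.diff (dPlus_isFirstOrderCalculus 𝕜 N q)

/-- `dx_i` as an element of the algebra of forms. -/
noncomputable def dx (i : Fin N) : SphereForms 𝕜 N q :=
  UnivCalc.ofForm (dPlus 𝕜 N q) (dPlus 𝕜 N q (QSphere.x 𝕜 N q i))

/-- The invariant one-form `η = C^{kl} x_k dx_l`. -/
noncomputable def etaForm : SphereForms 𝕜 N q :=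
  ∑ k, ∑ l, (metC q k l : 𝕜) • (QSphere.x 𝕜 N q k • dx 𝕜 N q l)

variable {N} {M : Type*} [AddCommGroup M] [Module 𝕜 M] [Module (QSphere 𝕜 N q) M]

open QSphere in
/-- The right-hand side of the first relation, in a left `X`-module `M` where `w k l` stands for
`dx_k ∧ dx_l` and `e l` for `η ∧ dx_l`. -/
noncomputable def relOne (w : Fin N → Fin N → M) (e : Fin N → M) (i j : Fin N) : M :=
  (∑ k, ∑ l, (matRinv q k l i j : 𝕜) • w k l) + (q : 𝕜) • w i j
    - ((q * ((1 - q) * (1 + q ^ ((N : ℤ) - 2)) / (1 - q ^ ((N : ℤ) - 1))) : ℝ) : 𝕜) •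
        (x 𝕜 N q i • e j)
    - (((1 - q) * (1 + q ^ ((N : ℤ) - 2)) / (1 - q ^ ((N : ℤ) - 1)) : ℝ) : 𝕜) •
        ∑ k, ∑ l, (matRinv q k l i j : 𝕜) • (x 𝕜 N q k • e l)
    - (((1 + q ^ 2) * (1 + q ^ ((N : ℤ) - 2)) ^ 2 / (1 - q ^ ((N : ℤ) - 1)) ^ 2 : ℝ) : 𝕜) •
        ((x 𝕜 N q i * x 𝕜 N q j) • ∑ k, ∑ l, (metC q k l : 𝕜) • (x 𝕜 N q k • e l))
    + ((q ^ ((N : ℤ) - 2) * ((1 + q) * (1 + q ^ 2) * (1 + q ^ ((N : ℤ) - 2))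
          / (1 - q ^ ((N : ℤ) - 1)) ^ 2) : ℝ) : 𝕜) •
        ∑ k, ∑ l, (matK q k l i j : 𝕜) • (x 𝕜 N q k • e l)

open QSphere in
/-- The right-hand side of the second relation, in a left `X`-module `M` where `dη` stands for the
differential of `η` and `e l` for `η ∧ dx_l`. -/
noncomputable def relTwo (dη : M) (e : Fin N → M) : M :=
  dη + ((2 * q * ((1 + q ^ ((N : ℤ) - 2)) / ((1 - q) * (1 - q ^ ((N : ℤ) - 1)))) : ℝ) : 𝕜) •
    ∑ k, ∑ l, (metC q k l : 𝕜) • (x 𝕜 N q k • e l)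

variable (N)

/-- The free left `X`-module on the symbols `dx_i ⊗ dx_j`. -/
abbrev FreeTwo : Type _ := Fin N × Fin N → QSphere 𝕜 N q

variable {N}

/-- The basis element `dx_i ⊗ dx_j`. -/
noncomputable def symW (i j : Fin N) : FreeTwo 𝕜 N q := Pi.single (i, j) 1

/-- The element `η ⊗ dx_j = C^{kl} x_k dx_l ⊗ dx_j`. -/
noncomputable def symEtaW (j : Fin N) : FreeTwo 𝕜 N q :=
  ∑ k, ∑ l, (metC q k l : 𝕜) • (QSphere.x 𝕜 N q k • symW 𝕜 q l j)

variable (N)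

/-- The element `C^{kl} dx_k ⊗ dx_l`, which represents `dη`. -/
noncomputable def symDEta : FreeTwo 𝕜 N q :=
  ∑ k, ∑ l, (metC q k l : 𝕜) • symW 𝕜 q k l

end TwoForms

/-! Write `h = q - q⁻¹` and `Q = q^{N-2}`. The commutation rule between `dx_i` and `x_j` becomes
simple in another basis of the one-forms: `ω_i = β⁻¹ (dx_i - α x_i η)` satisfies `ω_i x_j =
(R⁻)^{kl}_{ij} x_k ω_l` and `C^{kl} x_k ω_l = η`, and `dx_i = α x_i η + β ω_i`. Moreover `η x_i -
x_i η = λ⁻¹ dx_i`, so the calculus is inner: `d` is the commutator with `λ η`.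

Two-forms are governed by `G_ij = (R⁻)^{kl}_{ij} ω_k ω_l + q ω_i ω_j - τ C_ij t`, where `t = C^{ij}
ω_i ω_j`, and by `g_j = C^{ki} x_k G_ij` (`quadG`, `quadg`). Both stated families are combinations
of `G` and `g` (`relQuad_eq`, `relation_trace`). Conversely a subspace stable under left
multiplication that contains the two families contains `G` (`quadG_mem_of_relations`).

The relations hold: applying `d` to `η x_j = x_j η + λ⁻¹ dx_j` shows that the commutator of `dη`
with `x_j` is `dx_j η + η dx_j`. A direct computation gives a scalar multiple of the same
anticommutator, and the scalar is not `1` because `q^{N+1} ≠ 1`. Hence `η` anticommutes with `dx_j`,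
which forces `g = 0` and then `G = 0` (`quadG_eq_zero_of_leibniz`).

There are no others: let `Z` be the free left module on the symbols `dx_i ⊗ dx_j` modulo the stated
relations. Functions and the `ω_i` act on `X ⊕ X^N ⊕ Z` by multiplication truncated after degree
two. The relations in `Z` make `G` vanish as an operator; then `η η` is a multiple of `t` and
commutes with `X`, so the commutator with `λ η` induces a homomorphism out of the universal
calculus. Evaluating at `1` sends `∑ a_ij dx_i ∧ dx_j` to the class of `(a_ij)` in `Z`, which bounds
the kernel.

The facts about `R⁻` behind this are the quadratic relation (`act_act`) and the braid relation
(`act_braid`), proved by induction from `N` to `N + 2` by splitting off the first and last index,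
and the crossing relations with the metric, read off from the entries. -/

/-! ### The action of tensors on families -/

section Act

variable {𝕜 : Type*} [Field 𝕜] {M : Type*} [AddCommGroup M] [Module 𝕜 M] {ι : Type*} [Fintype ι]

/-- The action `F ↦ R^{kl}_{ij} F_{kl}` of a tensor on families with two indices. -/
def act (R : ι → ι → ι → ι → 𝕜) (F : ι → ι → M) (i j : ι) : M := ∑ k, ∑ l, R k l i j • F k l

/-- The contraction `C^{kl} F_{kl}`. -/
def contr (C : ι → ι → 𝕜) (F : ι → ι → M) : M := ∑ k, ∑ l, C k l • F k l

variable (R : ι → ι → ι → ι → 𝕜) (C : ι → ι → 𝕜)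

theorem act_add (F G : ι → ι → M) (i j : ι) :
    act R (fun k l => F k l + G k l) i j = act R F i j + act R G i j := by
  simp [act, smul_add, Finset.sum_add_distrib]

theorem act_sub (F G : ι → ι → M) (i j : ι) :
    act R (fun k l => F k l - G k l) i j = act R F i j - act R G i j := by
  simp [act, smul_sub, Finset.sum_sub_distrib]

theorem act_smul (c : 𝕜) (F : ι → ι → M) (i j : ι) :
    act R (fun k l => c • F k l) i j = c • act R F i j := by
  simp [act, Finset.smul_sum, smul_comm c]

theorem contr_add (F G : ι → ι → M) :
    contr C (fun k l => F k l + G k l) = contr C F + contr C G := by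
  simp [contr, smul_add, Finset.sum_add_distrib]

theorem contr_sub (F G : ι → ι → M) :
    contr C (fun k l => F k l - G k l) = contr C F - contr C G := by
  simp [contr, smul_sub, Finset.sum_sub_distrib]

theorem contr_smul (c : 𝕜) (F : ι → ι → M) :
    contr C (fun k l => c • F k l) = c • contr C F := by
  simp [contr, Finset.smul_sum, smul_comm c]

end Act

/-! ### The matrices with values in a field of scalars -/

section Recursion

variable (𝕜 : Type*) [RCLike 𝕜]

/-- The inverse `R`-matrix with entries in `𝕜`. -/
noncomputable def rInv {N : ℕ} (q : ℝ) (k l i j : Fin N) : 𝕜 := (matRinv q k l i j : 𝕜)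

/-- The metric with entries in `𝕜`. -/
noncomputable def met {N : ℕ} (q : ℝ) (i j : Fin N) : 𝕜 := (metC q i j : 𝕜)

theorem rho_rev {N : ℕ} (i : Fin N) : rho i.rev = -rho i := by
  have := i.2
  have h : ((i.rev : ℕ) : ℝ) = N - (i + 1) := by
    rw [Fin.val_rev, Nat.cast_sub (by omega)]; push_cast; ring
  unfold rho
  have h2 : (i.rev : ℕ) = N - (i + 1) := Fin.val_rev i
  split_ifs <;> first | omega | (rw [h]; ring) | simp

variable {𝕜} {M : Type*} [AddCommGroup M] [Module 𝕜 M] {N : ℕ} {q : ℝ}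

theorem met_eq_zero {i j : Fin N} (h : i ≠ j.rev) : met 𝕜 q i j = 0 := by
  simp [met, metC, h]

theorem met_mul_met_rev (hq : 0 < q) (i : Fin N) :
    met 𝕜 q i i.rev * met 𝕜 q i.rev i = 1 := by
  simp only [met, metC, Fin.rev_rev, if_true, rho_rev]
  rw [← RCLike.ofReal_mul, ← Real.rpow_add hq]; simp

theorem met_rev_mul_met (hq : 0 < q) (i : Fin N) :
    met 𝕜 q i.rev i * met 𝕜 q i i.rev = 1 := by
  rw [mul_comm, met_mul_met_rev hq]

/-- Adding `-h I` and `h K` to `R` replaces the condition `i < l` by its complement with the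
opposite sign. What remains is a flip part, a diagonal part and a trace part, each sparse. -/
theorem matRinv_eq {N : ℕ} (q : ℝ) (k l i j : Fin N) :
    matRinv q k l i j = (if k = j then if l = i then
          q ^ ((if i = j then (1 : ℤ) else 0) - (if i = j.rev then (1 : ℤ) else 0)) else 0 else 0)
        - (if k = i then if l = j then (q - q⁻¹) * (if j ≤ i then 1 else 0) else 0 else 0)
        + (if k = l.rev then ((q - q⁻¹) * metC q i j) * (if l ≤ i then metC q k l else 0) else 0) := by
  have hk : k ≠ l.rev → metC q k l = 0 := fun h => by simp [metC, h]
  have e1 : q ^ ((if k = l then (1 : ℤ) else 0) - (if k = l.rev then (1 : ℤ) else 0))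
      * (if i = l then 1 else 0) * (if j = k then 1 else 0) =
      (if k = j then if l = i then
      q ^ ((if i = j then (1 : ℤ) else 0) - (if i = j.rev then (1 : ℤ) else 0)) else 0 else 0) := by
    by_cases h1 : k = j
    · by_cases h2 : l = i
      · subst h1 h2
        have : (k = l.rev) ↔ (l = k.rev) := by rw [← Fin.rev_inj, Fin.rev_rev, eq_comm]
        simp [eq_comm (a := k) (b := l), this]
      · simp [h2, Ne.symm h2]
    · simp [h1, Ne.symm h1]
  have e2 : (q - q⁻¹) * (if i < l then 1 else 0)
      * ((if i = k then 1 else 0) * (if j = l then 1 else 0)) -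
        (q - q⁻¹) * ((if k = i then 1 else 0) * (if l = j then 1 else 0)) =
      - (if k = i then if l = j then (q - q⁻¹) * (if j ≤ i then 1 else 0) else 0 else 0) := by
    by_cases h1 : k = i
    · by_cases h2 : l = j
      · subst h1 h2
        by_cases h3 : k < l
        · simp [h3, not_le.2 h3]
        · simp [h3, not_lt.1 h3]
      · simp [h2, Ne.symm h2]
    · simp [h1, Ne.symm h1]
  have e3 : -((q - q⁻¹) * (if i < l then 1 else 0) * matK q k l i j)
      + (q - q⁻¹) * matK q k l i j =
      (if k = l.rev then ((q - q⁻¹) * metC q i j) * (if l ≤ i then metC q k l else 0)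
        else 0) := by
    by_cases h1 : k = l.rev
    · by_cases h3 : i < l
      · simp [h3, not_le.2 h3]
      · simp [h1, h3, not_lt.1 h3, matK]; ring
    · simp [h1, matK, hk h1]
  unfold matRinv matR
  rw [e1]
  linear_combination e2 + e3

/-- The explicit form of the action of `R⁻`. -/
theorem act_rInv (F : Fin N → Fin N → M) (i j : Fin N) :
    act (rInv 𝕜 q) F i j =
      ((q ^ ((if i = j then (1 : ℤ) else 0) - (if i = j.rev then (1 : ℤ) else 0)) : ℝ) : 𝕜) • F j i
      - ((q : 𝕜) - (q : 𝕜)⁻¹) • (if j ≤ i then F i j else 0)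
      + (((q : 𝕜) - (q : 𝕜)⁻¹) * met 𝕜 q i j) •
        ∑ l, (if l ≤ i then met 𝕜 q l.rev l • F l.rev l else 0) := by
  -- Each part of `R⁻` is supported on the flip, on the diagonal or on `k = l'`, so the double sum
  -- collapses part by part.
  have key : ∀ k l : Fin N, rInv 𝕜 q k l i j • F k l =
      (if k = j then if l = i then ((q ^ ((if i = j then (1 : ℤ) else 0)
        - (if i = j.rev then (1 : ℤ) else 0)) : ℝ) : 𝕜) • F j i else 0 else 0)
      - (if k = i then if l = j then
          ((q : 𝕜) - (q : 𝕜)⁻¹) • (if j ≤ i then F i j else 0) else 0 else 0)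
      + (if k = l.rev then (((q : 𝕜) - (q : 𝕜)⁻¹) * met 𝕜 q i j) •
        (if l ≤ i then met 𝕜 q l.rev l • F l.rev l else 0) else 0) := by
    intro k l
    have e := matRinv_eq q k l i j
    rw [rInv, e, RCLike.ofReal_add, RCLike.ofReal_sub, add_smul, sub_smul]
    congr 1
    · congr 1
      · by_cases h1 : k = j
        · by_cases h2 : l = i
          · simp only [h1, h2, if_true]
          · simp [h2]
        · simp [h1]
      · by_cases h1 : k = i
        · by_cases h2 : l = j
          · by_cases h3 : j ≤ i
            · simp [h1, h2, h3]
            · simp [h1, h3]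
          · simp [h2]
        · simp [h1]
    · by_cases h1 : k = l.rev
      · by_cases h2 : l ≤ i
        · simp [h1, h2, met, mul_smul]
        · simp [h2]
      · simp [h1]
  simp only [act, key, Finset.sum_add_distrib, Finset.sum_sub_distrib, Finset.smul_sum]
  congr 1
  · congr 1
    · rw [Finset.sum_eq_single j] <;> simp +contextual
    · rw [Finset.sum_eq_single i] <;> simp +contextual
  · rw [Finset.sum_comm]
    simp

end Recursion


/-! ### Reduction from `N + 2` to `N` -/

section Step

variable (n : ℕ)

/-- The smallest index. -/
def lo : Fin (n + 2) := 0

/-- The largest index. -/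
def hi : Fin (n + 2) := Fin.last (n + 1)

variable {n}

/-- The inclusion of the indices which are neither the smallest nor the largest. -/
def mid (i : Fin n) : Fin (n + 2) := i.castSucc.succ

theorem index_cases {p : Fin (n + 2) → Prop} (h0 : p (lo n)) (h1 : ∀ i, p (mid i))
    (h2 : p (hi n)) (i : Fin (n + 2)) : p i := by
  refine Fin.cases h0 (fun i => ?_) i
  refine Fin.lastCases h2 (fun i => ?_) i
  exact h1 i

theorem sum_index {M : Type*} [AddCommMonoid M] (f : Fin (n + 2) → M) :
    ∑ i, f i = f (lo n) + ∑ i, f (mid i) + f (hi n) := by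
  rw [Fin.sum_univ_succ, Fin.sum_univ_castSucc, ← add_assoc]; rfl

theorem rev_lo : (lo n).rev = hi n := by ext; simp [lo, hi]

theorem rev_hi : (hi n).rev = lo n := by ext; simp [lo, hi]

theorem rev_mid (i : Fin n) : (mid i).rev = mid i.rev := by
  ext; simp only [mid, Fin.val_rev, Fin.val_succ, Fin.val_castSucc]; omega

theorem mid_inj {i j : Fin n} : mid i = mid j ↔ i = j := by
  simp [mid]

theorem mid_le_mid {i j : Fin n} : mid i ≤ mid j ↔ i ≤ j := by
  simp [mid]

theorem lo_le (i : Fin (n + 2)) : lo n ≤ i := Fin.zero_le i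

theorem le_hi (i : Fin (n + 2)) : i ≤ hi n := Fin.le_last i

theorem mid_ne_lo (i : Fin n) : mid i ≠ lo n := Fin.succ_ne_zero _

theorem mid_ne_hi (i : Fin n) : mid i ≠ hi n := by
  intro h; have := congrArg Fin.val h; simp [mid, hi] at this; omega

theorem lo_ne_hi : lo n ≠ hi n := by
  intro h; have := congrArg Fin.val h; simp [lo, hi] at this

theorem mid_not_le_lo (i : Fin n) : ¬ mid i ≤ lo n := fun h =>
  mid_ne_lo i (le_antisymm h (lo_le _))

theorem hi_not_le_lo : ¬ hi n ≤ lo n := fun h => lo_ne_hi (le_antisymm h (lo_le _)).symm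

theorem hi_not_le_mid (i : Fin n) : ¬ hi n ≤ mid i := fun h =>
  mid_ne_hi i (le_antisymm (le_hi _) h)

/-- Passing from `n` to `n + 2` raises both `N/2` and the position of a middle index by one. This
makes the metric, and with it `R⁻`, recursive. -/
theorem rho_mid (i : Fin n) : rho (mid i) = rho i := by
  have h : (mid i : ℕ) = i + 1 := rfl
  unfold rho
  rw [h]
  push_cast
  split_ifs <;> first | omega | ring

theorem rho_lo : rho (lo n) = n / 2 := by
  have h : (lo n : ℕ) = 0 := rfl
  unfold rho
  rw [h, if_pos (by omega)]; push_cast; ring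

theorem rho_hi : rho (hi n) = -(n / 2) := by
  rw [← rev_lo, rho_rev, rho_lo]

variable (𝕜 : Type*) [RCLike 𝕜]

/-- The number `q^{n/2}`. -/
noncomputable def halfPow (q : ℝ) (n : ℕ) : 𝕜 := ((q ^ ((n : ℝ) / 2) : ℝ) : 𝕜)

variable {𝕜} {q : ℝ}

theorem halfPow_sq (hq : 0 < q) : halfPow 𝕜 q n ^ 2 = (q : 𝕜) ^ n := by
  rw [halfPow, ← RCLike.ofReal_pow, ← RCLike.ofReal_pow, ← Real.rpow_natCast, ← Real.rpow_mul hq.le,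
    ← Real.rpow_natCast q n]
  congr 2; push_cast; ring

theorem halfPow_ne_zero (hq : 0 < q) : halfPow 𝕜 q n ≠ 0 := by
  rw [halfPow]; exact_mod_cast (Real.rpow_pos_of_pos hq _).ne'

theorem met_lo_lo : met 𝕜 q (lo n) (lo n) = 0 := met_eq_zero (by rw [rev_lo]; exact lo_ne_hi)
theorem met_hi_hi : met 𝕜 q (hi n) (hi n) = 0 := met_eq_zero (by rw [rev_hi]; exact lo_ne_hi.symm)
theorem met_lo_mid (i : Fin n) : met 𝕜 q (lo n) (mid i) = 0 :=
  met_eq_zero (by rw [rev_mid]; exact (mid_ne_lo _).symm)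
theorem met_hi_mid (i : Fin n) : met 𝕜 q (hi n) (mid i) = 0 :=
  met_eq_zero (by rw [rev_mid]; exact (mid_ne_hi _).symm)
theorem met_mid_lo (i : Fin n) : met 𝕜 q (mid i) (lo n) = 0 :=
  met_eq_zero (by rw [rev_lo]; exact mid_ne_hi _)
theorem met_mid_hi (i : Fin n) : met 𝕜 q (mid i) (hi n) = 0 :=
  met_eq_zero (by rw [rev_hi]; exact mid_ne_lo _)
theorem met_mid_mid (i j : Fin n) : met 𝕜 q (mid i) (mid j) = met 𝕜 q i j := by
  simp [met, metC, rev_mid, mid_inj, rho_mid]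
theorem met_hi_lo : met 𝕜 q (hi n) (lo n) = halfPow 𝕜 q n := by
  simp [met, metC, rev_lo, rho_hi, halfPow]
theorem met_lo_hi (hq : 0 < q) : met 𝕜 q (lo n) (hi n) = (halfPow 𝕜 q n)⁻¹ := by
  simp [met, metC, rev_hi, rho_lo, halfPow, Real.rpow_neg hq.le]

variable {M : Type*} [AddCommGroup M] [Module 𝕜 M]

theorem contr_met (F : Fin n → Fin n → M) :
    contr (met 𝕜 q) F = ∑ l, met 𝕜 q l.rev l • F l.rev l := by
  rw [contr, Finset.sum_comm]
  refine Finset.sum_congr rfl fun l _ => ?_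
  rw [Finset.sum_eq_single l.rev] <;> simp +contextual [met_eq_zero]

theorem contr_met_step (hq : 0 < q) (F : Fin (n + 2) → Fin (n + 2) → M) :
    contr (met 𝕜 q) F = halfPow 𝕜 q n • F (hi n) (lo n) +
      contr (met 𝕜 q) (fun k l => F (mid k) (mid l)) +
      (halfPow 𝕜 q n)⁻¹ • F (lo n) (hi n) := by
  rw [contr_met, sum_index, contr_met]
  simp only [rev_lo, rev_mid, rev_hi, met_hi_lo, met_lo_hi hq, met_mid_mid]

variable (F : Fin (n + 2) → Fin (n + 2) → M)

theorem act_lo_lo : act (rInv 𝕜 q) F (lo n) (lo n) = (q : 𝕜)⁻¹ • F (lo n) (lo n) := by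
  rw [act_rInv, met_lo_lo, rev_lo, if_neg lo_ne_hi]
  simp
  module

theorem act_hi_hi : act (rInv 𝕜 q) F (hi n) (hi n) = (q : 𝕜)⁻¹ • F (hi n) (hi n) := by
  rw [act_rInv, met_hi_hi, rev_hi, if_neg lo_ne_hi.symm]
  simp
  module

theorem act_lo_mid (j : Fin n) : act (rInv 𝕜 q) F (lo n) (mid j) = F (mid j) (lo n) := by
  rw [act_rInv, met_lo_mid, if_neg (mid_ne_lo j).symm, rev_mid, if_neg (mid_ne_lo _).symm,
    if_neg (mid_not_le_lo j)]
  simp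

theorem act_mid_lo (j : Fin n) : act (rInv 𝕜 q) F (mid j) (lo n) =
    F (lo n) (mid j) - ((q : 𝕜) - (q : 𝕜)⁻¹) • F (mid j) (lo n) := by
  rw [act_rInv, met_mid_lo, if_neg (mid_ne_lo j), rev_lo, if_neg (mid_ne_hi _), if_pos (lo_le _)]
  simp

theorem act_mid_hi (j : Fin n) : act (rInv 𝕜 q) F (mid j) (hi n) = F (hi n) (mid j) := by
  rw [act_rInv, met_mid_hi, if_neg (mid_ne_hi j), rev_hi, if_neg (mid_ne_lo _),
    if_neg (hi_not_le_mid j)]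
  simp

theorem act_hi_mid (j : Fin n) : act (rInv 𝕜 q) F (hi n) (mid j) =
    F (mid j) (hi n) - ((q : 𝕜) - (q : 𝕜)⁻¹) • F (hi n) (mid j) := by
  rw [act_rInv, met_hi_mid, if_neg (mid_ne_hi j).symm, rev_mid, if_neg (mid_ne_hi _).symm,
    if_pos (le_hi _)]
  simp

/-- Only `l = lo` satisfies `l ≤ lo`, so the trace part contributes `h F(hi, lo)` and completes the
flip coefficient `q⁻¹` to `q`. -/
theorem act_lo_hi (hq : 0 < q) :
    act (rInv 𝕜 q) F (lo n) (hi n) = (q : 𝕜) • F (hi n) (lo n) := by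
  have h := halfPow_ne_zero (𝕜 := 𝕜) (n := n) hq
  have hq' : (q : 𝕜) ≠ 0 := by exact_mod_cast hq.ne'
  rw [act_rInv, if_neg lo_ne_hi, rev_hi, if_pos rfl, if_neg hi_not_le_lo, sum_index]
  simp only [mid_not_le_lo, hi_not_le_lo, if_false, if_pos (lo_le _), rev_lo, met_hi_lo,
    met_lo_hi hq, Finset.sum_const_zero, zero_sub, zpow_neg, zpow_one, RCLike.ofReal_inv]
  match_scalars
  field_simp
  ring

/-- Every `l` satisfies `l ≤ hi`, so the full contraction enters. This is the only corner that sees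
the inner block. -/
theorem act_hi_lo (hq : 0 < q) :
    act (rInv 𝕜 q) F (hi n) (lo n) = (q : 𝕜) • F (lo n) (hi n)
      + ((q : 𝕜) - (q : 𝕜)⁻¹) • (((q : 𝕜) ^ n - 1) • F (hi n) (lo n)
      + halfPow 𝕜 q n • contr (met 𝕜 q) (fun k l => F (mid k) (mid l))) := by
  have h := halfPow_ne_zero (𝕜 := 𝕜) (n := n) hq
  have hq' : (q : 𝕜) ≠ 0 := by exact_mod_cast hq.ne'
  rw [act_rInv, if_neg lo_ne_hi.symm, rev_lo, if_pos rfl, if_pos (lo_le _)]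
  simp only [if_pos (le_hi _)]
  rw [← contr_met, contr_met_step hq, met_hi_lo, ← halfPow_sq hq]
  simp only [zero_sub, zpow_neg, zpow_one, RCLike.ofReal_inv]
  match_scalars
  · field_simp
    ring
  · field_simp
    ring
  · field_simp

/-- Among the outer indices only `lo` lies below a middle index, so the inner block reproduces `R⁻`
for `n` up to the single extra trace term with `l = lo`. -/
theorem act_mid_mid (i j : Fin n) :
    act (rInv 𝕜 q) F (mid i) (mid j) = act (rInv 𝕜 q) (fun k l => F (mid k) (mid l)) i j
      + (((q : 𝕜) - (q : 𝕜)⁻¹) * halfPow 𝕜 q n * met 𝕜 q i j) • F (hi n) (lo n) := by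
  rw [act_rInv, act_rInv, sum_index]
  simp only [mid_inj, rev_mid, mid_le_mid, met_mid_mid, rev_lo, met_hi_lo, if_pos (lo_le _),
    hi_not_le_mid, if_false]
  module

end Step


/-! ### The quadratic relation of the `R`-matrix -/

section Quadratic

variable {𝕜 : Type*} [RCLike 𝕜] {q : ℝ} {M : Type*} [AddCommGroup M] [Module 𝕜 M]

theorem ofReal_ne_zero_of_pos (𝕜 : Type*) [RCLike 𝕜] {q : ℝ} (hq : 0 < q) : (q : 𝕜) ≠ 0 := by
  exact_mod_cast hq.ne'

/-- The two outer antidiagonal entries add `q^n + q^{-n}` to the trace of `K`; after multiplication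
by `h` these increments sum to a closed form. -/
theorem contr_met_met (hq : 0 < q) (n : ℕ) :
    ((q : 𝕜) - (q : 𝕜)⁻¹) * contr (met 𝕜 q) (met 𝕜 q : Fin n → Fin n → 𝕜) =
      (q : 𝕜) ^ n * (q : 𝕜)⁻¹ + q - (q : 𝕜)⁻¹ - q * ((q : 𝕜) ^ n)⁻¹ := by
  have hq' := ofReal_ne_zero_of_pos 𝕜 hq
  induction n using Nat.twoStepInduction with
  | zero => simp [contr]
  | one =>
    have : met 𝕜 q (0 : Fin 1) 0 = 1 := by simp [met, metC, rho]
    simp only [contr, Finset.univ_unique, Fin.default_eq_zero, Finset.sum_singleton, this,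
      smul_eq_mul, pow_one]
    field_simp
    ring
  | more n ih _ =>
    have hp := halfPow_ne_zero (𝕜 := 𝕜) (n := n) hq
    have h2 : ((q : 𝕜) ^ n)⁻¹ = (halfPow 𝕜 q n)⁻¹ ^ 2 := by rw [inv_pow, halfPow_sq hq]
    have h3 := halfPow_sq (𝕜 := 𝕜) (n := n) hq
    rw [contr_met_step hq]
    simp only [met_mid_mid, met_hi_lo, met_lo_hi hq, smul_eq_mul]
    have e : (q : 𝕜) ^ (n + 2) = q ^ n * q ^ 2 := pow_add _ _ _
    rw [e, mul_inv, h2]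
    rw [h2] at ih
    rw [mul_add, mul_add, show (fun k l : Fin n => met 𝕜 q k l) = met 𝕜 q from rfl, ih, ← h3]
    field_simp
    ring

/-- Only the corner `(hi, lo)` involves the contraction of the inner block, and there the value of
the trace of `K` closes the induction. -/
theorem act_rInv_met (hq : 0 < q) {n : ℕ} (m : M) (i j : Fin n) :
    act (rInv 𝕜 q) (fun k l => met 𝕜 q k l • m) i j =
      ((q : 𝕜) ^ n * (q : 𝕜)⁻¹ * met 𝕜 q i j) • m := by
  have hq' := ofReal_ne_zero_of_pos 𝕜 hq
  induction n using Nat.twoStepInduction with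
  | zero => exact i.elim0
  | one =>
    have : met 𝕜 q (0 : Fin 1) 0 = 1 := by simp [met, metC, rho]
    fin_cases i; fin_cases j
    rw [act_rInv]
    simp [this, hq']
  | more n ih _ =>
    have hp := halfPow_ne_zero (𝕜 := 𝕜) (n := n) hq
    have h3 := halfPow_sq (𝕜 := 𝕜) (n := n) hq
    have e : (q : 𝕜) ^ (n + 2) = q ^ n * q ^ 2 := pow_add _ _ _
    have hk := contr_met_met (𝕜 := 𝕜) hq n
    have hk' : contr (met 𝕜 q) (fun k l : Fin n => met 𝕜 q k l • m) =
        contr (met 𝕜 q) (met 𝕜 q : Fin n → Fin n → 𝕜) • m := by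
      simp [contr, Finset.sum_smul, smul_smul]
    rw [e, ← h3]
    induction i using index_cases <;> induction j using index_cases <;>
      simp only [act_lo_lo, act_hi_hi, act_lo_mid, act_mid_lo, act_mid_hi, act_hi_mid, act_mid_mid,
        act_lo_hi _ hq, act_hi_lo _ hq, met_lo_lo, met_hi_hi, met_lo_mid, met_hi_mid, met_mid_lo,
        met_mid_hi, met_mid_mid, met_hi_lo, met_lo_hi hq, ih, hk', ← h3]
    case h0.h0 => simp
    case h2.h2 => simp
    case h0.h1 => simp
    case h1.h0 => simp
    case h1.h2 => simp
    case h2.h1 => simp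
    case h0.h2 => match_scalars; field_simp
    case h1.h1 => match_scalars; field_simp; ring
    case h2.h0 =>
      rw [← h3] at hk
      match_scalars
      linear_combination (norm := (field_simp; ring)) halfPow 𝕜 q n * hk

theorem contr_met_act (hq : 0 < q) {n : ℕ} (F : Fin n → Fin n → M) :
    contr (met 𝕜 q) (act (rInv 𝕜 q) F) =
      ((q : 𝕜) ^ n * (q : 𝕜)⁻¹) • contr (met 𝕜 q) F := by
  have hq' := ofReal_ne_zero_of_pos 𝕜 hq
  induction n using Nat.twoStepInduction with
  | zero => simp [contr]
  | one =>
    have : met 𝕜 q (0 : Fin 1) 0 = 1 := by simp [met, metC, rho]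
    simp [contr, act_rInv, this, hq']
  | more n ih _ =>
    have hp := halfPow_ne_zero (𝕜 := 𝕜) (n := n) hq
    have h3 := halfPow_sq (𝕜 := 𝕜) (n := n) hq
    have e : (q : 𝕜) ^ (n + 2) = q ^ n * q ^ 2 := pow_add _ _ _
    have hk := contr_met_met (𝕜 := 𝕜) hq n
    have hk' : contr (met 𝕜 q) (fun k l : Fin n => met 𝕜 q k l • F (hi n) (lo n)) =
        contr (met 𝕜 q) (met 𝕜 q : Fin n → Fin n → 𝕜) • F (hi n) (lo n) := by
      simp [contr, Finset.sum_smul, smul_smul]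
    rw [e, contr_met_step hq, contr_met_step hq]
    simp only [act_lo_hi _ hq, act_hi_lo _ hq, act_mid_mid, mul_smul, contr_add, contr_smul, hk']
    rw [show contr (met 𝕜 q) (fun k l : Fin n => act (rInv 𝕜 q) (fun k l => F (mid k) (mid l)) k l)
      = _ from ih _, smul_comm _ (halfPow 𝕜 q n) (contr _ _ • _), smul_smul _ (contr _ _), hk, ← h3]
    match_scalars
    all_goals field_simp
    all_goals ring

/-- Since `R = R⁻ + h (1 - K)` and `K R⁻ = q^{N-1} K`, this amounts to `R R⁻ = 1`. On families with
zero contraction it reads `(R⁻ - q⁻¹)(R⁻ + q) = 0`. -/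
theorem act_act (hq : 0 < q) {n : ℕ} (F : Fin n → Fin n → M) (i j : Fin n) :
    act (rInv 𝕜 q) (act (rInv 𝕜 q) F) i j = F i j
      - ((q : 𝕜) - (q : 𝕜)⁻¹) • act (rInv 𝕜 q) F i j
      + (((q : 𝕜) - (q : 𝕜)⁻¹) * ((q : 𝕜) ^ n * (q : 𝕜)⁻¹) * met 𝕜 q i j) • contr (met 𝕜 q) F := by
  have hq' := ofReal_ne_zero_of_pos 𝕜 hq
  induction n using Nat.twoStepInduction with
  | zero => exact i.elim0
  | one =>
    have : met 𝕜 q (0 : Fin 1) 0 = 1 := by simp [met, metC, rho]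
    fin_cases i; fin_cases j
    simp [contr, act_rInv, this, hq']
  | more n ih _ =>
    have hp := halfPow_ne_zero (𝕜 := 𝕜) (n := n) hq
    have h3 := halfPow_sq (𝕜 := 𝕜) (n := n) hq
    have e : (q : 𝕜) ^ (n + 2) = q ^ n * q ^ 2 := pow_add _ _ _
    have hk := contr_met_met (𝕜 := 𝕜) hq n
    rw [contr_met_step hq, e, ← h3]
    induction i using index_cases <;> induction j using index_cases <;>
      simp only [act_lo_lo, act_hi_hi, act_lo_mid, act_mid_lo, act_mid_hi, act_hi_mid, act_mid_mid,
        act_lo_hi _ hq, act_hi_lo _ hq, met_lo_lo, met_hi_hi, met_lo_mid, met_hi_mid, met_mid_lo,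
        met_mid_hi, met_mid_mid, met_hi_lo, met_lo_hi hq, ← h3, mul_zero, zero_smul, add_zero]
    case h0.h0 => match_scalars; field_simp; ring
    case h2.h2 => match_scalars; field_simp; ring
    case h0.h2 => match_scalars <;> field_simp <;> ring
    case h1.h1 i j =>
      have h1 := ih (fun k l => F (mid k) (mid l)) i j
      have h2 := act_rInv_met (𝕜 := 𝕜) hq (F (hi n) (lo n)) i j
      simp only [act_add, mul_smul, act_smul, h2, h1, ← h3]
      match_scalars <;> field_simp <;> ring
    case h2.h0 =>
      have h1 := contr_met_act (𝕜 := 𝕜) hq (fun k l => F (mid k) (mid l))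
      have hk' : contr (met 𝕜 q) (fun k l : Fin n => met 𝕜 q k l • F (hi n) (lo n)) =
        contr (met 𝕜 q) (met 𝕜 q : Fin n → Fin n → 𝕜) • F (hi n) (lo n) := by
        simp [contr, Finset.sum_smul, smul_smul]
      simp only [contr_add, mul_smul, contr_smul, h1, hk', ← h3]
      rw [smul_comm _ (halfPow 𝕜 q n) (contr _ _ • _), smul_smul _ (contr _ _), hk, ← h3]
      match_scalars <;> field_simp <;> ring

end Quadratic


/-! ### Crossing relations -/

section Crossing

theorem metC_rev_mul {N : ℕ} {q : ℝ} (hq : 0 < q) (i : Fin N) :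
    metC q i.rev i * metC q i i.rev = 1 := by
  simp only [metC, Fin.rev_rev, if_true, rho_rev]
  rw [← Real.rpow_add hq]; simp

theorem matR_symm {N : ℕ} (q : ℝ) (k l i j : Fin N) : matR q k l i j = matR q i j k l := by
  unfold matR
  have e1 : q ^ ((if k = l then (1 : ℤ) else 0) - (if k = l.rev then (1 : ℤ) else 0))
      * (if i = l then 1 else 0) * (if j = k then 1 else 0) =
      q ^ ((if i = j then (1 : ℤ) else 0) - (if i = j.rev then (1 : ℤ) else 0))
      * (if k = j then 1 else 0) * (if l = i then 1 else 0) := by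
    by_cases h1 : k = j
    · by_cases h2 : l = i
      · subst h1 h2
        have : (k = l.rev) ↔ (l = k.rev) := by rw [← Fin.rev_inj, Fin.rev_rev, eq_comm]
        simp [eq_comm (a := k) (b := l), this]
      · simp [h2, Ne.symm h2]
    · simp [h1, Ne.symm h1]
  have e2 : (if i < l then 1 else 0) * ((if i = k then 1 else 0) * (if j = l then (1 : ℝ) else 0)) =
      (if k < j then 1 else 0) * ((if k = i then 1 else 0) * (if l = j then (1 : ℝ) else 0)) := by
    by_cases h1 : i = k
    · by_cases h2 : j = l
      · subst h1 h2; simp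
      · simp [h2, Ne.symm h2]
    · simp [h1, Ne.symm h1]
  have e3 : (if i < l then 1 else 0) * matK q k l i j =
      (if k < j then 1 else 0) * matK q i j k l := by
    by_cases h1 : i = j.rev
    · by_cases h2 : k = l.rev
      · have : i < l ↔ k < j := by rw [h1, h2, Fin.rev_lt_iff]
        simp [this, matK, mul_comm]
      · simp [matK, metC, h2]
    · simp [matK, metC, h1]
  rw [e1]
  linear_combination (q - q⁻¹) * e2 - (q - q⁻¹) * e3

theorem matRinv_symm {N : ℕ} (q : ℝ) (k l i j : Fin N) :
    matRinv q k l i j = matRinv q i j k l := by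
  unfold matRinv
  simp only [matR_symm q k l, matK, mul_comm (metC q i j), eq_comm (a := k) (b := i), eq_comm (a := l) (b := j)]

/-- Rotating an inverse crossing by the metric gives a crossing: the flip part goes to the flip
part, while the diagonal part of `R⁻` becomes the trace part of `R` and conversely. -/
theorem crossing_left {N : ℕ} {q : ℝ} (hq : 0 < q) (m k l j : Fin N) :
    metC q m m.rev * matRinv q k l m.rev j = matR q m k j l.rev * metC q l.rev l := by
  have hl := metC_rev_mul hq l.rev
  have hm := metC_rev_mul hq m
  rw [Fin.rev_rev] at hl
  have E1 : (if k = l.rev then ((q - q⁻¹) * metC q m.rev j) * (if l ≤ m.rev then metC q k l else 0)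
      else 0) * metC q m m.rev = (if j = m ∧ k = l.rev then (q - q⁻¹) *
        (if l ≤ m.rev then metC q l.rev l else 0) else 0) := by
    by_cases h1 : k = l.rev
    · by_cases h2 : j = m
      · subst h1 h2; simp only [if_true, and_self]; linear_combination ((q - q⁻¹) * if l ≤ j.rev then metC q l.rev l else 0) * hm
      · simp [metC, h1, h2, Fin.rev_inj, Ne.symm h2]
    · simp [h1]
  have E2 : matK q m k j l.rev * metC q l.rev l = if k = m.rev ∧ l = j then metC q m m.rev else 0 := by
    by_cases h1 : k = m.rev
    · by_cases h2 : l = j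
      · subst h1 h2; simp [matK]; linear_combination metC q m m.rev * hl
      · simp [matK, metC, h2, Ne.symm h2]
    · have : m ≠ k.rev := fun h => h1 (by rw [h, Fin.rev_rev])
      simp [matK, metC, h1, this]
  rw [matRinv_eq, mul_add, mul_comm (metC q m m.rev) (ite (k = l.rev) _ _), E1, matR, add_mul,
    mul_assoc _ (_ - _), sub_mul _ (matK _ _ _ _ _), E2]
  -- The cases are the support patterns: flip (`hA`), diagonal part of `R⁻` (`hB`), trace part of
  -- `R⁻` (`hD`). Outside the flip pattern the weak inequalities of `R⁻` agree with the strict ones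
  -- of `R`; inside it the exponent of `q` accounts for the difference.
  by_cases hA : k = j ∧ l = m.rev
  · obtain ⟨rfl, rfl⟩ := hA
    have e1 : m.rev = k ↔ k = m.rev := eq_comm
    have e2 : m = k ↔ k = m := eq_comm
    have e3 : m = k.rev ↔ k = m.rev := by rw [← Fin.rev_inj, Fin.rev_rev, eq_comm]
    simp only [Fin.rev_rev, Fin.rev_inj, e1, e2, e3]
    by_cases h1 : k = m
    · by_cases h2 : k = m.rev
      · subst h1
        simp [← h2]
        ring
      · have : m ≠ m.rev := fun h => h2 (h1 ▸ h)
        simp [h1, this]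
        try ring
    · by_cases h2 : k = m.rev
      · have : m.rev ≠ m := fun h => h1 (h2.trans h)
        simp [h2, this]
        try ring
      · simp [h1, h2]
        try ring
  · have h0 : (if k = j then if l = m.rev then q ^ ((if m.rev = j then (1 : ℤ) else 0) -
        (if m.rev = j.rev then (1 : ℤ) else 0)) else 0 else 0) = 0 := by
      split_ifs <;> first | rfl | exact absurd ⟨‹_›, ‹_›⟩ hA
    have h0' : (if j = k then 1 else 0) * (if l.rev = m then (1 : ℝ) else 0) = 0 := by
      by_cases h1 : j = k
      · have : l.rev ≠ m := fun h => hA ⟨h1.symm, by rw [← h, Fin.rev_rev]⟩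
        simp [this]
      · simp [h1]
    rw [h0, mul_assoc (q ^ _), h0']
    by_cases hB : k = m.rev ∧ l = j
    · obtain ⟨rfl, rfl⟩ := hB
      have h1 : l ≠ m.rev := fun h => hA ⟨h.symm, h⟩
      have h2 : (l ≤ m.rev) ↔ l < m.rev := ⟨fun h => lt_of_le_of_ne h h1, le_of_lt⟩
      by_cases h3 : l = m
      · have h5 : ¬ (m.rev = m ∧ True) := fun h => h1 (h3.trans h.1.symm)
        subst h3
        simp [h2]
        split_ifs <;> ring
      · have h4 : ¬ m.rev = l.rev := fun h => h3 (Fin.rev_inj.1 h).symm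
        simp [h2, h3]
        split_ifs <;> ring
    · have h3 : (if k = m.rev then if l = j then (q - q⁻¹) * (if j ≤ m.rev then 1 else 0) else 0 else 0)
          = 0 := by
        split_ifs <;> first | exact absurd ⟨‹_›, ‹_›⟩ hB | simp
      rw [h3]
      by_cases hD : j = m ∧ k = l.rev
      · obtain ⟨rfl, rfl⟩ := hD
        have h1 : l ≠ j.rev := fun h => hA ⟨by rw [h, Fin.rev_rev], h⟩
        have h2 : (l ≤ j.rev) ↔ j < l.rev := by
          rw [Fin.lt_rev_iff]; exact ⟨fun h => lt_of_le_of_ne h h1, le_of_lt⟩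
        have hB' : ¬ (l.rev = j.rev ∧ l = j) := hB
        simp only [h2, if_true, and_self, if_neg hB']
        split_ifs <;> ring
      · have hD' : (if j = m then (1 : ℝ) else 0) * (if l.rev = k then 1 else 0) = 0 := by
          by_cases h1 : j = m
          · have : l.rev ≠ k := fun h => hD ⟨h1, h.symm⟩
            simp [this]
          · simp [h1]
        rw [if_neg hB, if_neg hD, hD']
        ring

theorem metC_rev_rev {N : ℕ} (q : ℝ) (i j : Fin N) : metC q j.rev i.rev = metC q i j := by
  by_cases h : i = j.rev
  · subst h; simp [metC]
  · have : j.rev ≠ i := Ne.symm h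
    simp [metC, h, this]

theorem matRinv_rev {N : ℕ} (q : ℝ) (k l i j : Fin N) :
    matRinv q l.rev k.rev j.rev i.rev = matRinv q k l i j := by
  rw [matRinv_eq, matRinv_eq]
  simp only [Fin.rev_inj, Fin.rev_rev, Fin.rev_le_rev, metC_rev_rev]
  congr 1
  · congr 1
    · have e1 : (j.rev = i) ↔ i = j.rev := eq_comm
      by_cases h1 : k = j <;> by_cases h2 : l = i <;> simp [h1, h2, e1, eq_comm (a := i) (b := j)]
    · by_cases h1 : k = i <;> by_cases h2 : l = j <;> simp [h1, h2]
  · have e1 : (l.rev = k) ↔ k = l.rev := eq_comm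
    simp only [e1]
    by_cases h1 : k = l.rev
    · by_cases h2 : i = j.rev
      · have : j ≤ l.rev ↔ l ≤ j.rev := Fin.le_rev_iff
        simp [h1, h2, this]
      · simp [metC, h2]
    · simp [h1]

/-- `R⁻` preserves weights: an entry vanishes unless `(k, l)` is a rearrangement of `(i, j)` or both
pairs are antidiagonal, and then both metric products equal `1`. -/
theorem matRinv_weight {N : ℕ} {q : ℝ} (hq : 0 < q) (k l i j : Fin N) :
    metC q k k.rev * metC q l l.rev * matRinv q k l i j =
      metC q i i.rev * metC q j j.rev * matRinv q k l i j := by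
  rw [matRinv_eq]
  by_cases h1 : k = j ∧ l = i
  · rw [h1.1, h1.2]; ring
  by_cases h2 : k = i ∧ l = j
  · rw [h2.1, h2.2]
  by_cases h3 : k = l.rev ∧ i = j.rev
  · have h := metC_rev_mul hq l.rev
    have h' := metC_rev_mul hq j.rev
    rw [Fin.rev_rev] at h h'
    rw [h3.1, h3.2, Fin.rev_rev, Fin.rev_rev, mul_comm (metC q l.rev l), h,
      mul_comm (metC q j.rev j), h']
  · have e : (if k = j then if l = i then q ^ ((if i = j then (1 : ℤ) else 0) -
        (if i = j.rev then (1 : ℤ) else 0)) else 0 else 0) = 0 := by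
      split_ifs <;> first | rfl | exact absurd ⟨‹_›, ‹_›⟩ h1
    have e2 : (if k = i then if l = j then (q - q⁻¹) * (if j ≤ i then 1 else 0) else 0 else 0) = 0 := by
      split_ifs <;> first | exact absurd ⟨‹_›, ‹_›⟩ h2 | simp
    have e3 : (if k = l.rev then ((q - q⁻¹) * metC q i j) * (if l ≤ i then metC q k l else 0) else 0)
        = 0 := by
      by_cases h4 : k = l.rev
      · have : i ≠ j.rev := fun h => h3 ⟨h4, h⟩
        simp [metC, this]
      · simp [h4]
    rw [e, e2, e3]; ring

/-- The mirror image of `crossing_left` under `matRinv_rev`; `matRinv_weight` exchanges the metric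
factors that end up at the wrong indices. -/
theorem crossing_right {N : ℕ} {q : ℝ} (hq : 0 < q) (k l i p : Fin N) :
    matRinv q k l i p.rev * metC q p.rev p = metC q k k.rev * matR q l p k.rev i := by
  have h1 := crossing_left hq l p i.rev k.rev
  rw [Fin.rev_rev, ← matRinv_rev, Fin.rev_rev, Fin.rev_rev, Fin.rev_rev] at h1
  have h2 := matRinv_weight hq k l i p.rev
  rw [Fin.rev_rev] at h2
  have h3 := metC_rev_mul hq i
  have h4 := matRinv_symm q k l i p.rev
  linear_combination (-matRinv q k l i p.rev * metC q p.rev p + metC q k k.rev * matR q l p k.rev i)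
    * h3 + metC q i.rev i * metC q k k.rev * h1 - metC q i.rev i * h2
      + metC q i.rev i * metC q k k.rev * metC q l l.rev * h4

variable {𝕜 : Type*} [RCLike 𝕜] {M : Type*} [AddCommGroup M] [Module 𝕜 M] {N : ℕ} {q : ℝ}

variable (𝕜) in
/-- The `R`-matrix with entries in `𝕜`. -/
noncomputable def rMat {N : ℕ} (q : ℝ) (k l i j : Fin N) : 𝕜 := (matR q k l i j : 𝕜)

theorem act_rMat (F : Fin N → Fin N → M) (i j : Fin N) :
    act (rMat 𝕜 q) F i j = act (rInv 𝕜 q) F i j + ((q : 𝕜) - (q : 𝕜)⁻¹) • F i j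
      - (((q : 𝕜) - (q : 𝕜)⁻¹) * met 𝕜 q i j) • contr (met 𝕜 q) F := by
  have e : ∀ k l, rMat 𝕜 q k l i j • F k l = rInv 𝕜 q k l i j • F k l +
      ((q : 𝕜) - (q : 𝕜)⁻¹) • (if k = i then if l = j then F k l else 0 else 0) -
      (((q : 𝕜) - (q : 𝕜)⁻¹) * met 𝕜 q i j) • met 𝕜 q k l • F k l := by
    intro k l
    have : matR q k l i j = matRinv q k l i j
        + (q - q⁻¹) * ((if k = i then 1 else 0) * (if l = j then 1 else 0))
        - (q - q⁻¹) * metC q i j * metC q k l := by rw [matRinv, matK]; ring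
    rw [rMat, this, rInv, met, met]
    by_cases h1 : k = i <;> by_cases h2 : l = j <;> simp [h1, h2, sub_smul, add_smul, mul_smul]
  simp only [act, contr, e, Finset.sum_add_distrib, Finset.sum_sub_distrib, Finset.smul_sum]
  congr 2
  rw [Finset.sum_eq_single i] <;> simp +contextual

theorem act_rInv_act_rMat (hq : 0 < q) (F : Fin N → Fin N → M) (i j : Fin N) :
    act (rInv 𝕜 q) (act (rMat 𝕜 q) F) i j = F i j := by
  have h : act (rMat 𝕜 q) F = fun i j => act (rInv 𝕜 q) F i j + ((q : 𝕜) - (q : 𝕜)⁻¹) • F i j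
      - ((q : 𝕜) - (q : 𝕜)⁻¹) • (met 𝕜 q i j • contr (met 𝕜 q) F) := by
    funext i j; rw [act_rMat, mul_smul]
  have h1 : act (rInv 𝕜 q) (fun i j => act (rInv 𝕜 q) F i j) i j = _ := act_act hq F i j
  rw [h, act_sub, act_add, act_smul, act_smul, act_rInv_met hq, h1]
  module

theorem act_rMat_act_rInv (hq : 0 < q) (F : Fin N → Fin N → M) (i j : Fin N) :
    act (rMat 𝕜 q) (act (rInv 𝕜 q) F) i j = F i j := by
  rw [act_rMat, act_act hq, contr_met_act hq]
  module

/-- Moving `R⁻` through the first leg of the metric. -/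
theorem contr_act_left (hq : 0 < q) (F : Fin N → Fin N → Fin N → M) (j : Fin N) :
    contr (met 𝕜 q) (fun m i => act (rInv 𝕜 q) (F m) i j) =
      contr (met 𝕜 q) (fun n l => act (rMat 𝕜 q) (fun m k => F m k l) j n) := by
  rw [contr_met, contr_met]
  simp only [act, Finset.smul_sum]
  rw [← Equiv.sum_comp Fin.revPerm, Finset.sum_comm_cycle]
  refine Finset.sum_congr rfl fun l _ => Finset.sum_congr rfl fun m _ =>
    Finset.sum_congr rfl fun k _ => ?_
  have := congrArg (fun r : ℝ => (r : 𝕜)) (crossing_left hq m k l j)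
  simp only [RCLike.ofReal_mul] at this
  simp only [Fin.revPerm_apply, Fin.rev_rev, smul_smul]
  rw [met, rInv, this, mul_comm]; rfl

/-- Moving `R⁻` through the second leg of the metric. -/
theorem contr_act_right (hq : 0 < q) (F : Fin N → Fin N → Fin N → M) (i : Fin N) :
    contr (met 𝕜 q) (fun a b => act (rInv 𝕜 q) (fun c k => F c k b) i a) =
      contr (met 𝕜 q) (fun c m => act (rMat 𝕜 q) (F c) m i) := by
  rw [contr_met, contr_met]
  simp only [act, Finset.smul_sum]
  rw [← Equiv.sum_comp Fin.revPerm (fun l => ∑ k, ∑ b, met 𝕜 q l.rev l • rMat 𝕜 q k b l i •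
    F l.rev k b), Finset.sum_comm, Finset.sum_congr rfl]
  intro c _
  rw [Finset.sum_comm]
  refine Finset.sum_congr rfl fun k _ => Finset.sum_congr rfl fun b _ => ?_
  have := congrArg (fun r : ℝ => (r : 𝕜)) (crossing_right hq c k i b)
  simp only [RCLike.ofReal_mul] at this
  simp only [Fin.revPerm_apply, Fin.rev_rev, smul_smul]
  rw [met, rInv, mul_comm, this]; rfl

/-- In tensor diagrams, a strand crossing one leg of the cup `C` may cross the other leg instead,
with `R` in place of `R⁻`. -/
theorem act_met_left (hq : 0 < q) (H : Fin N → M) (a b k : Fin N) :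
    act (rInv 𝕜 q) (fun c d => met 𝕜 q a c • H d) b k =
      act (rMat 𝕜 q) (fun d n => met 𝕜 q n k • H d) a b := by
  simp only [act]
  rw [Finset.sum_eq_single a.rev, Finset.sum_congr rfl]
  · intro d _
    rw [Finset.sum_eq_single k.rev]
    · have := congrArg (fun r : ℝ => (r : 𝕜)) (crossing_left hq a b k d)
      simp only [RCLike.ofReal_mul] at this
      rw [smul_smul, smul_smul, rInv, matRinv_symm, rMat, matR_symm, mul_comm]
      exact congrArg (· • H d) this
    · intro n _ hn; rw [met_eq_zero hn]; simp
    · simp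
  · intro c _ hc
    have : a ≠ c.rev := fun h => hc (by rw [h, Fin.rev_rev])
    simp [met_eq_zero this]
  · simp

theorem act_met_right (hq : 0 < q) (H : Fin N → M) (i a b : Fin N) :
    act (rInv 𝕜 q) (fun c d => met 𝕜 q d b • H c) i a =
      act (rMat 𝕜 q) (fun m c => met 𝕜 q i m • H c) a b := by
  simp only [act]
  refine Finset.sum_comm.trans ((Finset.sum_eq_single b.rev ?_ ?_).trans (Eq.trans ?_
    (Finset.sum_eq_single i.rev ?_ ?_).symm))
  · intro d _ hd
    simp [met_eq_zero hd]
  · simp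
  · refine Finset.sum_congr rfl fun c _ => ?_
    have := congrArg (fun r : ℝ => (r : 𝕜)) (crossing_right hq i a c b)
    simp only [RCLike.ofReal_mul] at this
    rw [smul_smul, smul_smul, rInv, matRinv_symm, rMat, matR_symm, mul_comm _ (met 𝕜 q i i.rev)]
    exact congrArg (· • H c) this
  · intro m _ hm
    have : i ≠ m.rev := fun h => hm (by rw [h, Fin.rev_rev])
    simp [met_eq_zero this]
  · simp

end Crossing


/-! ### The braid relation -/

section Braid

variable {𝕜 : Type*} [RCLike 𝕜] {M : Type*} [AddCommGroup M] [Module 𝕜 M] {N : ℕ} {q : ℝ}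

/-- A strand slides past a cup: `act_met_left` turns the inner `R⁻` into `R`, which the outer `R⁻`
cancels. -/
theorem act_act_met_left (hq : 0 < q) (H : Fin N → M) (i j k : Fin N) :
    act (rInv 𝕜 q) (fun a b => act (rInv 𝕜 q) (fun c d => met 𝕜 q a c • H d) b k) i j =
      met 𝕜 q j k • H i := by
  simp only [act_met_left hq]
  exact act_rInv_act_rMat hq (fun d n => met 𝕜 q n k • H d) i j

theorem act_act_met_right (hq : 0 < q) (H : Fin N → M) (i j k : Fin N) :
    act (rInv 𝕜 q) (fun a b => act (rInv 𝕜 q) (fun c d => met 𝕜 q d b • H c) i a) j k =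
      met 𝕜 q i j • H k := by
  simp only [act_met_right hq]
  exact act_rInv_act_rMat hq (fun m c => met 𝕜 q i m • H c) j k

theorem contr_met_smul_left (hq : 0 < q) (H : Fin N → M) (i : Fin N) :
    contr (met 𝕜 q) (fun m c => met 𝕜 q i m • H c) = H i := by
  rw [contr_met, Finset.sum_eq_single i]
  · rw [smul_smul, met_rev_mul_met hq, one_smul]
  · intro l _ hl
    have : i ≠ l.rev.rev := by rw [Fin.rev_rev]; exact hl.symm
    simp [met_eq_zero this]
  · simp

theorem contr_met_smul_right (hq : 0 < q) (H : Fin N → M) (i : Fin N) :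
    contr (met 𝕜 q) (fun m c => met 𝕜 q c i • H m) = H i := by
  rw [contr_met, Finset.sum_eq_single i.rev]
  · rw [smul_smul, Fin.rev_rev, met_mul_met_rev hq, one_smul]
  · intro l _ hl
    simp [met_eq_zero hl]
  · simp

/-- A skein relation: the `R` produced by `act_met_right` is expanded as `R⁻ + h - h K`. -/
theorem act_met_right_eq (hq : 0 < q) (f : Fin N → M) (i j k : Fin N) :
    act (rInv 𝕜 q) (fun a b => met 𝕜 q b k • f a) i j =
      act (rInv 𝕜 q) (fun b c => met 𝕜 q i b • f c) j k
      + (((q : 𝕜) - (q : 𝕜)⁻¹) * met 𝕜 q i j) • f k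
      - (((q : 𝕜) - (q : 𝕜)⁻¹) * met 𝕜 q j k) • f i := by
  rw [act_met_right hq, act_rMat, contr_met_smul_left hq, smul_smul]

/-- The eigenvalue is `q^{N-1} + h - h tr K`, which the trace formula turns into `q^{1-N}`. -/
theorem act_rMat_met (hq : 0 < q) (m : M) (i j : Fin N) :
    act (rMat 𝕜 q) (fun k l => met 𝕜 q k l • m) i j =
      ((q : 𝕜) * ((q : 𝕜) ^ N)⁻¹ * met 𝕜 q i j) • m := by
  have h := contr_met_met (𝕜 := 𝕜) hq N
  have h' : contr (met 𝕜 q) (fun k l : Fin N => met 𝕜 q k l • m) =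
      contr (met 𝕜 q) (met 𝕜 q : Fin N → Fin N → 𝕜) • m := by
    simp [contr, Finset.sum_smul, smul_smul]
  rw [act_rMat, act_rInv_met hq, h']
  match_scalars
  linear_combination -met 𝕜 q i j * h

/-- Dual to the slide past a cup: moved across the cap, the outer `R⁻` becomes `R` and cancels the
inner one. -/
theorem contr_act_act_left (hq : 0 < q) (F : Fin N → Fin N → Fin N → M) (i : Fin N) :
    contr (met 𝕜 q) (fun k l => act (rInv 𝕜 q) (fun a b =>
      act (rInv 𝕜 q) (fun c d => F c d b) k a) l i) = contr (met 𝕜 q) (F i) := by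
  refine (contr_act_left hq (fun k a b => act (rInv 𝕜 q) (fun c d => F c d b) k a) i).trans ?_
  congr 1
  funext n l
  exact act_rMat_act_rInv hq (fun c d => F c d l) i n

theorem contr_act_act_right (hq : 0 < q) (F : Fin N → Fin N → Fin N → M) (i : Fin N) :
    contr (met 𝕜 q) (fun k l => act (rInv 𝕜 q) (fun a b =>
      act (rInv 𝕜 q) (fun c d => F a c d) b l) i k) = contr (met 𝕜 q) (fun k l => F k l i) := by
  refine (contr_act_right hq (fun a b l => act (rInv 𝕜 q) (fun c d => F a c d) b l) i).trans ?_
  congr 1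
  funext c m
  exact act_rMat_act_rInv hq (F c) m i

/-- Removal of a curl: moved across the cap, the crossing becomes `R` acting on the metric, which
costs its eigenvalue `q^{1-N}`. -/
theorem contr_act_met_left (hq : 0 < q) (f : Fin N → M) (i : Fin N) :
    contr (met 𝕜 q) (fun k l => act (rInv 𝕜 q) (fun a b => met 𝕜 q k a • f b) l i) =
      ((q : 𝕜) * ((q : 𝕜) ^ N)⁻¹) • f i := by
  rw [contr_act_left hq]
  simp only [act_rMat_met hq, mul_smul, contr_smul, contr_met_smul_left hq]

theorem contr_act_met_right (hq : 0 < q) (f : Fin N → M) (i : Fin N) :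
    contr (met 𝕜 q) (fun k l => act (rInv 𝕜 q) (fun a b => met 𝕜 q b l • f a) i k) =
      ((q : 𝕜) * ((q : 𝕜) ^ N)⁻¹) • f i := by
  rw [contr_act_right hq (fun a b l => met 𝕜 q b l • f a)]
  simp only [act_rMat_met hq, mul_smul, contr_smul, contr_met_smul_right hq]

theorem contr_act_right_eq (hq : 0 < q) (F : Fin N → Fin N → Fin N → M) (i : Fin N) :
    contr (met 𝕜 q) (fun a b => act (rInv 𝕜 q) (fun c k => F c k b) i a) =
      contr (met 𝕜 q) (fun c m => act (rInv 𝕜 q) (fun k b => F c k b) m i)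
      + ((q : 𝕜) - (q : 𝕜)⁻¹) • contr (met 𝕜 q) (fun c m => F c m i)
      - ((q : 𝕜) - (q : 𝕜)⁻¹) • contr (met 𝕜 q) (fun k l => F i k l) := by
  rw [contr_act_right hq]
  simp only [act_rMat, mul_smul, contr_add, contr_sub, contr_smul]
  rw [contr_met_smul_right hq (fun c => contr (met 𝕜 q) (F c))]

/-- The recursion for `R⁻` turns each of the 27 patterns of low, middle and high indices into an
identity about the inner block. There the cup and cap slides, the curl removals and the quadratic
relation apply, and for three middle indices also the induction hypothesis. -/
theorem act_braid (hq : 0 < q) (F : Fin N → Fin N → Fin N → M) (i j k : Fin N) :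
    act (rInv 𝕜 q) (fun a b => act (rInv 𝕜 q) (fun b' c =>
      act (rInv 𝕜 q) (fun a' d => F a' d c) a b') b k) i j =
    act (rInv 𝕜 q) (fun b c => act (rInv 𝕜 q) (fun a b' =>
      act (rInv 𝕜 q) (fun d c' => F a d c') b' c) i b) j k := by
  have hq' := ofReal_ne_zero_of_pos 𝕜 hq
  induction N using Nat.twoStepInduction with
  | zero => exact i.elim0
  | one =>
    have : met 𝕜 q (0 : Fin 1) 0 = 1 := by simp [met, metC, rho]
    fin_cases i; fin_cases j; fin_cases k
    simp [act_rInv, this]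
  | more n ih _ =>
    have hp := halfPow_ne_zero (𝕜 := 𝕜) (n := n) hq
    have h3 := halfPow_sq (𝕜 := 𝕜) (n := n) hq
    have hk := contr_met_met (𝕜 := 𝕜) hq n
    rw [← h3] at hk
    have hk' : ∀ m : M, contr (met 𝕜 q) (fun k l : Fin n => met 𝕜 q k l • m) =
        contr (met 𝕜 q) (met 𝕜 q : Fin n → Fin n → 𝕜) • m := fun m => by
      simp [contr, Finset.sum_smul, smul_smul]
    induction i using index_cases <;> induction j using index_cases <;>
      induction k using index_cases <;>
      simp only [act_lo_lo, act_hi_hi, act_lo_mid, act_mid_lo, act_mid_hi, act_hi_mid, act_mid_mid,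
        act_lo_hi _ hq, act_hi_lo _ hq, act_add, act_sub, act_smul, contr_add, contr_sub, contr_smul,
        mul_smul, smul_add, smul_sub]
    all_goals try (match_scalars <;> field_simp <;> ring1)
    all_goals simp only [ih, act_act hq, act_rInv_met hq, contr_met_act hq, act_act_met_left hq,
      act_act_met_right hq, contr_act_act_left hq, contr_act_act_right hq, contr_act_met_left hq,
      contr_act_met_right hq, contr_met_smul_left hq, contr_met_smul_right hq, hk', ← h3]
    all_goals try (match_scalars <;> field_simp <;> ring1)
    -- Four patterns survive. In the first two, a crossing at a cup or cap appears on different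
    -- strands on the two sides, and the skein relation compares them; in the last two the numerical
    -- value of the trace of `K` is needed.
    case h1.h1.h1 i j k =>
      rw [act_met_right_eq hq (fun a => F (hi n) (mid a) (lo n)) i j k]
      match_scalars <;> field_simp <;> ring1
    case h2.h1.h0 i =>
      rw [contr_act_right_eq hq (fun a b c => F (mid a) (mid b) (mid c)) i]
      match_scalars <;> field_simp <;> ring1
    case h2.h0.h0 =>
      match_scalars
      all_goals try (field_simp <;> ring1)
      linear_combination (norm := (field_simp <;> ring1))
        (-((q : 𝕜) - (q : 𝕜)⁻¹) ^ 2) * halfPow 𝕜 q n ^ 2 * hk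
    case h2.h2.h0 =>
      match_scalars
      all_goals try (field_simp <;> ring1)
      linear_combination (norm := (field_simp <;> ring1))
        ((q : 𝕜) - (q : 𝕜)⁻¹) ^ 2 * halfPow 𝕜 q n ^ 2 * hk

end Braid


/-! ### Constants -/

section Constants

variable {𝕜 : Type*} [RCLike 𝕜]

/-- The nondegeneracy conditions on `q` and `Q = q^{N-2}`. -/
structure Nondeg (𝕜 : Type*) [RCLike 𝕜] (N : ℕ) (q : ℝ) (Q : 𝕜) : Prop where
  pos : 0 < q
  q_ne_zero : (q : 𝕜) ≠ 0
  q_sub_one : (q : 𝕜) - 1 ≠ 0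
  q_add_one : (q : 𝕜) + 1 ≠ 0
  q_sq_add_one : (q : 𝕜) ^ 2 + 1 ≠ 0
  one_add : 1 + Q ≠ 0
  sub_one : q * Q - 1 ≠ 0
  sq_sub_one : (q : 𝕜) ^ 2 * Q - 1 ≠ 0
  cube_sub_one : (q : 𝕜) ^ 3 * Q - 1 ≠ 0
  pow_eq : (q : 𝕜) ^ N = q ^ 2 * Q

variable (q : ℝ) (Q : 𝕜)

/-- `q - q⁻¹`. -/
noncomputable def cH (𝕜 : Type*) [RCLike 𝕜] (q : ℝ) : 𝕜 := (q : 𝕜) - (q : 𝕜)⁻¹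

/-- The constant of the trace part of the relations of the sphere. -/
noncomputable def cS : 𝕜 := cH 𝕜 q * Q / (1 + Q)

/-- `cS - (q - q⁻¹)`. -/
noncomputable def cS' : 𝕜 := -cH 𝕜 q / (1 + Q)

/-- The coefficient of `x_i η` in `dx_i`. -/
noncomputable def cA : 𝕜 := q * (1 + Q) / (q * Q - 1)

/-- The coefficient of `ω_i` in `dx_i`. -/
noncomputable def cB : 𝕜 := -(q + 1) / (q * Q - 1)

/-- The constant in `dx_i = λ (η x_i - x_i η)`. -/
noncomputable def cL : 𝕜 := q * (1 + Q) / ((q - 1) * (q * Q - 1))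

/-- The constant of the trace part of the quadratic relations of the forms `ω_i`. -/
noncomputable def cT : 𝕜 := cH 𝕜 q * (q ^ 2 * Q) / (q ^ 2 * Q - 1)

end Constants

/-! ### The bimodule of one-forms in a basis with simple commutation relations -/

section Bimod

variable {𝕜 : Type*} [RCLike 𝕜] {A : Type*} [Ring A] [Algebra 𝕜 A] {N : ℕ} {q : ℝ} {Q : 𝕜}

theorem mul_act {ι : Type*} [Fintype ι] (R : ι → ι → ι → ι → 𝕜) (F : ι → ι → A) (a : A) (i j : ι) :
    a * act R F i j = act R (fun k l => a * F k l) i j := by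
  simp [act, Finset.mul_sum]

theorem act_mul {ι : Type*} [Fintype ι] (R : ι → ι → ι → ι → 𝕜) (F : ι → ι → A) (a : A) (i j : ι) :
    act R F i j * a = act R (fun k l => F k l * a) i j := by
  simp [act, Finset.sum_mul]

theorem mul_contr {ι : Type*} [Fintype ι] (C : ι → ι → 𝕜) (F : ι → ι → A) (a : A) :
    a * contr C F = contr C (fun k l => a * F k l) := by
  simp [contr, Finset.mul_sum]

theorem contr_mul {ι : Type*} [Fintype ι] (C : ι → ι → 𝕜) (F : ι → ι → A) (a : A) :
    contr C F * a = contr C (fun k l => F k l * a) := by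
  simp [contr, Finset.sum_mul]

/-- Families satisfying the relations of the quantum sphere. -/
structure IsSphereFamily (q : ℝ) (Q : 𝕜) (x : Fin N → A) : Prop where
  rel : ∀ i j, act (rInv 𝕜 q) (fun k l => x k * x l) i j =
    (q : 𝕜)⁻¹ • (x i * x j) + (cS q Q * met 𝕜 q i j) • (1 : A)
  unit : contr (met 𝕜 q) (fun k l => x k * x l) = 1

/-- Families `x` and `ω` satisfying the relations of the quantum sphere and
`ω_i x_j = (R⁻)^{kl}_{ij} x_k ω_l`. -/
structure IsBimodFamily (q : ℝ) (Q : 𝕜) (x w : Fin N → A) : Prop extends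
    IsSphereFamily q Q x where
  comm : ∀ i j, w i * x j = act (rInv 𝕜 q) (fun k l => x k * w l) i j

variable (q) in
/-- The contraction `C^{kl} x_k w_l`. -/
noncomputable def pairing (𝕜 : Type*) [RCLike 𝕜] [Algebra 𝕜 A] (x w : Fin N → A) : A :=
  contr (met 𝕜 q) (fun k l => x k * w l)

variable {x w : Fin N → A}

theorem IsSphereFamily.rMat_rel (hS : IsSphereFamily q Q x) (hQ : Nondeg 𝕜 N q Q) (i j : Fin N) :
    act (rMat 𝕜 q) (fun k l => x k * x l) i j =
      (q : 𝕜) • (x i * x j) + (cS' q Q * met 𝕜 q i j) • (1 : A) := by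
  have h1 := hQ.one_add
  have e : cS q Q - cH 𝕜 q = cS' q Q := by unfold cS cS'; field_simp; ring
  rw [act_rMat, hS.rel, hS.unit, ← e, cH]
  module

/-- Moved across the cap, the crossing becomes `R` acting on `x_m x_k`, where the relations of the
sphere evaluate it. -/
theorem pairing_act_mul (hS : IsSphereFamily q Q x) (hQ : Nondeg 𝕜 N q Q) (H : Fin N → A)
    (j : Fin N) :
    contr (met 𝕜 q) (fun m i => x m * act (rInv 𝕜 q) (fun k l => x k * H l) i j) =
      (q : 𝕜) • (x j * pairing q 𝕜 x H) + cS' q Q • H j := by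
  simp only [mul_act]
  rw [contr_act_left hQ.pos (fun m k l => x m * (x k * H l)) j]
  simp only [← mul_assoc, ← act_mul, hS.rMat_rel hQ, add_mul, contr_add, mul_smul, smul_mul_assoc,
    contr_smul, one_mul, contr_met_smul_left hQ.pos]
  simp only [pairing, mul_assoc, mul_contr]

theorem pairing_met (x : Fin N → A) (hq : 0 < q) (j : Fin N) (m : A) :
    contr (met 𝕜 q) (fun k i => x k * met 𝕜 q i j • m) = x j * m := by
  simp only [mul_smul_comm]
  exact contr_met_smul_right hq (fun k => x k * m) j

theorem pairing_mul (x w : Fin N → A) (a : A) :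
    pairing q 𝕜 x w * a = pairing q 𝕜 x (fun i => w i * a) := by
  simp only [pairing, contr_mul, mul_assoc]

theorem pairing_self_mul (hS : IsSphereFamily q Q x) (a : A) :
    pairing q 𝕜 x (fun i => x i * a) = a := by
  simp only [pairing, ← mul_assoc, ← contr_mul, hS.unit, one_mul]

theorem pairing_add (x : Fin N → A) (v w : Fin N → A) :
    pairing q 𝕜 x (fun i => v i + w i) = pairing q 𝕜 x v + pairing q 𝕜 x w := by
  simp only [pairing, mul_add, contr_add]

theorem pairing_sub (x : Fin N → A) (v w : Fin N → A) :
    pairing q 𝕜 x (fun i => v i - w i) = pairing q 𝕜 x v - pairing q 𝕜 x w := by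
  simp only [pairing, mul_sub, contr_sub]

theorem pairing_smul (x : Fin N → A) (c : 𝕜) (w : Fin N → A) :
    pairing q 𝕜 x (fun i => c • w i) = c • pairing q 𝕜 x w := by
  simp only [pairing, mul_smul_comm, contr_smul]

theorem IsBimodFamily.comm_mul (hB : IsBimodFamily q Q x w) (i j : Fin N) (a : A) :
    w i * (x j * a) = act (rInv 𝕜 q) (fun k l => x k * (w l * a)) i j := by
  rw [← mul_assoc, hB.comm, act_mul]
  simp only [mul_assoc]

/-- `η x_j = q x_j η + s' ω_j`. -/
theorem IsBimodFamily.pairing_mul_x (hB : IsBimodFamily q Q x w) (hQ : Nondeg 𝕜 N q Q)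
    (j : Fin N) : pairing q 𝕜 x w * x j =
    (q : 𝕜) • (x j * pairing q 𝕜 x w) + cS' q Q • w j := by
  rw [← pairing_act_mul hB.toIsSphereFamily hQ, pairing_mul, pairing]
  simp only [hB.comm]

theorem IsBimodFamily.pairing_mul_x_mul (hB : IsBimodFamily q Q x w)
    (hQ : Nondeg 𝕜 N q Q) (j : Fin N) (a : A) : pairing q 𝕜 x w * (x j * a) =
    (q : 𝕜) • (x j * (pairing q 𝕜 x w * a)) + cS' q Q • (w j * a) := by
  rw [← mul_assoc, hB.pairing_mul_x hQ, add_mul, smul_mul_assoc, smul_mul_assoc, mul_assoc]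

/-- The element `t = C^{ij} ω_i ω_j` commutes with the `x_k`. -/
theorem IsBimodFamily.trace_comm (hB : IsBimodFamily q Q x w) (hQ : Nondeg 𝕜 N q Q)
    (k : Fin N) :
    contr (met 𝕜 q) (fun i j => w i * w j) * x k =
      x k * contr (met 𝕜 q) (fun i j => w i * w j) := by
  have hq := hQ.pos
  simp only [contr_mul, mul_assoc, hB.comm, mul_act, hB.comm_mul]
  -- Passing `x_k` through two forms costs two crossings; moved across the cap, the outer one
  -- becomes `R` and cancels the inner one.
  rw [contr_act_left hq (fun i a b => act (rInv 𝕜 q) (fun c d => x c * (w d * w b)) i a) k, mul_contr]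
  congr 1
  funext n l
  exact act_rMat_act_rInv hq (fun c d => x c * (w d * w l)) k n

end Bimod


/-! ### Quadratic expressions in the one-forms -/

section Quadratic

variable {𝕜 : Type*} [RCLike 𝕜] {A : Type*} [Ring A] [Algebra 𝕜 A] {N : ℕ} {q : ℝ} {Q : 𝕜}

/-- The family `dx_i = α x_i η + β ω_i`. -/
noncomputable def formU (q : ℝ) (Q : 𝕜) (x w : Fin N → A) (i : Fin N) : A :=
  cA q Q • (x i * pairing q 𝕜 x w) + cB q Q • w i

/-- The quadratic relations `R⁻ ωω + q ωω - τ K ωω`. -/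
noncomputable def quadG (q : ℝ) (Q : 𝕜) (w : Fin N → A) (i j : Fin N) : A :=
  act (rInv 𝕜 q) (fun k l => w k * w l) i j + (q : 𝕜) • (w i * w j)
    - (cT q Q * met 𝕜 q i j) • pairing q 𝕜 w w

/-- The contraction `C^{ki} x_k G_{ij}`. -/
noncomputable def quadg (q : ℝ) (Q : 𝕜) (x w : Fin N → A) (j : Fin N) : A :=
  pairing q 𝕜 x (fun i => quadG q Q w i j)

variable {x w : Fin N → A}

theorem act_rMat_eq (F : Fin N → Fin N → A) (i j : Fin N) :
    act (rMat 𝕜 q) F i j = act (rInv 𝕜 q) F i j + cH 𝕜 q • F i j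
      - cH 𝕜 q • met 𝕜 q i j • contr (met 𝕜 q) F := by
  rw [act_rMat, mul_smul]; rfl

theorem cS_sub (hQ : Nondeg 𝕜 N q Q) : cS' q Q = cS q Q - cH 𝕜 q := by
  have h1 := hQ.one_add
  unfold cS cS'; field_simp; ring

/-- This normalisation makes `η` the same whether computed from the `ω_i` or from the `dx_i`. -/
theorem cA_add_cB (hQ : Nondeg 𝕜 N q Q) : cA q Q + cB q Q = 1 := by
  have := hQ.sub_one
  unfold cA cB; field_simp; ring

theorem cA_mul_cS' (hQ : Nondeg 𝕜 N q Q) : cA q Q * cS' q Q = (q - 1) * cB q Q := by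
  have h1 := hQ.sub_one
  have h2 := hQ.one_add
  have h3 := hQ.q_ne_zero
  unfold cA cB cS' cH; field_simp; ring

/-- `C^{ki} x_k u_i = η`. -/
theorem pairing_formU (hS : IsSphereFamily q Q x) (hQ : Nondeg 𝕜 N q Q) :
    pairing q 𝕜 x (formU q Q x w) = pairing q 𝕜 x w := by
  have h : formU q Q x w = fun i => cA q Q • (x i * pairing q 𝕜 x w) + cB q Q • w i := rfl
  rw [h, pairing_add, pairing_smul, pairing_smul, pairing_self_mul hS, ← add_smul,
    cA_add_cB hQ, one_smul]

/-- Moved across the cap, the crossing in `G` becomes `R = R⁻ + h - h K` on `x_m ω_k`; its `R⁻` part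
is `ω x` by the commutation rule, and `q - h = q⁻¹` is the coefficient of `η ω_j`. -/
theorem quadg_eq (hB : IsBimodFamily q Q x w) (hQ : Nondeg 𝕜 N q Q) (j : Fin N) :
    quadg q Q x w j = w j * pairing q 𝕜 x w + (q : 𝕜)⁻¹ • (pairing q 𝕜 x w * w j)
      + (cH 𝕜 q - cT q Q) • (x j * pairing q 𝕜 w w) := by
  have hq := hQ.pos
  have h1 : pairing q 𝕜 x (fun i => act (rInv 𝕜 q) (fun k l => w k * w l) i j) =
      w j * pairing q 𝕜 x w + cH 𝕜 q • (x j * pairing q 𝕜 w w)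
        - cH 𝕜 q • (pairing q 𝕜 x w * w j) := by
    simp only [pairing, mul_act]
    rw [contr_act_left hq (fun m k l => x m * (w k * w l)) j]
    simp only [← mul_assoc, ← act_mul, act_rMat_eq, ← hB.comm, add_mul, sub_mul, contr_add, contr_sub,
      smul_mul_assoc, contr_smul, contr_met_smul_left hq]
    simp only [mul_assoc, mul_contr]
  have h2 : pairing q 𝕜 x (fun i => (cT q Q * met 𝕜 q i j) • pairing q 𝕜 w w) =
      cT q Q • (x j * pairing q 𝕜 w w) := by
    simp only [mul_smul, pairing_smul]
    congr 1
    exact pairing_met x hq j _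
  unfold quadg
  simp only [quadG]
  rw [pairing_sub, pairing_add, h1, h2, pairing_smul, ← pairing_mul, cH]
  module

/-- `η η = q ζ₀ + s' t`. -/
theorem pairing_sq (hB : IsBimodFamily q Q x w) (hQ : Nondeg 𝕜 N q Q) :
    pairing q 𝕜 x w * pairing q 𝕜 x w =
      (q : 𝕜) • pairing q 𝕜 x (fun j => pairing q 𝕜 x w * w j)
        + cS' q Q • pairing q 𝕜 w w := by
  have h : pairing q 𝕜 x w * pairing q 𝕜 x w =
      contr (met 𝕜 q) (fun k l => pairing q 𝕜 x w * (x k * w l)) := mul_contr _ _ _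
  rw [h]
  simp only [hB.pairing_mul_x_mul hQ, contr_add, contr_smul]
  rfl

theorem pairing_mul_pairing (x w : Fin N → A) :
    pairing q 𝕜 x (fun j => w j * pairing q 𝕜 x w) = pairing q 𝕜 x w * pairing q 𝕜 x w :=
  (pairing_mul x w _).symm

/-- `C^{kj} x_k g_j = (q + q⁻¹) ζ₀ + (s - τ) t`. -/
theorem pairing_quadg (hB : IsBimodFamily q Q x w) (hQ : Nondeg 𝕜 N q Q) :
    pairing q 𝕜 x (quadg q Q x w) =
      ((q : 𝕜) + (q : 𝕜)⁻¹) • pairing q 𝕜 x (fun j => pairing q 𝕜 x w * w j)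
        + (cS q Q - cT q Q) • pairing q 𝕜 w w := by
  have h : quadg q Q x w = _ := funext (quadg_eq hB hQ)
  rw [h, pairing_add, pairing_add, pairing_mul_pairing, pairing_sq hB hQ, pairing_smul,
    pairing_smul, pairing_self_mul hB.toIsSphereFamily, cS_sub hQ]
  module

/-- The calculus is inner: `u_j` is the commutator of `λ η` with `x_j`. -/
theorem formU_mul_x (hB : IsBimodFamily q Q x w) (hQ : Nondeg 𝕜 N q Q) (j : Fin N) :
    pairing q 𝕜 x w * x j = x j * pairing q 𝕜 x w + (cL q Q)⁻¹ • formU q Q x w j := by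
  have h1 := hQ.sub_one
  have h2 := hQ.one_add
  have h3 := hQ.q_ne_zero
  have h4 := hQ.q_sub_one
  rw [hB.pairing_mul_x hQ, formU]
  match_scalars
  · unfold cL cA; field_simp; ring
  · unfold cL cB cS' cH; field_simp; ring

/-- `η u_j` in terms of the forms `ω`. -/
theorem pairing_mul_formU (hB : IsBimodFamily q Q x w) (hQ : Nondeg 𝕜 N q Q) (j : Fin N) :
    pairing q 𝕜 x w * formU q Q x w j =
      (cA q Q * q) • (x j * (pairing q 𝕜 x w * pairing q 𝕜 x w))
        + ((q - 1) * cB q Q) • (w j * pairing q 𝕜 x w)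
        + cB q Q • (pairing q 𝕜 x w * w j) := by
  rw [formU, mul_add, mul_smul_comm, mul_smul_comm, hB.pairing_mul_x_mul hQ, ← cA_mul_cS' hQ]
  module

/-- `u_j η + η u_j` in terms of the forms `g`. -/
theorem formU_anticomm (hB : IsBimodFamily q Q x w) (hQ : Nondeg 𝕜 N q Q) (j : Fin N) :
    formU q Q x w j * pairing q 𝕜 x w + pairing q 𝕜 x w * formU q Q x w j =
      (q * cB q Q) • quadg q Q x w j
        + (cA q Q * q ^ 2 * (1 + q) / (1 + q ^ 2)) • (x j * pairing q 𝕜 x (quadg q Q x w)) := by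
  have h1 := hQ.sub_one
  have h2 := hQ.one_add
  have h3 := hQ.q_ne_zero
  have h4 := hQ.sq_sub_one
  have h5 : 1 + (q : 𝕜) ^ 2 ≠ 0 := by rw [add_comm]; exact hQ.q_sq_add_one
  rw [pairing_mul_formU hB hQ, quadg_eq hB hQ, pairing_quadg hB hQ, formU, add_mul,
    smul_mul_assoc, smul_mul_assoc, mul_assoc, pairing_sq hB hQ]
  simp only [mul_add, mul_smul_comm]
  match_scalars
  · field_simp; ring
  · unfold cA cB cT cS cS' cH; field_simp; ring
  · ring
  · field_simp

/-- `C^{ki} x_k (η u_i)`. -/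
theorem pairing_eta_formU (hB : IsBimodFamily q Q x w) (hQ : Nondeg 𝕜 N q Q) :
    pairing q 𝕜 x (fun i => pairing q 𝕜 x w * formU q Q x w i) =
      (q - cB q Q) • (pairing q 𝕜 x w * pairing q 𝕜 x w)
        + cB q Q • pairing q 𝕜 x (fun j => pairing q 𝕜 x w * w j) := by
  simp only [pairing_mul_formU hB hQ]
  rw [pairing_add, pairing_add, pairing_smul, pairing_smul, pairing_smul,
    pairing_self_mul hB.toIsSphereFamily, pairing_mul_pairing, eq_sub_of_add_eq (cA_add_cB hQ)]
  module

/-- `C^{ij} u_i x_j = -η`. -/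
theorem contr_formU_mul_x (hB : IsBimodFamily q Q x w) (hQ : Nondeg 𝕜 N q Q) (a : A) :
    contr (met 𝕜 q) (fun i j => formU q Q x w i * (x j * a)) = -(pairing q 𝕜 x w * a) := by
  have h1 := hQ.sub_one
  have h2 := hQ.one_add
  have h3 := hQ.q_ne_zero
  simp only [formU, add_mul, smul_mul_assoc, mul_assoc, hB.pairing_mul_x_mul hQ, hB.comm_mul,
    contr_add, contr_smul, mul_add, mul_smul_comm]
  rw [contr_met_act hQ.pos]
  have e1 : contr (met 𝕜 q) (fun i j => x i * (w j * a)) = pairing q 𝕜 x w * a :=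
    (pairing_mul x w a).symm
  have e2 : contr (met 𝕜 q) (fun i j => x i * (x j * (pairing q 𝕜 x w * a))) =
    pairing q 𝕜 x w * a := pairing_self_mul hB.toIsSphereFamily _
  rw [e1, e2, hQ.pow_eq]
  match_scalars
  unfold cA cB cS' cH; field_simp; ring

/-- `dη = C^{ij} u_i u_j`. -/
theorem contr_formU_formU (hB : IsBimodFamily q Q x w) (hQ : Nondeg 𝕜 N q Q) :
    pairing q 𝕜 (formU q Q x w) (formU q Q x w) =
      (cA q Q * (cB q Q - q)) • pairing q 𝕜 x (fun j => pairing q 𝕜 x w * w j)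
        + (cB q Q * (cB q Q + 1 - q)) • pairing q 𝕜 w w := by
  have e (i j) : formU q Q x w i * formU q Q x w j =
      cA q Q • (formU q Q x w i * (x j * pairing q 𝕜 x w))
        + (cA q Q * cB q Q) • (x i * (pairing q 𝕜 x w * w j))
        + (cB q Q * cB q Q) • (w i * w j) := by
    conv_lhs => rw [show formU q Q x w j = cA q Q • (x j * pairing q 𝕜 x w) + cB q Q • w j from rfl]
    rw [mul_add, mul_smul_comm, mul_smul_comm,
      show formU q Q x w i * w j =
        cA q Q • (x i * (pairing q 𝕜 x w * w j)) + cB q Q • (w i * w j) by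
          rw [formU, add_mul, smul_mul_assoc, smul_mul_assoc, mul_assoc]]
    module
  rw [pairing]
  simp only [e, contr_add, contr_smul]
  rw [contr_formU_mul_x hB hQ, pairing_sq hB hQ]
  have e3 : contr (met 𝕜 q) (fun i j => x i * (pairing q 𝕜 x w * w j)) =
    pairing q 𝕜 x (fun j => pairing q 𝕜 x w * w j) := rfl
  have e4 : contr (met 𝕜 q) (fun i j => w i * w j) = pairing q 𝕜 w w := rfl
  rw [e3, e4]
  have h := cA_mul_cS' hQ
  match_scalars
  · ring
  · linear_combination -h

/-- The second relation is a multiple of `C^{kj} x_k g_j`. -/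
theorem relation_trace (hB : IsBimodFamily q Q x w) (hQ : Nondeg 𝕜 N q Q) :
    pairing q 𝕜 (formU q Q x w) (formU q Q x w) + (2 * cL q Q) •
        pairing q 𝕜 x (fun i => pairing q 𝕜 x w * formU q Q x w i) =
      (q ^ 2 * (1 + Q) * (q + 1) * (q ^ 2 * Q - 1) / ((q ^ 2 + 1) * (q * Q - 1) ^ 2 * (q - 1)) : 𝕜) •
        pairing q 𝕜 x (quadg q Q x w) := by
  have h1 := hQ.sub_one
  have h2 := hQ.one_add
  have h3 := hQ.q_ne_zero
  have h4 := hQ.sq_sub_one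
  have h5 := hQ.q_sq_add_one
  have h6 := hQ.q_sub_one
  rw [contr_formU_formU hB hQ, pairing_eta_formU hB hQ, pairing_quadg hB hQ, pairing_sq hB hQ]
  match_scalars
  · unfold cA cB cL; field_simp; ring
  · unfold cB cL cS cS' cT cH; field_simp; ring

end Quadratic


/-! ### The two families of relations and the quadratic relations -/

section Relations

variable {𝕜 : Type*} [RCLike 𝕜] {A : Type*} [Ring A] [Algebra 𝕜 A] {N : ℕ} {q : ℝ} {Q : 𝕜}
  {x w : Fin N → A}

/-- The first relation, for `z_j = η ∧ u_j`. -/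
noncomputable def relQuad (q : ℝ) (Q : 𝕜) (x u z : Fin N → A) (i j : Fin N) : A :=
  act (rInv 𝕜 q) (fun k l => u k * u l) i j + (q : 𝕜) • (u i * u j)
    - (q * ((q - 1) * (1 + Q) / (q * Q - 1))) • (x i * z j)
    - ((q - 1) * (1 + Q) / (q * Q - 1)) • act (rInv 𝕜 q) (fun k l => x k * z l) i j
    - ((1 + q ^ 2) * (1 + Q) ^ 2 / (q * Q - 1) ^ 2) • (x i * x j * pairing q 𝕜 x z)
    + (Q * ((1 + q) * (1 + q ^ 2) * (1 + Q) / (q * Q - 1) ^ 2) * met 𝕜 q i j) • pairing q 𝕜 x z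

/-- The coefficient of `x_i x_j C^{kl} x_k g_l` in the first relation. -/
noncomputable def cXX (q : ℝ) (Q : 𝕜) : 𝕜 := q * (1 - q ^ 2) * (1 + Q) ^ 2 / (q * Q - 1) ^ 3

/-- The coefficient of `C_{ij} C^{kl} x_k g_l` in the first relation. -/
noncomputable def cCC (q : ℝ) (Q : 𝕜) : 𝕜 := Q * (1 + Q) * (q + 1) * q *
  (q ^ 4 * Q + q ^ 3 * Q + q ^ 4 - q ^ 3 - q ^ 2 - 1) / ((q * Q - 1) ^ 3 * (q ^ 2 + 1))

theorem act_act_add (hQ : Nondeg 𝕜 N q Q) (F : Fin N → Fin N → A) (i j : Fin N) :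
    act (rInv 𝕜 q) (act (rInv 𝕜 q) F) i j = F i j - cH 𝕜 q • act (rInv 𝕜 q) F i j
      + (cH 𝕜 q * (q * Q)) • met 𝕜 q i j • contr (met 𝕜 q) F := by
  have h : (q : 𝕜) ^ 2 * Q * (q : 𝕜)⁻¹ = q * Q := by have := hQ.q_ne_zero; field_simp
  rw [act_act hQ.pos, hQ.pow_eq, h, mul_smul _ (met 𝕜 q i j)]
  rfl

theorem act_x_mul (hS : IsSphereFamily q Q x) (a : A) (i j : Fin N) :
    act (rInv 𝕜 q) (fun k l => x k * (x l * a)) i j =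
      (q : 𝕜)⁻¹ • (x i * (x j * a)) + cS q Q • met 𝕜 q i j • a := by
  simp only [← mul_assoc]
  rw [← act_mul, hS.rel, add_mul, smul_mul_assoc, smul_mul_assoc, one_mul, mul_smul]

/-- `β ω_j η` in terms of `η u_j`. -/
theorem cB_smul_mul_pairing (hB : IsBimodFamily q Q x w) (hQ : Nondeg 𝕜 N q Q) (j : Fin N) :
    cB q Q • (w j * pairing q 𝕜 x w) = -(pairing q 𝕜 x w * formU q Q x w j)
      + (cA q Q * q) • (x j * (pairing q 𝕜 x w * pairing q 𝕜 x w))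
      + (cB q Q * q) • quadg q Q x w j
      - (cB q Q * q * (cH 𝕜 q - cT q Q)) • (x j * pairing q 𝕜 w w) := by
  have h3 := hQ.q_ne_zero
  rw [pairing_mul_formU hB hQ, quadg_eq hB hQ]
  match_scalars <;> field_simp <;> ring

theorem formU_mul_formU (hB : IsBimodFamily q Q x w) (i j : Fin N) :
    formU q Q x w i * formU q Q x w j =
      cA q Q • (x i * (pairing q 𝕜 x w * formU q Q x w j))
      + cA q Q • act (rInv 𝕜 q) (fun k l => x k * (cB q Q • (w l * pairing q 𝕜 x w))) i j
      + cB q Q ^ 2 • (w i * w j) := by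
  conv_lhs => rw [show formU q Q x w i = cA q Q • (x i * pairing q 𝕜 x w) + cB q Q • w i from rfl]
  rw [add_mul, smul_mul_assoc, smul_mul_assoc, mul_assoc]
  have : w i * formU q Q x w j = 
      cA q Q • act (rInv 𝕜 q) (fun k l => x k * (w l * pairing q 𝕜 x w)) i j
      + cB q Q • (w i * w j) := by
    rw [formU, mul_add, mul_smul_comm, mul_smul_comm, hB.comm_mul]
  rw [this]
  simp only [mul_smul_comm, act_smul]
  module

/-- A normal form adapted to the first relation: each `ω_l η` is traded for `η u_l` and `g_l`, and
the remainder is `R⁻` applied to `x_k x_l e`, with `e` a combination of `η η` and `t`. -/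
theorem formU_mul_formU_eq (hB : IsBimodFamily q Q x w) (hQ : Nondeg 𝕜 N q Q) (i j : Fin N) :
    formU q Q x w i * formU q Q x w j =
      cA q Q • (x i * (pairing q 𝕜 x w * formU q Q x w j))
      - cA q Q • act (rInv 𝕜 q) (fun k l => x k * (pairing q 𝕜 x w * formU q Q x w l)) i j
      + (cA q Q * cB q Q * q) • act (rInv 𝕜 q) (fun k l => x k * quadg q Q x w l) i j
      + ((q : 𝕜)⁻¹ • (x i * (x j *
          ((cA q Q ^ 2 * q) • (pairing q 𝕜 x w * pairing q 𝕜 x w)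
          - (cA q Q * cB q Q * q * (cH 𝕜 q - cT q Q)) • pairing q 𝕜 w w)))
        + cS q Q • met 𝕜 q i j • ((cA q Q ^ 2 * q) • (pairing q 𝕜 x w * pairing q 𝕜 x w)
          - (cA q Q * cB q Q * q * (cH 𝕜 q - cT q Q)) • pairing q 𝕜 w w))
      + cB q Q ^ 2 • (w i * w j) := by
  rw [← act_x_mul hB.toIsSphereFamily, formU_mul_formU hB]
  simp only [cB_smul_mul_pairing hB hQ, mul_add, mul_sub, mul_neg,
    mul_smul_comm, act_add, act_sub, act_smul]
  have h : act (rInv 𝕜 q) (fun k l => -(x k * (pairing q 𝕜 x w * formU q Q x w l))) i j =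
    -act (rInv 𝕜 q) (fun k l => x k * (pairing q 𝕜 x w * formU q Q x w l)) i j := by
    simp [act]
  rw [h]
  module

/-- Keeping `e` as a name lets `x_k x_l e` be treated as one family under `R⁻`, so that the
quadratic relation applies to all three terms where `R⁻` is iterated. -/
theorem act_formU_mul_formU (hB : IsBimodFamily q Q x w) (hQ : Nondeg 𝕜 N q Q) (i j : Fin N)
    (e : A) (he : e = (cA q Q ^ 2 * q) • (pairing q 𝕜 x w * pairing q 𝕜 x w)
          - (cA q Q * cB q Q * q * (cH 𝕜 q - cT q Q)) • pairing q 𝕜 w w) :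
    act (rInv 𝕜 q) (fun k l => formU q Q x w k * formU q Q x w l) i j =
      cA q Q • act (rInv 𝕜 q) (fun k l => x k * (pairing q 𝕜 x w * formU q Q x w l)) i j
      - cA q Q • (x i * (pairing q 𝕜 x w * formU q Q x w j)
        - cH 𝕜 q • act (rInv 𝕜 q) (fun k l => x k * (pairing q 𝕜 x w * formU q Q x w l)) i j
        + (cH 𝕜 q * (q * Q)) • met 𝕜 q i j •
          pairing q 𝕜 x (fun l => pairing q 𝕜 x w * formU q Q x w l))
      + (cA q Q * cB q Q * q) • (x i * quadg q Q x w j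
        - cH 𝕜 q • act (rInv 𝕜 q) (fun k l => x k * quadg q Q x w l) i j
        + (cH 𝕜 q * (q * Q)) • met 𝕜 q i j • pairing q 𝕜 x (quadg q Q x w))
      + (x i * (x j * e) - cH 𝕜 q • ((q : 𝕜)⁻¹ • (x i * (x j * e)) + cS q Q • met 𝕜 q i j • e)
        + (cH 𝕜 q * (q * Q)) • met 𝕜 q i j • e)
      + cB q Q ^ 2 • act (rInv 𝕜 q) (fun k l => w k * w l) i j := by
  have h : (fun k l => formU q Q x w k * formU q Q x w l) = fun i j => cA q Q • (x i * (pairing q 𝕜 x w * formU q Q x w j))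
      - cA q Q • act (rInv 𝕜 q) (fun k l => x k * (pairing q 𝕜 x w * formU q Q x w l)) i j
      + (cA q Q * cB q Q * q) • act (rInv 𝕜 q) (fun k l => x k * quadg q Q x w l) i j
      + act (rInv 𝕜 q) (fun k l => x k * (x l * e)) i j + cB q Q ^ 2 • (w i * w j) := by
    funext i j
    rw [formU_mul_formU_eq hB hQ, act_x_mul hB.toIsSphereFamily, ← he]
  have hp : contr (met 𝕜 q) (fun k l => x k * (x l * e)) = e :=
    pairing_self_mul hB.toIsSphereFamily e
  simp only [h, act_add, act_sub, act_smul]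
  have hh (F : Fin N → Fin N → A) : act (rInv 𝕜 q) (fun k l => act (rInv 𝕜 q) F k l) i j = _ :=
    act_act_add hQ F i j
  rw [hh, hh, hh, act_x_mul hB.toIsSphereFamily, hp]
  rfl

/-- The first relation in terms of the quadratic relations of the forms `ω`. -/
theorem relQuad_eq (hB : IsBimodFamily q Q x w) (hQ : Nondeg 𝕜 N q Q) (i j : Fin N) :
    relQuad q Q x (formU q Q x w) (fun l => pairing q 𝕜 x w * formU q Q x w l) i j =
      cB q Q ^ 2 • quadG q Q w i j
      + (cA q Q * cB q Q) • (act (rInv 𝕜 q) (fun k l => x k * quadg q Q x w l) i j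
        + (q : 𝕜) • (x i * quadg q Q x w j))
      + cXX q Q • (x i * (x j * pairing q 𝕜 x (quadg q Q x w)))
      + cCC q Q • met 𝕜 q i j • pairing q 𝕜 x (quadg q Q x w) := by
  have h1 := hQ.sub_one
  have h2 := hQ.one_add
  have h3 := hQ.q_ne_zero
  have h4 := hQ.sq_sub_one
  have h5 := hQ.q_sq_add_one
  have h6 := hQ.q_sub_one
  have h5' : 1 + (q : 𝕜) ^ 2 ≠ 0 := by rw [add_comm]; exact h5
  unfold relQuad quadG
  beta_reduce
  rw [act_formU_mul_formU hB hQ i j _ rfl, formU_mul_formU_eq hB hQ, pairing_eta_formU hB hQ,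
    pairing_quadg hB hQ, pairing_sq hB hQ, mul_assoc (x i)]
  -- Both sides are now combinations of the elements abstracted below, so only identities between
  -- rational functions of `q` and `Q` remain.
  generalize pairing q 𝕜 x (fun j => pairing q 𝕜 x w * w j) = z0
  generalize pairing q 𝕜 w w = t
  generalize act (rInv 𝕜 q) (fun k l => x k * quadg q Q x w l) i j = a1
  generalize act (rInv 𝕜 q) (fun k l => x k * (pairing q 𝕜 x w * formU q Q x w l)) i j = a2
  generalize act (rInv 𝕜 q) (fun k l => w k * w l) i j = a3
  generalize quadg q Q x w j = a4
  generalize pairing q 𝕜 x w * formU q Q x w j = a5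
  generalize w i * w j = a6
  generalize met 𝕜 q i j = m
  simp only [mul_add, mul_sub, mul_smul_comm]
  generalize x i * (x j * z0) = b1
  generalize x i * (x j * t) = b2
  generalize x i * a4 = b3
  generalize x i * a5 = b4
  match_scalars
  all_goals (simp only [cXX, cCC, cA, cB, cS, cS', cT, cH]; try field_simp; try ring)

/-- `C^{ki} x_k` applied to the first relation. -/
theorem pairing_relQuad (hB : IsBimodFamily q Q x w) (hQ : Nondeg 𝕜 N q Q) (j : Fin N) :
    pairing q 𝕜 x (fun i => relQuad q Q x (formU q Q x w)
        (fun l => pairing q 𝕜 x w * formU q Q x w l) i j) =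
      (q * cB q Q) • quadg q Q x w j
        + (cA q Q * cB q Q * q + cXX q Q + cCC q Q) • (x j * pairing q 𝕜 x (quadg q Q x w)) := by
  have hS := hB.toIsSphereFamily
  have h1 : pairing q 𝕜 x (fun i => act (rInv 𝕜 q) (fun k l => x k * quadg q Q x w l) i j) =
      (q : 𝕜) • (x j * pairing q 𝕜 x (quadg q Q x w)) + cS' q Q • quadg q Q x w j :=
    pairing_act_mul hS hQ (quadg q Q x w) j
  have h2 : pairing q 𝕜 x (fun i => met 𝕜 q i j • pairing q 𝕜 x (quadg q Q x w)) =
      x j * pairing q 𝕜 x (quadg q Q x w) := pairing_met x hQ.pos j _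
  have h3 : pairing q 𝕜 x (fun i => quadG q Q w i j) = quadg q Q x w j := rfl
  simp only [relQuad_eq hB hQ, pairing_add, pairing_smul, pairing_self_mul hS, h1, h2, h3]
  have e1 := cA_mul_cS' hQ
  have e2 := cA_add_cB hQ
  match_scalars
  · linear_combination cB q Q * e1 + cB q Q * q * e2
  · ring

/-- Each term of `G` passes through `x_k`: the crossing by the braid relation, the metric by
`act_act_met_right`, and `t` because it commutes with `x_k`. -/
theorem quadG_mul_x (hB : IsBimodFamily q Q x w) (hQ : Nondeg 𝕜 N q Q) (i j k : Fin N) :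
    quadG q Q w i j * x k = act (rInv 𝕜 q) (fun a b => act (rInv 𝕜 q)
      (fun c d => x c * quadG q Q w d b) i a) j k := by
  have hq := hQ.pos
  have h1 (i j k) : w i * (w j * x k) = act (rInv 𝕜 q) (fun a b => act (rInv 𝕜 q)
      (fun c d => x c * (w d * w b)) i a) j k := by
    simp only [hB.comm, mul_act, hB.comm_mul]
  have h2 := act_braid (𝕜 := 𝕜) hq (fun c d b => x c * (w d * w b)) i j k
  have h3 : met 𝕜 q i j • (x k * pairing q 𝕜 w w) = act (rInv 𝕜 q) (fun a b => act (rInv 𝕜 q)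
      (fun c d => met 𝕜 q d b • (x c * pairing q 𝕜 w w)) i a) j k :=
    (act_act_met_right hq (fun k => x k * pairing q 𝕜 w w) i j k).symm
  simp only [quadG, sub_mul, add_mul, smul_mul_assoc, mul_assoc, act_mul, h1, mul_sub, mul_add,
    mul_smul_comm, mul_act, act_sub, act_add, act_smul, mul_smul]
  rw [show pairing q 𝕜 w w * x k = x k * pairing q 𝕜 w w from hB.trace_comm hQ k, h2, h3]

theorem contr_act_comm (C : Fin N → Fin N → 𝕜) (R : Fin N → Fin N → Fin N → Fin N → 𝕜)
    (F : Fin N → Fin N → Fin N → Fin N → A) (j k : Fin N) :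
    contr C (fun m i => act R (F m i) j k) = act R (fun a b => contr C (fun m i => F m i a b)) j k := by
  simp only [contr, act, Finset.smul_sum]
  simp only [← Finset.sum_product', Finset.univ_product_univ]
  refine (Equiv.sum_comp ((Equiv.prodAssoc _ _ _).symm.trans
    ((Equiv.prodComm (Fin N × Fin N) (Fin N × Fin N)).trans (Equiv.prodAssoc _ _ _))) _).symm.trans ?_
  refine Finset.sum_congr rfl fun p _ => ?_
  exact smul_comm _ _ _

/-- Contracting `quadG_mul_x` with `x` leaves an inner crossing that `pairing_act_mul` evaluates;
its `s'` term brings back the uncontracted `G`. This is how `g` controls `G`. -/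
theorem quadg_mul_x (hB : IsBimodFamily q Q x w) (hQ : Nondeg 𝕜 N q Q) (j k : Fin N) :
    quadg q Q x w j * x k = act (rInv 𝕜 q) (fun a b => (q : 𝕜) • (x a * quadg q Q x w b)
      + cS' q Q • quadG q Q w a b) j k := by
  have h (a b) : (q : 𝕜) • (x a * quadg q Q x w b) + cS' q Q • quadG q Q w a b = _ :=
    (pairing_act_mul hB.toIsSphereFamily hQ (fun d => quadG q Q w d b) a).symm
  simp only [h]
  rw [quadg, pairing_mul]
  simp only [quadG_mul_x hB hQ, pairing]
  rw [← contr_act_comm]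
  simp only [← mul_act]
-- By the quadratic relation `(R⁻ - q⁻¹)(R⁻ + q)` is a multiple of `K`, and `τ = h q^{N-1} /
-- (q^{N-1} - q⁻¹)` is the value for which the metric terms cancel.
theorem act_quadG (hQ : Nondeg 𝕜 N q Q) (w : Fin N → A) (i j : Fin N) :
    act (rInv 𝕜 q) (quadG q Q w) i j = (q : 𝕜)⁻¹ • quadG q Q w i j := by
  have h3 := hQ.q_ne_zero
  have h4 := hQ.sq_sub_one
  have h : quadG q Q w = fun i j => act (rInv 𝕜 q) (fun k l => w k * w l) i j
    + (q : 𝕜) • (w i * w j) - cT q Q • met 𝕜 q i j • pairing q 𝕜 w w := by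
    funext i j; rw [quadG, mul_smul]
  have hh (F : Fin N → Fin N → A) : act (rInv 𝕜 q) (fun k l => act (rInv 𝕜 q) F k l) i j = _ :=
    act_act_add hQ F i j
  rw [h, act_sub, act_add, act_smul, act_smul, act_rInv_met hQ.pos, hh, hQ.pow_eq,
    show contr (met 𝕜 q) (fun k l => w k * w l) = pairing q 𝕜 w w from rfl]
  match_scalars
  all_goals try simp only [cT, cH]
  all_goals try field_simp
  all_goals try ring

/-- Multiplying `g = 0` by the `x_k` on the right leaves `s' R⁻ G = s' q⁻¹ G = 0`, and `s' ≠ 0`. -/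
theorem quadG_eq_zero_of_quadg (hB : IsBimodFamily q Q x w) (hQ : Nondeg 𝕜 N q Q)
    (h : ∀ j, quadg q Q x w j = 0) (i j : Fin N) : quadG q Q w i j = 0 := by
  have h1 := hQ.one_add
  have h3 := hQ.q_ne_zero
  have hs : cS' q Q ≠ 0 := by
    have := mul_ne_zero hQ.q_sub_one hQ.q_add_one
    have e : (q : 𝕜) - (q : 𝕜)⁻¹ = (q - 1) * (q + 1) * (q : 𝕜)⁻¹ := by field_simp; ring
    rw [cS', cH, e]
    exact div_ne_zero (neg_ne_zero.2 (mul_ne_zero this (inv_ne_zero h3))) h1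
  have h0 := quadg_mul_x hB hQ i j
  simp only [h, zero_mul, mul_zero, smul_zero, zero_add, act_smul] at h0
  have e : act (rInv 𝕜 q) (fun a b => quadG q Q w a b) i j = _ := act_quadG hQ w i j
  rw [e, eq_comm, smul_smul] at h0
  exact (smul_eq_zero.1 h0).resolve_left (mul_ne_zero hs (inv_ne_zero h3))

/-- If `η` anticommutes with the `u_j`, then the quadratic relations hold. -/
theorem quadG_eq_zero_of_anticomm (hB : IsBimodFamily q Q x w) (hQ : Nondeg 𝕜 N q Q)
    (h : ∀ j, formU q Q x w j * pairing q 𝕜 x w + pairing q 𝕜 x w * formU q Q x w j = 0)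
    (i j : Fin N) : quadG q Q w i j = 0 := by
  have h1 := hQ.sub_one
  have h2 := hQ.one_add
  have h3 := hQ.q_ne_zero
  have h4 := hQ.sq_sub_one
  have h5 := hQ.q_sq_add_one
  have h5' : 1 + (q : 𝕜) ^ 2 ≠ 0 := by rw [add_comm]; exact h5
  have h6 := hQ.q_add_one
  simp only [formU_anticomm hB hQ] at h
  have hB0 : (q : 𝕜) * cB q Q ≠ 0 := mul_ne_zero h3 (div_ne_zero (neg_ne_zero.2 h6) h1)
  -- A further contraction with `x` leaves a scalar times `C^{kj} x_k g_j`; the scalar is nonzero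
  -- since `q^2 Q = q^N ≠ 1`.
  have hp := congrArg (pairing q 𝕜 x) (funext h)
  rw [pairing_add, pairing_smul, pairing_smul, pairing_self_mul hB.toIsSphereFamily,
    ← add_smul] at hp
  have e : (q : 𝕜) * cB q Q + cA q Q * q ^ 2 * (1 + q) / (1 + q ^ 2) =
      q * (q + 1) * (q ^ 2 * Q - 1) / ((q * Q - 1) * (1 + q ^ 2)) := by
    unfold cA cB; field_simp; ring
  have hz : pairing q 𝕜 x (fun _ => (0 : A)) = 0 := by simp [pairing, contr]
  rw [e, hz] at hp
  have hp' := (smul_eq_zero.1 hp).resolve_left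
    (div_ne_zero (mul_ne_zero (mul_ne_zero h3 h6) h4) (mul_ne_zero h1 h5'))
  refine quadG_eq_zero_of_quadg hB hQ (fun j => ?_) i j
  have := h j
  rw [hp', mul_zero, smul_zero, add_zero] at this
  exact (smul_eq_zero.1 this).resolve_left hB0

/-- If a subspace stable under left multiplication by the `x_k` contains the two families of
relations, then it contains the quadratic relations. -/
theorem quadG_mem_of_relations (hB : IsBimodFamily q Q x w) (hQ : Nondeg 𝕜 N q Q)
    (J : Submodule 𝕜 A) (hJ : ∀ k, ∀ a ∈ J, x k * a ∈ J)
    (h1 : ∀ i j, relQuad q Q x (formU q Q x w)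
      (fun l => pairing q 𝕜 x w * formU q Q x w l) i j ∈ J)
    (h2 : pairing q 𝕜 (formU q Q x w) (formU q Q x w) + (2 * cL q Q) •
      pairing q 𝕜 x (fun i => pairing q 𝕜 x w * formU q Q x w i) ∈ J) (i j : Fin N) :
    quadG q Q w i j ∈ J := by
  have hB0 : cB q Q ≠ 0 := div_ne_zero (neg_ne_zero.2 hQ.q_add_one) hQ.sub_one
  have hm : (q ^ 2 * (1 + Q) * (q + 1) * (q ^ 2 * Q - 1) /
      ((q ^ 2 + 1) * (q * Q - 1) ^ 2 * (q - 1)) : 𝕜) ≠ 0 :=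
    div_ne_zero (mul_ne_zero (mul_ne_zero (mul_ne_zero (pow_ne_zero 2 hQ.q_ne_zero) hQ.one_add)
      hQ.q_add_one) hQ.sq_sub_one)
      (mul_ne_zero (mul_ne_zero hQ.q_sq_add_one (pow_ne_zero 2 hQ.sub_one)) hQ.q_sub_one)
  have hcontr (F : Fin N → Fin N → A) (hF : ∀ i j, F i j ∈ J) : contr (met 𝕜 q) F ∈ J :=
    Submodule.sum_mem _ fun _ _ => Submodule.sum_mem _ fun _ _ => J.smul_mem _ (hF _ _)
  have hact (F : Fin N → Fin N → A) (hF : ∀ i j, F i j ∈ J) (i j) : act (rInv 𝕜 q) F i j ∈ J :=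
    Submodule.sum_mem _ fun _ _ => Submodule.sum_mem _ fun _ _ => J.smul_mem _ (hF _ _)
  rw [relation_trace hB hQ] at h2
  -- Right multiplication is not available in `J`. Instead the second relation gives `C^{kj} x_k
  -- g_j`, the contracted first relation then gives `g_j`, and the first relation itself gives
  -- `G_ij`.
  have hG0 := (J.smul_mem_iff hm).1 h2
  have hg (j) : quadg q Q x w j ∈ J := by
    have := hcontr _ (fun k i => hJ k _ (h1 i j))
    have h := pairing_relQuad hB hQ j
    rw [pairing] at h
    rw [h] at this
    exact (J.smul_mem_iff (mul_ne_zero hQ.q_ne_zero hB0)).1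
      ((J.add_mem_iff_left (J.smul_mem _ (hJ _ _ hG0))).1 this)
  have := h1 i j
  rw [relQuad_eq hB hQ] at this
  exact (J.smul_mem_iff (pow_ne_zero 2 hB0)).1 ((J.add_mem_iff_left
    (J.smul_mem _ (J.add_mem (hact _ (fun k l => hJ k _ (hg l)) i j)
      (J.smul_mem _ (hJ i _ (hg j)))))).1 ((J.add_mem_iff_left
        (J.smul_mem _ (hJ i _ (hJ j _ hG0)))).1 ((J.add_mem_iff_left
          (J.smul_mem _ (J.smul_mem _ hG0))).1 this)))

/-- If the quadratic relations hold, then so does the first relation. -/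
theorem relQuad_eq_zero (hB : IsBimodFamily q Q x w) (hQ : Nondeg 𝕜 N q Q)
    (h : ∀ i j, quadG q Q w i j = 0) (i j : Fin N) :
    relQuad q Q x (formU q Q x w) (fun l => pairing q 𝕜 x w * formU q Q x w l) i j = 0 := by
  have hg : ∀ j, quadg q Q x w j = 0 := fun j => by simp [quadg, pairing, h, contr]
  rw [relQuad_eq hB hQ, show quadg q Q x w = fun _ => 0 from funext hg]
  simp [pairing, h, contr, act]

/-- If the quadratic relations hold, then so does the second relation. -/
theorem relation_trace_eq_zero (hB : IsBimodFamily q Q x w) (hQ : Nondeg 𝕜 N q Q)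
    (h : ∀ i j, quadG q Q w i j = 0) :
    pairing q 𝕜 (formU q Q x w) (formU q Q x w) + (2 * cL q Q) •
      pairing q 𝕜 x (fun i => pairing q 𝕜 x w * formU q Q x w i) = 0 := by
  rw [relation_trace hB hQ]
  simp [quadg, pairing, h, contr]

/-- If the quadratic relations hold, then `η η` is a multiple of `t`. -/
theorem pairing_sq_comm (hB : IsBimodFamily q Q x w) (hQ : Nondeg 𝕜 N q Q)
    (h : ∀ i j, quadG q Q w i j = 0) (k : Fin N) :
    pairing q 𝕜 x w * pairing q 𝕜 x w * x k = x k * (pairing q 𝕜 x w * pairing q 𝕜 x w) := by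
  have h0 : pairing q 𝕜 x (quadg q Q x w) = 0 := by simp [quadg, pairing, h, contr]
  have hc : (q : 𝕜) + (q : 𝕜)⁻¹ ≠ 0 := by
    have e : (q : 𝕜) + (q : 𝕜)⁻¹ = (q ^ 2 + 1) * (q : 𝕜)⁻¹ := by
      have := hQ.q_ne_zero
      field_simp
    rw [e]
    exact mul_ne_zero hQ.q_sq_add_one (inv_ne_zero hQ.q_ne_zero)
  -- Vanishing of `C^{kj} x_k g_j` makes `C^{kj} x_k η ω_j` a multiple of `t`, hence also `η η`.
  rw [pairing_quadg hB hQ, add_eq_zero_iff_eq_neg, ← eq_inv_smul_iff₀ hc] at h0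
  rw [pairing_sq hB hQ, h0, ← neg_smul, smul_smul, smul_smul, ← add_smul, smul_mul_assoc,
    mul_smul_comm]
  congr 1
  exact hB.trace_comm hQ k


end Relations



/-! ### The commutation relations between the `x_j` and the `dx_i` -/

section Commutation

variable {𝕜 : Type*} [RCLike 𝕜] {A : Type*} [Ring A] [Algebra 𝕜 A] {N : ℕ} {q : ℝ} {Q : 𝕜}
  {x w u : Fin N → A}

/-- The commutation relations between the `x_j` and the forms `u_i = dx_i`. -/
def IsFormFamily (q : ℝ) (Q : 𝕜) (x u : Fin N → A) : Prop :=
  ∀ i j, u i * x j = act (rInv 𝕜 q) (fun k l => x k * u l) i j + ((q : 𝕜) - 1) • (x i * u j)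
    - (cA q Q * cS q Q) • met 𝕜 q i j • pairing q 𝕜 x u
    + (cA q Q * (1 - (q : 𝕜)⁻¹)) • (x i * (x j * pairing q 𝕜 x u))

theorem cA_mul_cL_inv (hQ : Nondeg 𝕜 N q Q) : cA q Q * (cL q Q)⁻¹ = q - 1 := by
  have h1 := hQ.sub_one
  have h2 := hQ.one_add
  have h3 := hQ.q_ne_zero
  have h4 := hQ.q_sub_one
  unfold cA cL; field_simp

theorem act_x_formU (hS : IsSphereFamily q Q x) (w : Fin N → A) (i j : Fin N) :
    act (rInv 𝕜 q) (fun k l => x k * formU q Q x w l) i j =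
      cA q Q • ((q : 𝕜)⁻¹ • (x i * (x j * pairing q 𝕜 x w))
        + cS q Q • met 𝕜 q i j • pairing q 𝕜 x w)
      + cB q Q • act (rInv 𝕜 q) (fun k l => x k * w l) i j := by
  simp only [formU, mul_add, mul_smul_comm, act_add, act_smul, act_x_mul hS]

theorem IsBimodFamily.isFormFamily (hB : IsBimodFamily q Q x w) (hQ : Nondeg 𝕜 N q Q) :
    IsFormFamily q Q x (formU q Q x w) := by
  intro i j
  have hS := hB.toIsSphereFamily
  rw [pairing_formU hS hQ, act_x_formU hS, ← hB.comm]
  conv_lhs => rw [formU, add_mul, smul_mul_assoc, smul_mul_assoc, mul_assoc, formU_mul_x hB hQ,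
    mul_add, mul_smul_comm, smul_add, smul_smul, cA_mul_cL_inv hQ]
  module

/-- The forms `ω_i = β⁻¹ (u_i - α x_i η)`. -/
noncomputable def formW (q : ℝ) (Q : 𝕜) (x u : Fin N → A) (i : Fin N) : A :=
  (cB q Q)⁻¹ • (u i - cA q Q • (x i * pairing q 𝕜 x u))

theorem cB_ne_zero (hQ : Nondeg 𝕜 N q Q) : cB q Q ≠ 0 :=
  div_ne_zero (neg_ne_zero.2 hQ.q_add_one) hQ.sub_one

theorem pairing_formW (hS : IsSphereFamily q Q x) (hQ : Nondeg 𝕜 N q Q) (u : Fin N → A) :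
    pairing q 𝕜 x (formW q Q x u) = pairing q 𝕜 x u := by
  have h : formW q Q x u =
    fun i => (cB q Q)⁻¹ • (u i - cA q Q • (x i * pairing q 𝕜 x u)) := rfl
  have hb := cB_ne_zero hQ
  rw [h, pairing_smul, pairing_sub, pairing_smul, pairing_self_mul hS,
    eq_sub_of_add_eq (cA_add_cB hQ), inv_smul_eq_iff₀ hb]
  module

theorem formU_formW (hS : IsSphereFamily q Q x) (hQ : Nondeg 𝕜 N q Q) (u : Fin N → A) :
    formU q Q x (formW q Q x u) = u := by
  funext i
  rw [formU, pairing_formW hS hQ, formW, smul_inv_smul₀ (cB_ne_zero hQ)]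
  abel

theorem IsFormFamily.isBimodFamily (hS : IsSphereFamily q Q x) (hU : IsFormFamily q Q x u)
    (hQ : Nondeg 𝕜 N q Q) : IsBimodFamily q Q x (formW q Q x u) := by
  have h1 := hQ.sub_one
  have h2 := hQ.one_add
  have h3 := hQ.q_ne_zero
  have h4 := hQ.q_sub_one
  -- Contracting the commutation rule of the `u_i` with `x` already gives the inner form of the
  -- calculus; the rule for the `ω_i` follows from it.
  have hx (j) : pairing q 𝕜 x u * x j = x j * pairing q 𝕜 x u + (cL q Q)⁻¹ • u j := by
    have e1 : pairing q 𝕜 x (fun i => act (rInv 𝕜 q) (fun k l => x k * u l) i j) =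
        (q : 𝕜) • (x j * pairing q 𝕜 x u) + cS' q Q • u j := pairing_act_mul hS hQ u j
    have e2 : pairing q 𝕜 x (fun i => met 𝕜 q i j • pairing q 𝕜 x u) =
        x j * pairing q 𝕜 x u := pairing_met x hQ.pos j _
    rw [pairing_mul]
    simp only [hU _ j]
    simp only [pairing_add, pairing_sub, pairing_smul, pairing_self_mul hS, e1, e2]
    match_scalars
    all_goals (simp only [cL, cA, cS, cS', cH]; field_simp; ring)
  refine ⟨hS, fun i j => ?_⟩
  have h := act_x_formU hS (formW q Q x u) i j
  rw [formU_formW hS hQ, pairing_formW hS hQ] at h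
  rw [formW, smul_mul_assoc, inv_smul_eq_iff₀ (cB_ne_zero hQ), sub_mul, hU, h, smul_mul_assoc,
    mul_assoc, hx, mul_add, mul_smul_comm, smul_add (cA q Q) (x i * _), smul_smul _ (cL q Q)⁻¹, cA_mul_cL_inv hQ]
  module

theorem cL_ne_zero (hQ : Nondeg 𝕜 N q Q) : cL q Q ≠ 0 :=
  div_ne_zero (mul_ne_zero hQ.q_ne_zero hQ.one_add) (mul_ne_zero hQ.q_sub_one hQ.sub_one)

theorem pairing_sq_mul_x (hB : IsBimodFamily q Q x w) (hQ : Nondeg 𝕜 N q Q) (j : Fin N) :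
    pairing q 𝕜 x w * pairing q 𝕜 x w * x j - x j * (pairing q 𝕜 x w * pairing q 𝕜 x w) =
      (cL q Q)⁻¹ • (formU q Q x w j * pairing q 𝕜 x w + pairing q 𝕜 x w * formU q Q x w j) := by
  have h := formU_mul_x hB hQ j
  rw [mul_assoc, h, mul_add, mul_smul_comm, ← mul_assoc, h, add_mul, smul_mul_assoc, mul_assoc]
  module

/-- If `dη` satisfies the commutation relation that follows from the Leibniz rule, then the
quadratic relations hold. -/
theorem quadG_eq_zero_of_leibniz (hB : IsBimodFamily q Q x w) (hQ : Nondeg 𝕜 N q Q)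
    (h : ∀ j, pairing q 𝕜 (formU q Q x w) (formU q Q x w) * x j
        - x j * pairing q 𝕜 (formU q Q x w) (formU q Q x w) =
      formU q Q x w j * pairing q 𝕜 x w + pairing q 𝕜 x w * formU q Q x w j)
    (i j : Fin N) : quadG q Q w i j = 0 := by
  have h1 := hQ.sub_one
  have h2 := hQ.one_add
  have h3 := hQ.q_ne_zero
  have h4 := hQ.q_sub_one
  refine quadG_eq_zero_of_anticomm hB hQ (fun j => ?_) i j
  -- `dη` is expressed through `η η` and `t`. As `t` commutes with `x_j`, the commutator of `dη`
  -- with `x_j` is a scalar times that of `η η`, which is a multiple of the anticommutator.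
  have hs := pairing_sq hB hQ
  rw [← sub_eq_iff_eq_add, eq_comm, ← eq_inv_smul_iff₀ h3] at hs
  have ht : pairing q 𝕜 w w * x j = x j * pairing q 𝕜 w w := hB.trace_comm hQ j
  have h0 := h j
  have he := pairing_sq_mul_x hB hQ j
  rw [contr_formU_formU hB hQ, hs] at h0
  simp only [add_mul, sub_mul, smul_mul_assoc, mul_add, mul_sub, mul_smul_comm, ht] at h0
  generalize formU q Q x w j * pairing q 𝕜 x w + pairing q 𝕜 x w * formU q Q x w j = k at he h0 ⊢
  rw [sub_eq_iff_eq_add] at he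
  rw [he] at h0
  -- Two values of one commutator, both multiples of the anticommutator `k`; they differ by a
  -- nonzero factor because `q^3 Q = q^{N+1} ≠ 1`.
  have hk : (cA q Q * (cB q Q - q) * (q : 𝕜)⁻¹ * (cL q Q)⁻¹ - 1) • k = 0 := by
    rw [sub_smul, one_smul, sub_eq_zero]
    refine Eq.trans ?_ h0
    module
  refine (smul_eq_zero.1 hk).resolve_left ?_
  have e : cA q Q * (cB q Q - q) * (q : 𝕜)⁻¹ * (cL q Q)⁻¹ - 1 =
      -(q ^ 3 * Q - 1) / (q * (q * Q - 1)) := by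
    unfold cA cB cL; field_simp; ring
  rw [e]
  exact div_ne_zero (neg_ne_zero.2 hQ.cube_sub_one) (mul_ne_zero h3 h1)

end Commutation


/-! ### The generators of the sphere and their differentials -/

section Generators

variable {𝕜 : Type*} [RCLike 𝕜] {N : ℕ} {q : ℝ}

/-- The scalar `q^{N-2}`. -/
noncomputable def qPow (𝕜 : Type*) [RCLike 𝕜] (N : ℕ) (q : ℝ) : 𝕜 := ((q ^ ((N : ℤ) - 2) : ℝ) : 𝕜)

/-- The products `q Q`, `q^2 Q`, `q^3 Q` are `q^{N-1}`, `q^N`, `q^{N+1}`, and a positive real other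
than `1` has no positive power equal to `1`. -/
theorem nondeg (hN : 3 ≤ N) (hq : 0 < q) (hq1 : q ≠ 1) : Nondeg 𝕜 N q (qPow 𝕜 N q) := by
  have hpow (n : ℕ) (hn : n ≠ 0) : q ^ n - 1 ≠ 0 := by
    rw [sub_ne_zero, Ne, pow_eq_one_iff_of_nonneg hq.le hn]; exact hq1
  have e (k n : ℕ) (h : N - 2 + k = n) : q ^ k * q ^ ((N : ℤ) - 2) = q ^ n := by
    rw [← zpow_natCast, ← zpow_natCast, ← zpow_add₀ hq.ne']
    congr 1; omega
  have c (r : ℝ) (hr : r ≠ 0) : (r : 𝕜) ≠ 0 := RCLike.ofReal_ne_zero.2 hr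
  have hQ : (0 : ℝ) < q ^ ((N : ℤ) - 2) := zpow_pos hq _
  refine ⟨hq, c _ hq.ne', ?_, ?_, ?_, ?_, ?_, ?_, ?_, ?_⟩
  · simpa using c _ (sub_ne_zero.2 hq1)
  · simpa using c (q + 1) (by positivity)
  · have := c (q ^ 2 + 1) (by positivity)
    push_cast at this
    exact this
  · simpa [qPow] using c (1 + q ^ ((N : ℤ) - 2)) (by positivity)
  · have := c _ (hpow (N - 2 + 1) (by omega))
    rw [← e 1 _ rfl] at this
    simpa [qPow] using this
  · have := c _ (hpow (N - 2 + 2) (by omega))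
    rw [← e 2 _ rfl] at this
    simpa [qPow] using this
  · have := c _ (hpow (N - 2 + 3) (by omega))
    rw [← e 3 _ rfl] at this
    simpa [qPow] using this
  · have h := e 2 N (by omega)
    rw [qPow, ← RCLike.ofReal_pow, ← RCLike.ofReal_pow, ← RCLike.ofReal_mul, h]

theorem sphere_coeff (hq : 0 < q) (N : ℕ) :
    (((q ^ ((N : ℤ) - 1) - q ^ ((N : ℤ) - 3)) / (1 + q ^ ((N : ℤ) - 2)) : ℝ) : 𝕜) =
      cS q (qPow 𝕜 N q) := by
  have h1 : q ^ ((N : ℤ) - 1) = q * q ^ ((N : ℤ) - 2) := by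
    rw [← zpow_one_add₀ hq.ne']; congr 1; ring
  have h2 : q ^ ((N : ℤ) - 3) = q⁻¹ * q ^ ((N : ℤ) - 2) := by
    rw [← zpow_neg_one, ← zpow_add₀ hq.ne']; congr 1; ring
  rw [h1, h2, cS, cH, qPow, ← sub_mul]
  push_cast
  rfl

theorem sum_matK {M : Type*} [AddCommGroup M] [Module 𝕜 M] (F : Fin N → Fin N → M) (i j : Fin N) :
    ∑ k, ∑ l, (matK q k l i j : 𝕜) • F k l = met 𝕜 q i j • contr (met 𝕜 q) F := by
  simp [contr, matK, met, Finset.smul_sum, mul_smul]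

theorem QSphere.isSphereFamily (hq : 0 < q) :
    IsSphereFamily q (qPow 𝕜 N q) (QSphere.x 𝕜 N q) := by
  have h1 (i j) := RingQuot.mkAlgHom_rel 𝕜 (SphereRel.comm (𝕜 := 𝕜) (N := N) (q := q) i j)
  have h2 := RingQuot.mkAlgHom_rel 𝕜 (SphereRel.unit (𝕜 := 𝕜) (N := N) (q := q))
  rw [sphere_coeff hq] at h1
  simp only [map_sum, map_add, map_smul, map_mul, map_one] at h1 h2
  refine ⟨fun i j => ?_, h2⟩
  have h3 : ∑ k, ∑ l, (matK q k l i j : 𝕜) • (QSphere.x 𝕜 N q k * QSphere.x 𝕜 N q l) =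
      met 𝕜 q i j • (1 : QSphere 𝕜 N q) :=
    (sum_matK (fun k l => QSphere.x 𝕜 N q k * QSphere.x 𝕜 N q l) i j).trans (congrArg _ h2)
  refine (h1 i j).trans ?_
  rw [mul_smul, ← h3, RCLike.ofReal_inv]
  rfl

theorem IsSphereFamily.map {A B : Type*} [Ring A] [Algebra 𝕜 A] [Ring B] [Algebra 𝕜 B] {Q : 𝕜}
    {x : Fin N → A} (hS : IsSphereFamily q Q x) (f : A →ₐ[𝕜] B) :
    IsSphereFamily q Q (fun i => f (x i)) where
  rel i j := by simpa [act] using congrArg f (hS.rel i j)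
  unit := by simpa [contr] using congrArg f hS.unit

/-- Algebra homomorphisms out of the coordinate algebra of the sphere. -/
noncomputable def QSphere.lift {A : Type*} [Ring A] [Algebra 𝕜 A] (hq : 0 < q) {x : Fin N → A}
    (hS : IsSphereFamily q (qPow 𝕜 N q) x) : QSphere 𝕜 N q →ₐ[𝕜] A :=
  RingQuot.liftAlgHom 𝕜 ⟨FreeAlgebra.lift 𝕜 x, by
    intro u v h
    induction h with
    | comm i j =>
      rw [sphere_coeff hq, sum_matK]
      have h1 : (FreeAlgebra.lift 𝕜 x) (contr (met 𝕜 q)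
          (fun k l => FreeAlgebra.ι 𝕜 k * FreeAlgebra.ι 𝕜 l)) = 1 := by
        simp only [contr, map_sum, map_smul, map_mul, FreeAlgebra.lift_ι_apply]
        exact hS.unit
      simp only [map_sum, map_add, map_smul, map_mul, h1, FreeAlgebra.lift_ι_apply,
        RCLike.ofReal_inv, smul_smul]
      exact hS.rel i j
    | unit =>
      simp only [map_sum, map_smul, map_mul, map_one, FreeAlgebra.lift_ι_apply]
      exact hS.unit⟩

theorem QSphere.lift_x {A : Type*} [Ring A] [Algebra 𝕜 A] (hq : 0 < q) {x : Fin N → A}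
    (hS : IsSphereFamily q (qPow 𝕜 N q) x) (i : Fin N) :
    QSphere.lift hq hS (QSphere.x 𝕜 N q i) = x i := by
  rw [QSphere.lift, QSphere.x, RingQuot.liftAlgHom_mkAlgHom_apply, FreeAlgebra.lift_ι_apply]

theorem QSphere.induction {p : QSphere 𝕜 N q → Prop} (algebraMap : ∀ c, p (algebraMap 𝕜 _ c))
    (x : ∀ i, p (QSphere.x 𝕜 N q i)) (add : ∀ a b, p a → p b → p (a + b))
    (mul : ∀ a b, p a → p b → p (a * b)) (a : QSphere 𝕜 N q) : p a := by
  obtain ⟨u, rfl⟩ := RingQuot.mkAlgHom_surjective 𝕜 (SphereRel 𝕜 N q) a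
  induction u using FreeAlgebra.induction with
  | grade0 c => rw [AlgHom.commutes]; exact algebraMap c
  | grade1 i => exact x i
  | mul u v hu hv => rw [map_mul]; exact mul _ _ hu hv
  | add u v hu hv => rw [map_add]; exact add _ _ hu hv

theorem gammaPlus_coeff (hQ : Nondeg 𝕜 N q (qPow 𝕜 N q)) :
    (((q ^ (N : ℤ) - q ^ ((N : ℤ) - 2)) / (1 - q ^ ((N : ℤ) - 1)) : ℝ) : 𝕜) =
      -(cA q (qPow 𝕜 N q) * cS q (qPow 𝕜 N q)) := by
  have hq := hQ.pos
  have h1 : q ^ ((N : ℤ) - 1) = q * q ^ ((N : ℤ) - 2) := by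
    rw [← zpow_one_add₀ hq.ne']; congr 1; ring
  have h2 : q ^ (N : ℤ) = q ^ 2 * q ^ ((N : ℤ) - 2) := by
    rw [← zpow_natCast, ← zpow_add₀ hq.ne']; congr 1; push_cast; ring
  have e1 := hQ.sub_one
  have e2 := hQ.one_add
  have e3 := hQ.q_ne_zero
  have e4 : 1 - q * qPow 𝕜 N q ≠ 0 := by rw [← neg_sub]; exact neg_ne_zero.2 e1
  rw [h1, h2, cS, cH, cA]
  push_cast
  rw [show ((q : 𝕜) ^ ((N : ℤ) - 2)) = qPow 𝕜 N q by simp [qPow]]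
  field_simp
  ring

/-- The scalar `(1-q)(1+q^{N-2})/(1-q^{N-1})`. -/
theorem kappa_coeff (hQ : Nondeg 𝕜 N q (qPow 𝕜 N q)) :
    (((1 - q) * (1 + q ^ ((N : ℤ) - 2)) / (1 - q ^ ((N : ℤ) - 1)) : ℝ) : 𝕜) =
      (q - 1) * (1 + qPow 𝕜 N q) / (q * qPow 𝕜 N q - 1) := by
  have hq := hQ.pos
  have h1 : q ^ ((N : ℤ) - 1) = q * q ^ ((N : ℤ) - 2) := by
    rw [← zpow_one_add₀ hq.ne']; congr 1; ring
  have e1 := hQ.sub_one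
  have e4 : 1 - q * qPow 𝕜 N q ≠ 0 := by rw [← neg_sub]; exact neg_ne_zero.2 e1
  rw [h1]
  push_cast
  rw [show ((q : 𝕜) ^ ((N : ℤ) - 2)) = qPow 𝕜 N q by simp [qPow]]
  field_simp
  ring

/-- A map of `Γ₊` into an algebra is compatible with the commutation relations. -/
theorem IsFormFamily.iff_coeff {A : Type*} [Ring A] [Algebra 𝕜 A]
    (hQ : Nondeg 𝕜 N q (qPow 𝕜 N q)) (x u : Fin N → A) (i j : Fin N) :
    ((∑ k, ∑ l, (matRinv q k l i j : 𝕜) • (x k * u l))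
      + ((q - 1 : ℝ) : 𝕜) • (x i * u j)
      + (((q ^ (N : ℤ) - q ^ ((N : ℤ) - 2)) / (1 - q ^ ((N : ℤ) - 1)) : ℝ) : 𝕜) •
          ∑ k, ∑ l, (matK q k l i j : 𝕜) • (x k * u l)
      + (((1 - q) * (1 + q ^ ((N : ℤ) - 2)) / (1 - q ^ ((N : ℤ) - 1)) : ℝ) : 𝕜) •
          ∑ k, ∑ l, (metC q k l : 𝕜) • (x i * x j * x k * u l)) =
    act (rInv 𝕜 q) (fun k l => x k * u l) i j + ((q : 𝕜) - 1) • (x i * u j)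
    - (cA q (qPow 𝕜 N q) * cS q (qPow 𝕜 N q)) • met 𝕜 q i j • pairing q 𝕜 x u
    + (cA q (qPow 𝕜 N q) * (1 - (q : 𝕜)⁻¹)) • (x i * (x j * pairing q 𝕜 x u)) := by
  have e3 := hQ.q_ne_zero
  have h : cA q (qPow 𝕜 N q) * (1 - (q : 𝕜)⁻¹) =
      (q - 1) * (1 + qPow 𝕜 N q) / (q * qPow 𝕜 N q - 1) := by
    unfold cA; field_simp
  have h' : ∑ k, ∑ l, (metC q k l : 𝕜) • (x i * x j * x k * u l) =
      x i * (x j * pairing q 𝕜 x u) := by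
    simp [pairing, Finset.mul_sum, contr, met, mul_assoc]
  rw [gammaPlus_coeff hQ, kappa_coeff hQ, sum_matK, h, h', neg_smul, ← sub_eq_add_neg]
  push_cast
  rfl

end Generators

/-! ### The generators and their differentials inside the universal calculus -/

section Forms

variable {𝕜 : Type*} [RCLike 𝕜] {N : ℕ} {q : ℝ}

/-- The element `x_i` of the algebra of forms. -/
noncomputable def xForm (𝕜 : Type*) [RCLike 𝕜] (N : ℕ) (q : ℝ) (i : Fin N) : SphereForms 𝕜 N q :=
  UnivCalc.ofAlg (dPlus 𝕜 N q) (QSphere.x 𝕜 N q i)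

theorem etaForm_eq (𝕜 : Type*) [RCLike 𝕜] (N : ℕ) (q : ℝ) :
    etaForm 𝕜 N q = pairing q 𝕜 (xForm 𝕜 N q) (dx 𝕜 N q) := rfl

theorem xForm_isSphereFamily (hq : 0 < q) :
    IsSphereFamily q (qPow 𝕜 N q) (xForm 𝕜 N q) :=
  (QSphere.isSphereFamily hq).map (UnivCalc.ofAlg (dPlus 𝕜 N q))

theorem dx_isFormFamily (hQ : Nondeg 𝕜 N q (qPow 𝕜 N q)) :
    IsFormFamily q (qPow 𝕜 N q) (xForm 𝕜 N q) (dx 𝕜 N q) := by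
  intro i j
  have h := gammaPlus_mk_eq 𝕜 N q (GammaPlusRel.bimod i j)
  have h' := congrArg (UnivCalc.ofForm (dPlus 𝕜 N q)) h
  rw [← IsFormFamily.iff_coeff hQ]
  have e1 : UnivCalc.ofForm (dPlus 𝕜 N q) (Submodule.Quotient.mk (rAct 𝕜 (preD 𝕜 N q
      (QSphere.x 𝕜 N q i)) (QSphere.x 𝕜 N q j))) = dx 𝕜 N q i * xForm 𝕜 N q j :=
    UnivCalc.ofForm_rAct (dPlus 𝕜 N q) (dPlus 𝕜 N q (QSphere.x 𝕜 N q i)) (QSphere.x 𝕜 N q j)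
  have e2 (a l) : UnivCalc.ofForm (dPlus 𝕜 N q) (Submodule.Quotient.mk (lAct 𝕜 a (preD 𝕜 N q
      (QSphere.x 𝕜 N q l)))) = UnivCalc.ofAlg (dPlus 𝕜 N q) a * dx 𝕜 N q l :=
    UnivCalc.ofForm_lAct (dPlus 𝕜 N q) a (dPlus 𝕜 N q (QSphere.x 𝕜 N q l))
  rw [e1] at h'
  rw [h']
  have e3 (c : 𝕜) (v) : UnivCalc.ofForm (dPlus 𝕜 N q) (Submodule.Quotient.mk (c • v)) =
      c • UnivCalc.ofForm (dPlus 𝕜 N q) (Submodule.Quotient.mk v) := by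
    rw [Submodule.Quotient.mk_smul, map_smul]
  simp only [← Submodule.mkQ_apply, map_add, map_sum] at e2 e3 ⊢
  simp only [e2, e3, map_sum, map_mul]
  rfl

end Forms


/-! ### The relations between two-forms -/

section TwoForms

variable {𝕜 : Type*} [RCLike 𝕜] {N : ℕ} {q : ℝ}

section Naturality

variable {A : Type*} [Ring A] [Algebra 𝕜 A]
  {M : Type*} [AddCommGroup M] [Module 𝕜 M] [Module (QSphere 𝕜 N q) M]

/-- The relations exist as elements of an algebra and as elements of a left module. Passing from one
to the other needs only compatibility with left multiplication by the `x_i`, so this serves both for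
the forms themselves and for evaluation of operators. -/
theorem map_relQuad (hQ : Nondeg 𝕜 N q (qPow 𝕜 N q)) {x : Fin N → A} (φ : A →ₗ[𝕜] M)
    (hx : ∀ i b, φ (x i * b) = QSphere.x 𝕜 N q i • φ b) (u z : Fin N → A) (i j : Fin N) :
    φ (relQuad q (qPow 𝕜 N q) x u z i j) =
      relOne 𝕜 q (fun k l => φ (u k * u l)) (fun l => φ (z l)) i j := by
  have hq := hQ.pos
  have h1 : q ^ ((N : ℤ) - 1) = q * q ^ ((N : ℤ) - 2) := by
    rw [← zpow_one_add₀ hq.ne']; congr 1; ring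
  have c2 := kappa_coeff hQ
  have c1 : ((q * ((1 - q) * (1 + q ^ ((N : ℤ) - 2)) / (1 - q ^ ((N : ℤ) - 1))) : ℝ) : 𝕜) =
      q * ((q - 1) * (1 + qPow 𝕜 N q) / (q * qPow 𝕜 N q - 1)) := by
    rw [RCLike.ofReal_mul, c2]
  have hz : ((q : 𝕜) ^ ((N : ℤ) - 2)) = qPow 𝕜 N q := by simp [qPow]
  have hsq : (1 - q * qPow 𝕜 N q) ^ 2 = (q * qPow 𝕜 N q - 1) ^ 2 := by ring
  have c3 : (((1 + q ^ 2) * (1 + q ^ ((N : ℤ) - 2)) ^ 2 / (1 - q ^ ((N : ℤ) - 1)) ^ 2 : ℝ) : 𝕜) =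
      (1 + q ^ 2) * (1 + qPow 𝕜 N q) ^ 2 / (q * qPow 𝕜 N q - 1) ^ 2 := by
    rw [h1]; push_cast; rw [hz, hsq]
  have c4 : ((q ^ ((N : ℤ) - 2) * ((1 + q) * (1 + q ^ 2) * (1 + q ^ ((N : ℤ) - 2))
      / (1 - q ^ ((N : ℤ) - 1)) ^ 2) : ℝ) : 𝕜) =
      qPow 𝕜 N q * ((1 + q) * (1 + q ^ 2) * (1 + qPow 𝕜 N q) / (q * qPow 𝕜 N q - 1) ^ 2) := by
    rw [h1]; push_cast; rw [hz, hsq]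
  have hact (F : Fin N → Fin N → A) :
      φ (act (rInv 𝕜 q) F i j) = ∑ k, ∑ l, (matRinv q k l i j : 𝕜) • φ (F k l) := by
    simp [act, rInv]
  have hp : φ (pairing q 𝕜 x z) = contr (met 𝕜 q) (fun k l => QSphere.x 𝕜 N q k • φ (z l)) := by
    simp [pairing, contr, hx]
  rw [relOne, c1, c2, c3, c4, sum_matK, ← hp, relQuad]
  simp only [map_add, map_sub, map_smul, hact, hx, mul_assoc (x i), mul_smul]
  congr 4
  simp only [hp]
  rfl

theorem map_relation_trace (hQ : Nondeg 𝕜 N q (qPow 𝕜 N q)) {x : Fin N → A} (φ : A →ₗ[𝕜] M)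
    (hx : ∀ i b, φ (x i * b) = QSphere.x 𝕜 N q i • φ b) (z : Fin N → A) (a : A) :
    φ (a + (2 * cL q (qPow 𝕜 N q)) • pairing q 𝕜 x z) =
      relTwo 𝕜 q (φ a) (fun l => φ (z l)) := by
  have hq := hQ.pos
  have h1 : q ^ ((N : ℤ) - 1) = q * q ^ ((N : ℤ) - 2) := by
    rw [← zpow_one_add₀ hq.ne']; congr 1; ring
  have hz : ((q : 𝕜) ^ ((N : ℤ) - 2)) = qPow 𝕜 N q := by simp [qPow]
  have c : ((2 * q * ((1 + q ^ ((N : ℤ) - 2)) / ((1 - q) * (1 - q ^ ((N : ℤ) - 1)))) : ℝ) : 𝕜) =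
      2 * cL q (qPow 𝕜 N q) := by
    have e : (1 - q) * (1 - q * q ^ ((N : ℤ) - 2)) = (q - 1) * (q * q ^ ((N : ℤ) - 2) - 1) := by
      ring
    rw [h1, e]; push_cast; rw [hz, cL]; ring
  have hp : φ (pairing q 𝕜 x z) = contr (met 𝕜 q) (fun k l => QSphere.x 𝕜 N q k • φ (z l)) := by
    simp [pairing, contr, hx]
  rw [relTwo, c, map_add, map_smul, hp]
  rfl

variable {M' : Type*} [AddCommGroup M'] [Module 𝕜 M'] [Module (QSphere 𝕜 N q) M']

theorem map_relOne (φ : M →ₗ[𝕜] M') (hφ : ∀ (a : QSphere 𝕜 N q) m, φ (a • m) = a • φ m)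
    (w : Fin N → Fin N → M) (e : Fin N → M) (i j : Fin N) :
    φ (relOne 𝕜 q w e i j) = relOne 𝕜 q (fun k l => φ (w k l)) (fun l => φ (e l)) i j := by
  simp only [relOne, map_add, map_sub, map_smul, map_sum, hφ]

theorem map_relTwo (φ : M →ₗ[𝕜] M') (hφ : ∀ (a : QSphere 𝕜 N q) m, φ (a • m) = a • φ m)
    (m : M) (e : Fin N → M) :
    φ (relTwo 𝕜 q m e) = relTwo 𝕜 q (φ m) (fun l => φ (e l)) := by
  simp only [relTwo, map_add, map_smul, map_sum, hφ]

end Naturality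

/-- The forms `ω_i` in the algebra of forms. -/
theorem wForm_isBimodFamily (hQ : Nondeg 𝕜 N q (qPow 𝕜 N q)) :
    IsBimodFamily q (qPow 𝕜 N q) (xForm 𝕜 N q)
      (formW q (qPow 𝕜 N q) (xForm 𝕜 N q) (dx 𝕜 N q)) :=
  (dx_isFormFamily hQ).isBimodFamily (xForm_isSphereFamily hQ.pos) hQ

theorem dForms_xForm (i : Fin N) : dForms 𝕜 N q (xForm 𝕜 N q i) = dx 𝕜 N q i :=
  UnivCalc.diff_ofAlg _ _

theorem dForms_dx (i : Fin N) : dForms 𝕜 N q (dx 𝕜 N q i) = 0 := by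
  rw [← dForms_xForm]
  exact UnivCalc.diff_diff _ _

theorem dForms_etaForm : dForms 𝕜 N q (etaForm 𝕜 N q) =
    pairing q 𝕜 (dx 𝕜 N q) (dx 𝕜 N q) := by
  rw [etaForm_eq, pairing, pairing, contr, contr]
  simp only [map_sum, map_smul, UnivCalc.diff_mul, dForms_xForm, dForms_dx, mul_zero, add_zero]

theorem signInv_dx (i : Fin N) : UnivCalc.signInv (dPlus 𝕜 N q) (dx 𝕜 N q i) = -dx 𝕜 N q i :=
  UnivCalc.signInv_ofForm _ _

theorem signInv_etaForm : UnivCalc.signInv (dPlus 𝕜 N q) (etaForm 𝕜 N q) = -etaForm 𝕜 N q := by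
  have h (k) : UnivCalc.signInv (dPlus 𝕜 N q) (xForm 𝕜 N q k) = xForm 𝕜 N q k :=
    UnivCalc.signInv_ofAlg _ _
  rw [etaForm_eq, pairing, contr]
  simp only [map_sum, map_smul, map_mul, h, signInv_dx, mul_neg, smul_neg, Finset.sum_neg_distrib]

/-- Differentiating `η x_j = x_j η + λ⁻¹ dx_j` and using `d dx_j = 0` yields the hypothesis of
`quadG_eq_zero_of_leibniz`. -/
theorem quadG_wForm (hQ : Nondeg 𝕜 N q (qPow 𝕜 N q)) (i j : Fin N) :
    quadG q (qPow 𝕜 N q) (formW q (qPow 𝕜 N q) (xForm 𝕜 N q) (dx 𝕜 N q)) i j = 0 := by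
  have hS := xForm_isSphereFamily (𝕜 := 𝕜) (N := N) hQ.pos
  have hB := wForm_isBimodFamily hQ
  refine quadG_eq_zero_of_leibniz hB hQ (fun j => ?_) i j
  have h := congrArg (dForms 𝕜 N q) (formU_mul_x hB hQ j)
  rw [formU_formW hS hQ, pairing_formW hS hQ, ← etaForm_eq] at h ⊢
  rw [map_add, map_smul, dForms_dx, UnivCalc.diff_mul, UnivCalc.diff_mul, dForms_xForm,
    dForms_etaForm, signInv_etaForm] at h
  have h2 : UnivCalc.signInv (dPlus 𝕜 N q) (xForm 𝕜 N q j) = xForm 𝕜 N q j :=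
    UnivCalc.signInv_ofAlg _ _
  rw [h2, smul_zero, add_zero, neg_mul, ← sub_eq_add_neg, sub_eq_iff_eq_add] at h
  rw [h]
  abel

theorem relOne_dx (hQ : Nondeg 𝕜 N q (qPow 𝕜 N q)) (i j : Fin N) :
    relOne 𝕜 q (fun k l => dx 𝕜 N q k * dx 𝕜 N q l)
      (fun l => etaForm 𝕜 N q * dx 𝕜 N q l) i j = 0 := by
  have hS := xForm_isSphereFamily (𝕜 := 𝕜) (N := N) hQ.pos
  have h := relQuad_eq_zero (wForm_isBimodFamily hQ) hQ (quadG_wForm hQ) i j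
  rw [formU_formW hS hQ, pairing_formW hS hQ, ← etaForm_eq] at h
  exact (map_relQuad hQ (x := xForm 𝕜 N q) LinearMap.id (fun _ _ => rfl) _ _ i j).symm.trans h

theorem relTwo_dx (hQ : Nondeg 𝕜 N q (qPow 𝕜 N q)) :
    relTwo 𝕜 q (dForms 𝕜 N q (etaForm 𝕜 N q)) (fun l => etaForm 𝕜 N q * dx 𝕜 N q l) = 0 := by
  have hS := xForm_isSphereFamily (𝕜 := 𝕜) (N := N) hQ.pos
  have h := relation_trace_eq_zero (wForm_isBimodFamily hQ) hQ (quadG_wForm hQ)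
  rw [formU_formW hS hQ, pairing_formW hS hQ, ← etaForm_eq, ← dForms_etaForm] at h
  exact (map_relation_trace hQ (x := xForm 𝕜 N q) LinearMap.id (fun _ _ => rfl) _ _).symm.trans h

/-! ### Generators of the module of two-forms -/

/-- The left module generated by the `dx_i`. -/
noncomputable def spanOne (𝕜 : Type*) [RCLike 𝕜] (N : ℕ) (q : ℝ) :
    Submodule (QSphere 𝕜 N q) (SphereForms 𝕜 N q) :=
  Submodule.span _ (Set.range (dx 𝕜 N q))

/-- The left module generated by the `dx_i ∧ dx_j`. -/
noncomputable def spanTwo (𝕜 : Type*) [RCLike 𝕜] (N : ℕ) (q : ℝ) :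
    Submodule (QSphere 𝕜 N q) (SphereForms 𝕜 N q) :=
  Submodule.span _ (Set.range fun p : Fin N × Fin N => dx 𝕜 N q p.1 * dx 𝕜 N q p.2)

theorem UnivCalc.smul_comm_of_scalar (c : 𝕜) (w : SphereForms 𝕜 N q) :
    c • w = algebraMap 𝕜 (QSphere 𝕜 N q) c • w := by
  rw [UnivCalc.smul_def, AlgHom.commutes, Algebra.smul_def]

/-- The commutation rule writes `dx_i x_j` with all functions on the left, so the left span of the
`dx_i` is also stable from the right. -/
theorem mul_xForm_mem (hQ : Nondeg 𝕜 N q (qPow 𝕜 N q)) (j : Fin N) {v : SphereForms 𝕜 N q}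
    (hv : v ∈ spanOne 𝕜 N q) : v * xForm 𝕜 N q j ∈ spanOne 𝕜 N q := by
  have hc (c : 𝕜) {w} (hw : w ∈ spanOne 𝕜 N q) : c • w ∈ spanOne 𝕜 N q := by
    rw [UnivCalc.smul_comm_of_scalar]; exact Submodule.smul_mem _ _ hw
  have hx (i) {w} (hw : w ∈ spanOne 𝕜 N q) : xForm 𝕜 N q i * w ∈ spanOne 𝕜 N q :=
    Submodule.smul_mem _ (QSphere.x 𝕜 N q i) hw
  have hd (i) : dx 𝕜 N q i ∈ spanOne 𝕜 N q := Submodule.subset_span ⟨i, rfl⟩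
  have hη : pairing q 𝕜 (xForm 𝕜 N q) (dx 𝕜 N q) ∈ spanOne 𝕜 N q := by
    unfold pairing contr
    exact Submodule.sum_mem _ fun k _ => Submodule.sum_mem _ fun l _ => hc _ (hx k (hd l))
  induction hv using Submodule.span_induction with
  | mem v h =>
    obtain ⟨i, rfl⟩ := h
    rw [dx_isFormFamily hQ]
    refine Submodule.add_mem _ (Submodule.sub_mem _ (Submodule.add_mem _ ?_ ?_) ?_) ?_
    · exact Submodule.sum_mem _ fun k _ => Submodule.sum_mem _ fun l _ => hc _ (hx k (hd l))
    · exact hc _ (hx _ (hd _))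
    · exact hc _ (hc _ hη)
    · exact hc _ (hx _ (hx _ hη))
  | zero => rw [zero_mul]; exact Submodule.zero_mem _
  | add v w _ _ hv hw => rw [add_mul]; exact Submodule.add_mem _ hv hw
  | smul a v _ hv =>
    rw [UnivCalc.smul_def, mul_assoc]; exact Submodule.smul_mem _ a hv

theorem mul_ofAlg_mem (hQ : Nondeg 𝕜 N q (qPow 𝕜 N q)) (a : QSphere 𝕜 N q)
    {v : SphereForms 𝕜 N q} (hv : v ∈ spanOne 𝕜 N q) :
    v * UnivCalc.ofAlg (dPlus 𝕜 N q) a ∈ spanOne 𝕜 N q := by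
  induction a using QSphere.induction generalizing v with
  | algebraMap c =>
    rw [AlgHom.commutes, ← Algebra.commutes, ← Algebra.smul_def, UnivCalc.smul_comm_of_scalar]
    exact Submodule.smul_mem _ _ hv
  | x i => exact mul_xForm_mem hQ i hv
  | add a b ha hb => rw [map_add, mul_add]; exact Submodule.add_mem _ (ha hv) (hb hv)
  | mul a b ha hb => rw [map_mul, ← mul_assoc]; exact hb (ha hv)

theorem ofForm_mem_spanOne (hQ : Nondeg 𝕜 N q (qPow 𝕜 N q)) (ω : GammaPlus 𝕜 N q) :
    UnivCalc.ofForm (dPlus 𝕜 N q) ω ∈ spanOne 𝕜 N q := by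
  have hd := dPlus_isFirstOrderCalculus 𝕜 N q
  have h (a) : UnivCalc.ofForm (dPlus 𝕜 N q) (dPlus 𝕜 N q a) ∈ spanOne 𝕜 N q := by
    induction a using QSphere.induction with
    | algebraMap c =>
      rw [Algebra.algebraMap_eq_smul_one, map_smul, hd.map_one, smul_zero, map_zero]
      exact Submodule.zero_mem _
    | x i => exact Submodule.subset_span ⟨i, rfl⟩
    | add a b ha hb => rw [map_add, map_add]; exact Submodule.add_mem _ ha hb
    | mul a b ha hb =>
      rw [hd.leibniz, map_add, UnivCalc.ofForm_rAct, UnivCalc.ofForm_lAct]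
      exact Submodule.add_mem _ (mul_ofAlg_mem hQ b ha) (Submodule.smul_mem _ a hb)
  induction ω using UnivCalc.oneForm_induction hd with
  | add ω η h1 h2 => rw [map_add]; exact Submodule.add_mem _ h1 h2
  | base a b => rw [UnivCalc.ofForm_lAct]; exact Submodule.smul_mem _ a (h b)

theorem mul_mem_spanTwo (hQ : Nondeg 𝕜 N q (qPow 𝕜 N q)) {v w : SphereForms 𝕜 N q}
    (hv : v ∈ spanOne 𝕜 N q) (hw : w ∈ spanOne 𝕜 N q) : v * w ∈ spanTwo 𝕜 N q := by
  induction hw using Submodule.span_induction generalizing v with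
  | mem w h =>
    obtain ⟨j, rfl⟩ := h
    induction hv using Submodule.span_induction with
    | mem v h => obtain ⟨i, rfl⟩ := h; exact Submodule.subset_span ⟨(i, j), rfl⟩
    | zero => rw [zero_mul]; exact Submodule.zero_mem _
    | add v w _ _ hv hw => rw [add_mul]; exact Submodule.add_mem _ hv hw
    | smul a v _ hv =>
      rw [UnivCalc.smul_def, mul_assoc]; exact Submodule.smul_mem _ a hv
  | zero => rw [mul_zero]; exact Submodule.zero_mem _
  | add w w' _ _ h h' => rw [mul_add]; exact Submodule.add_mem _ (h hv) (h' hv)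
  | smul a w _ h => rw [UnivCalc.smul_def, ← mul_assoc]; exact h (mul_ofAlg_mem hQ a hv)

theorem mem_spanTwo_iff (v : SphereForms 𝕜 N q) : v ∈ spanTwo 𝕜 N q ↔
    ∃ a : Fin N × Fin N → QSphere 𝕜 N q, v = ∑ p, a p • (dx 𝕜 N q p.1 * dx 𝕜 N q p.2) := by
  rw [spanTwo, Submodule.mem_span_range_iff_exists_fun]
  exact exists_congr fun a => eq_comm

theorem forms_two_iff (hQ : Nondeg 𝕜 N q (qPow 𝕜 N q)) (v : SphereForms 𝕜 N q) :
    v ∈ UnivCalc.forms (dPlus 𝕜 N q) 2 ↔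
      ∃ a : Fin N × Fin N → QSphere 𝕜 N q,
        v = ∑ p, a p • (dx 𝕜 N q p.1 * dx 𝕜 N q p.2) := by
  constructor
  · intro hv
    rw [← mem_spanTwo_iff]
    have h1 {w} (hw : w ∈ UnivCalc.forms (dPlus 𝕜 N q) 1) : w ∈ spanOne 𝕜 N q := by
      refine Submodule.span_induction (p := fun w _ => w ∈ spanOne 𝕜 N q) ?_
        (Submodule.zero_mem _) (fun _ _ _ _ h h' => Submodule.add_mem _ h h') ?_ hw
      · rintro _ ⟨ω, _, ⟨a, rfl⟩, rfl⟩
        exact mul_ofAlg_mem hQ a (ofForm_mem_spanOne hQ ω)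
      · intro c w _ h
        rw [UnivCalc.smul_comm_of_scalar]; exact Submodule.smul_mem _ _ h
    refine Submodule.span_induction (p := fun w _ => w ∈ spanTwo 𝕜 N q) ?_
        (Submodule.zero_mem _) (fun _ _ _ _ h h' => Submodule.add_mem _ h h') ?_ hv
    · rintro _ ⟨ω, w, hw, rfl⟩
      exact mul_mem_spanTwo hQ (ofForm_mem_spanOne hQ ω) (h1 hw)
    · intro c w _ h
      rw [UnivCalc.smul_comm_of_scalar]; exact Submodule.smul_mem _ _ h
  · rintro ⟨a, rfl⟩
    exact Submodule.sum_mem _ fun p _ => UnivCalc.ofAlg_mul_mem _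
      (UnivCalc.ofForm_mul_mem _ (UnivCalc.ofForm_mem _))

end TwoForms


/-! ### The commutation matrices of the forms `ω_i` -/

section Commutation

variable {𝕜 : Type*} [RCLike 𝕜] {N : ℕ} {q : ℝ} {Q : 𝕜} {X : Type*} [Ring X] [Algebra 𝕜 X]
  {x : Fin N → X}

/-- The matrix `ρ(x_j)` with `ω_i x_j = ρ(x_j)_{il} ω_l`. -/
noncomputable def rhoX (𝕜 : Type*) [RCLike 𝕜] [Algebra 𝕜 X] (q : ℝ)
    (x : Fin N → X) (j : Fin N) :
    Matrix (Fin N) (Fin N) (X) :=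
  Matrix.of fun i l => ∑ k, rInv 𝕜 q k l i j • x k

theorem rhoX_mulVec (x : Fin N → X) (j : Fin N) (H : Fin N → X) (i : Fin N) :
    Matrix.mulVec (rhoX 𝕜 q x j) H i =
      act (rInv 𝕜 q) (fun k l => x k * H l) i j := by
  simp only [Matrix.mulVec, dotProduct, rhoX, Matrix.of_apply, act, Finset.sum_mul]
  rw [Finset.sum_comm]
  exact Finset.sum_congr rfl fun k _ => Finset.sum_congr rfl fun l _ => smul_mul_assoc _ _ _

theorem act_mulVec (R : Fin N → Fin N → Fin N → Fin N → 𝕜)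
    (F : Fin N → Fin N → Matrix (Fin N) (Fin N) (X)) (H : Fin N → X)
    (i j m : Fin N) :
    Matrix.mulVec (act R F i j) H m = act R (fun k l => Matrix.mulVec (F k l) H m) i j := by
  simp [act, Matrix.sum_mulVec, Matrix.smul_mulVec]

/-- A product `ρ(x_i) ρ(x_j)` is two crossings of a form with the `x`'s. The braid relation carries
`R⁻` through them onto the `x`'s that emerge on the left, where the relation of the sphere applies;
the unit relation passes by sliding a cap. -/
theorem rhoX_isSphereFamily (hS : IsSphereFamily q Q x) (hq : 0 < q) :
    IsSphereFamily q Q (rhoX 𝕜 q x) := by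
  have hP (i j) (H : Fin N → X) (m) :
      Matrix.mulVec (rhoX 𝕜 q x i * rhoX 𝕜 q x j) H m = act (rInv 𝕜 q) (fun a b =>
        act (rInv 𝕜 q) (fun c d => x a * (x c * H d)) b j) m i := by
    rw [← Matrix.mulVec_mulVec, rhoX_mulVec]
    simp only [rhoX_mulVec, mul_act]
  have hx (e : X) (i j) := act_x_mul hS e i j
  constructor
  · intro i j
    refine Matrix.ext_of_mulVec_single fun p => ?_
    generalize (Pi.single p 1 : Fin N → X) = H
    funext m
    rw [act_mulVec]
    simp only [hP, Matrix.add_mulVec, Matrix.smul_mulVec, Matrix.one_mulVec, Pi.add_apply,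
      Pi.smul_apply]
    refine (act_braid hq (fun a c d => x a * (x c * H d)) m i j).symm.trans ?_
    simp only [hx, act_add, act_smul, act_act_met_left hq, mul_smul]
  · refine Matrix.ext_of_mulVec_single fun p => ?_
    generalize (Pi.single p 1 : Fin N → X) = H
    funext m
    have : Matrix.mulVec (contr (met 𝕜 q) fun k l => rhoX 𝕜 q x k * rhoX 𝕜 q x l) H m =
      contr (met 𝕜 q) fun k l => Matrix.mulVec (rhoX 𝕜 q x k * rhoX 𝕜 q x l) H m := by
      simp [contr, Matrix.sum_mulVec, Matrix.smul_mulVec]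
    rw [this]
    simp only [hP]
    rw [contr_act_act_right hq, Matrix.one_mulVec]
    exact pairing_self_mul hS (H m)

/-- The projection `E_{il} = x_i C_{ml} x_m`. -/
noncomputable def projE (𝕜 : Type*) [RCLike 𝕜] [Algebra 𝕜 X] (q : ℝ)
    (x : Fin N → X) :
    Matrix (Fin N) (Fin N) (X) :=
  Matrix.vecMulVec (x) (fun l => ∑ m, met 𝕜 q m l • x m)

theorem projE_mul_self (hS : IsSphereFamily q Q x) : projE 𝕜 q x * projE 𝕜 q x = projE 𝕜 q x := by
  have h : dotProduct (fun l => ∑ m, met 𝕜 q m l • x m) (x) = 1 := by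
    refine Eq.trans ?_ hS.unit
    simp only [dotProduct, contr, Finset.sum_mul]
    rw [Finset.sum_comm]
    exact Finset.sum_congr rfl fun k _ => Finset.sum_congr rfl fun l _ => smul_mul_assoc _ _ _
  rw [projE, Matrix.vecMulVec_mul_vecMulVec, h, one_smul]

/-- The matrix of the change of basis from the `ω_i` to the `dx_i`. -/
noncomputable def baseP (q : ℝ) (Q : 𝕜) (x : Fin N → X) :
    Matrix (Fin N) (Fin N) (X) :=
  cB q Q • 1 + cA q Q • projE 𝕜 q x

/-- The matrix of the change of basis from the `dx_i` to the `ω_i`. -/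
noncomputable def baseInv (q : ℝ) (Q : 𝕜) (x : Fin N → X) :
    Matrix (Fin N) (Fin N) (X) :=
  (cB q Q)⁻¹ • (1 - cA q Q • projE 𝕜 q x)

/-- `E` is idempotent and `α + β = 1`, so `β + α E` is inverted on the image of `E` and on its
complement. -/
theorem baseP_mul_baseInv (hS : IsSphereFamily q Q x) (hQ : Nondeg 𝕜 N q Q) :
    baseP q Q x * baseInv q Q x = 1 := by
  have h := eq_sub_of_add_eq (cA_add_cB hQ)
  have h0 := cB_ne_zero hQ
  rw [baseP, baseInv, mul_smul_comm, inv_smul_eq_iff₀ h0]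
  simp only [add_mul, mul_sub, smul_mul_assoc, mul_smul_comm, one_mul, mul_one,
    projE_mul_self hS]
  rw [h]
  module

end Commutation


/-! ### A representation of forms up to degree two -/

section Representation

variable {𝕜 : Type*} [RCLike 𝕜] {N : ℕ} {q : ℝ} {Q : 𝕜} {X : Type*} [Ring X] [Algebra 𝕜 X]
  {Z : Type*} [AddCommGroup Z] [Module 𝕜 Z] [Module X Z] [IsScalarTower 𝕜 X Z]
  {x : Fin N → X} {sym : Fin N → Fin N → Z}

/-- The space of forms of degree at most two. -/
abbrev LowForms (N : ℕ) (X Z : Type*) : Type _ := X × (Fin N → X) × Z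

/-- The action of functions by left multiplication. -/
noncomputable def leftOp (𝕜 : Type*) [RCLike 𝕜] (N : ℕ) (X Z : Type*) [Ring X] [Algebra 𝕜 X]
    [AddCommGroup Z] [Module 𝕜 Z] [Module X Z] [IsScalarTower 𝕜 X Z] :
    X →ₐ[𝕜] Module.End 𝕜 (LowForms N X Z) :=
  Algebra.lsmul 𝕜 𝕜 (LowForms N X Z)

theorem leftOp_apply (a : X) (p : LowForms N X Z) : leftOp 𝕜 N X Z a p = a • p := rfl

/-- The operator of exterior multiplication by a one-form with commutation matrix `T`. -/
noncomputable def formOp (sym : Fin N → Fin N → Z) (T : X →ₗ[𝕜] Matrix (Fin N) (Fin N) (X))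
    (i : Fin N) : Module.End 𝕜 (LowForms N X Z) where
  -- The middle component holds coordinates in the basis `dx_j`: row `i` of `T a` gives the
  -- coordinates of the `i`-th form times `a`, and `dx_l ∧ dx_j` is sent to `sym l j`. Degrees above
  -- two are dropped.
  toFun p := (0, T p.1 i, ∑ j, ∑ l, T (p.2.1 j) i l • sym l j)
  map_add' p p' := by
    simp [add_smul, Finset.sum_add_distrib, Matrix.add_apply]
    rfl
  map_smul' c p := by
    refine Prod.ext (smul_zero c).symm (Prod.ext ?_ ?_)
    · exact congrFun (map_smul T c p.1) i
    · simp only [Prod.smul_snd, Prod.smul_fst, Pi.smul_apply, map_smul, Matrix.smul_apply,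
        smul_assoc, RingHom.id_apply]
      simp only [Finset.smul_sum]

theorem formOp_apply (T : X →ₗ[𝕜] Matrix (Fin N) (Fin N) (X))
    (i : Fin N) (p : LowForms N X Z) :
    formOp sym T i p = (0, T p.1 i, ∑ j, ∑ l, T (p.2.1 j) i l • sym l j) := rfl

theorem sum_leftOp_mul_formOp (P : Matrix (Fin N) (Fin N) (X))
    (T : X →ₗ[𝕜] Matrix (Fin N) (Fin N) (X)) (i : Fin N) :
    ∑ l, leftOp 𝕜 N X Z (P i l) * formOp sym T l = formOp sym (LinearMap.mulLeft 𝕜 P ∘ₗ T) i := by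
  refine LinearMap.ext fun p => ?_
  simp only [LinearMap.sum_apply, Module.End.mul_apply, leftOp_apply, formOp_apply, Prod.smul_mk,
    LinearMap.comp_apply, LinearMap.mulLeft_apply]
  refine Prod.ext ?_ (Prod.ext ?_ ?_)
  · simp [Prod.fst_sum]
  · simp only [Prod.snd_sum, Prod.fst_sum]
    funext m
    simp [Matrix.mul_apply, Finset.sum_apply]
  · simp only [Prod.snd_sum, Matrix.mul_apply, Finset.smul_sum, Finset.sum_smul, smul_smul]
    rw [Finset.sum_comm]
    exact Finset.sum_congr rfl fun j _ => Finset.sum_comm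

theorem formOp_mul_leftOp (T : X →ₗ[𝕜] Matrix (Fin N) (Fin N) (X))
    (i : Fin N) (a : X) :
    formOp sym T i * leftOp 𝕜 N X Z a = formOp sym (T ∘ₗ LinearMap.mulLeft 𝕜 a) i := rfl

theorem formOp_mul_formOp_apply
    (T T' : X →ₗ[𝕜] Matrix (Fin N) (Fin N) (X)) (i j : Fin N)
    (p : LowForms N X Z) :
    (formOp sym T i * formOp sym T' j) p =
      (0, 0, ∑ m, ∑ l, T (T' p.1 j m) i l • sym l m) := by
  simp only [Module.End.mul_apply, formOp_apply, map_zero]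
  rfl

/-- The operators which depend only on the component of degree zero and have values in degree
two. -/
def degTwo (𝕜 : Type*) [RCLike 𝕜] (N : ℕ) (X Z : Type*) [Ring X] [Algebra 𝕜 X]
    [AddCommGroup Z] [Module 𝕜 Z] :
    Submodule 𝕜 (Module.End 𝕜 (LowForms N X Z)) where
  carrier := {b | ∀ p, b p = (0, 0, (b (p.1, 0, 0)).2.2)}
  zero_mem' p := rfl
  add_mem' {b b'} h h' p := by
    rw [LinearMap.add_apply, h p, h' p]
    simp
  smul_mem' c b h p := by
    rw [LinearMap.smul_apply, h p]
    simp

theorem formOp_mul_formOp_mem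
    (T T' : X →ₗ[𝕜] Matrix (Fin N) (Fin N) (X)) (i j : Fin N) :
    formOp sym T i * formOp sym T' j ∈ degTwo 𝕜 N X Z := fun p => by
  simp only [formOp_mul_formOp_apply]

/-- The operators of exterior multiplication by the `ω_i`. -/
noncomputable def wOp (q : ℝ) (Q : 𝕜) (x : Fin N → X) (ρ : X →ₐ[𝕜] Matrix (Fin N) (Fin N) X)
    (sym : Fin N → Fin N → Z) (i : Fin N) :
    Module.End 𝕜 (LowForms N X Z) :=
  -- `ω_i a = ρ(a)_{il} ω_l`, and `baseInv` expresses the `ω_l` in the basis `dx_m`.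
  formOp sym (LinearMap.mulRight 𝕜 (baseInv q Q x) ∘ₗ ρ.toLinearMap) i

/-- The operators of multiplication by the `x_i`. -/
noncomputable def xOp (𝕜 : Type*) [RCLike 𝕜] [Algebra 𝕜 X] (Z : Type*) [AddCommGroup Z]
    [Module 𝕜 Z] [Module X Z] [IsScalarTower 𝕜 X Z] (x : Fin N → X) (i : Fin N) :
    Module.End 𝕜 (LowForms N X Z) := leftOp 𝕜 N X Z (x i)

theorem map_smul_mul {A B : Type*} [Ring A] [Algebra 𝕜 A] [Ring B] [Algebra 𝕜 B] (f : A →ₐ[𝕜] B)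
    (c : 𝕜) (a : A) (b : B) : f (c • a) * b = c • (f a * b) := by
  rw [map_smul, smul_mul_assoc]

theorem wOp_isBimodFamily (hS : IsSphereFamily q Q x) {ρ : X →ₐ[𝕜] Matrix (Fin N) (Fin N) X}
    (hρ : ∀ j, ρ (x j) = rhoX 𝕜 q x j) (sym : Fin N → Fin N → Z) :
    IsBimodFamily q Q (xOp 𝕜 Z x) (wOp q Q x ρ sym) := by
  refine ⟨hS.map (leftOp 𝕜 N X Z), fun i j => ?_⟩
  have h : wOp q Q x ρ sym i * xOp 𝕜 Z x j =
      ∑ l, leftOp 𝕜 N X Z (rhoX 𝕜 q x j i l) * wOp q Q x ρ sym l := by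
    unfold wOp xOp
    rw [sum_leftOp_mul_formOp, formOp_mul_leftOp]
    congr 1
    refine LinearMap.ext fun a => ?_
    simp only [LinearMap.comp_apply, LinearMap.mulLeft_apply, LinearMap.mulRight_apply,
      AlgHom.toLinearMap_apply, map_mul, hρ, mul_assoc]
  rw [h, act, Finset.sum_comm]
  refine Finset.sum_congr rfl fun l _ => ?_
  rw [rhoX, Matrix.of_apply, map_sum, Finset.sum_mul]
  refine Finset.sum_congr rfl fun k _ => ?_
  rw [map_smul_mul]
  rfl

/-- The operators of exterior multiplication by the `dx_i`. -/
noncomputable def uOp (q : ℝ) (Q : 𝕜) (x : Fin N → X) (ρ : X →ₐ[𝕜] Matrix (Fin N) (Fin N) X)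
    (sym : Fin N → Fin N → Z) (i : Fin N) :
    Module.End 𝕜 (LowForms N X Z) := formU q Q (xOp 𝕜 Z x) (wOp q Q x ρ sym) i

/-- The matrix of `a` becomes `P ρ(a) P⁻¹`. It is the identity at `a = 1`, which is why evaluation
at `1` returns `sym i j`. -/
theorem uOp_eq (ρ : X →ₐ[𝕜] Matrix (Fin N) (Fin N) X) (i : Fin N) : uOp q Q x ρ sym i =
    formOp sym (LinearMap.mulLeft 𝕜 (baseP q Q x) ∘ₗ
      LinearMap.mulRight 𝕜 (baseInv q Q x) ∘ₗ ρ.toLinearMap) i := by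
  rw [← sum_leftOp_mul_formOp]
  have h1 : ∑ l, leftOp 𝕜 N X Z (projE 𝕜 q x i l) * wOp q Q x ρ sym l =
      xOp 𝕜 Z x i * pairing q 𝕜 (xOp 𝕜 Z x) (wOp q Q x ρ sym) := by
    rw [pairing, contr, Finset.sum_comm, Finset.mul_sum]
    refine Finset.sum_congr rfl fun l _ => ?_
    rw [projE, Matrix.vecMulVec_apply, map_mul, map_sum, mul_assoc, Finset.sum_mul]
    congr 1
    refine Finset.sum_congr rfl fun k _ => ?_
    rw [map_smul_mul]
    rfl
  have h2 : ∑ l, leftOp 𝕜 N X Z ((1 : Matrix (Fin N) (Fin N) (X)) i l) * wOp q Q x ρ sym l =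
      wOp q Q x ρ sym i := by
    simp [Matrix.one_apply, apply_ite (leftOp 𝕜 N X Z), ite_mul]
  rw [uOp, formU, ← h1, ← h2]
  simp only [baseP, Matrix.add_apply, Matrix.smul_apply, map_add, map_smul_mul, add_mul,
    Finset.sum_add_distrib, ← Finset.smul_sum]
  rw [add_comm]
  rfl

/-- The component of degree two of the value at `1`. -/
noncomputable def evalTwo (𝕜 : Type*) [RCLike 𝕜] (N : ℕ) (X Z : Type*) [Ring X] [Algebra 𝕜 X]
    [AddCommGroup Z] [Module 𝕜 Z] :
    Module.End 𝕜 (LowForms N X Z) →ₗ[𝕜] Z where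
  toFun b := (b (1, 0, 0)).2.2
  map_add' _ _ := rfl
  map_smul' _ _ := rfl

theorem evalTwo_leftOp_mul (a : X) (b : Module.End 𝕜 (LowForms N X Z)) :
    evalTwo 𝕜 N X Z (leftOp 𝕜 N X Z a * b) = a • evalTwo 𝕜 N X Z b := rfl

theorem evalTwo_uOp (hS : IsSphereFamily q Q x) (hQ : Nondeg 𝕜 N q Q)
    (ρ : X →ₐ[𝕜] Matrix (Fin N) (Fin N) X) (i j : Fin N) :
    evalTwo 𝕜 N X Z (uOp q Q x ρ sym i * uOp q Q x ρ sym j) = sym i j := by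
  change ((uOp q Q x ρ sym i * uOp q Q x ρ sym j) (1, 0, 0)).2.2 = _
  rw [uOp_eq, uOp_eq, formOp_mul_formOp_apply]
  have h1 : (LinearMap.mulLeft 𝕜 (baseP q Q x) ∘ₗ LinearMap.mulRight 𝕜 (baseInv q Q x) ∘ₗ
      ρ.toLinearMap) 1 = 1 := by
    simp [baseP_mul_baseInv hS hQ]
  simp only [h1]
  rw [Finset.sum_eq_single j, Finset.sum_eq_single i]
  · rw [Matrix.one_apply_eq, h1, Matrix.one_apply_eq, one_smul]
  · intro l _ hl
    rw [Matrix.one_apply_eq, h1, Matrix.one_apply_ne hl.symm, zero_smul]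
  · simp
  · intro m _ hm
    simp only [Matrix.one_apply_ne hm.symm, map_zero, Matrix.zero_apply, zero_smul,
      Finset.sum_const_zero]
  · simp

theorem evalTwo_pairing_uOp (hS : IsSphereFamily q Q x) (hQ : Nondeg 𝕜 N q Q)
    (ρ : X →ₐ[𝕜] Matrix (Fin N) (Fin N) X) (j : Fin N) :
    evalTwo 𝕜 N X Z (pairing q 𝕜 (xOp 𝕜 Z x) (wOp q Q x ρ sym) * uOp q Q x ρ sym j) =
      contr (met 𝕜 q) (fun k l => x k • sym l j) := by
  have hS' : IsSphereFamily q Q (xOp 𝕜 Z x) := hS.map (leftOp 𝕜 N X Z)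
  rw [← pairing_formU hS' hQ]
  have h (k l) : evalTwo 𝕜 N X Z (xOp 𝕜 Z x k * (uOp q Q x ρ sym l * uOp q Q x ρ sym j)) =
      x k • sym l j := by
    rw [xOp, evalTwo_leftOp_mul, evalTwo_uOp hS hQ]
  rw [pairing, contr_mul, contr, contr]
  simp only [map_sum, map_smul, mul_assoc]
  refine Finset.sum_congr rfl fun k _ => Finset.sum_congr rfl fun l _ => ?_
  exact congrArg (fun v => met 𝕜 q k l • v) (h k l)

end Representation


/-! ### From relations in the module `Z` to relations between operators -/

section Representation

universe u v

variable {𝕜 : Type*} [RCLike 𝕜] {N : ℕ} {q : ℝ} {Q : 𝕜} {X : Type*} [Ring X] [Algebra 𝕜 X]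
  {Z : Type*} [AddCommGroup Z] [Module 𝕜 Z] [Module X Z] [IsScalarTower 𝕜 X Z]
  {x : Fin N → X} {sym : Fin N → Fin N → Z}

theorem quadG_wOp_mem (ρ : X →ₐ[𝕜] Matrix (Fin N) (Fin N) X) (i j : Fin N) :
    quadG q Q (wOp q Q x ρ sym) i j ∈ degTwo 𝕜 N X Z := by
  have h (k l) : wOp q Q x ρ sym k * wOp q Q x ρ sym l ∈ degTwo 𝕜 N X Z :=
    formOp_mul_formOp_mem _ _ k l
  unfold quadG act pairing contr
  refine Submodule.sub_mem _ (Submodule.add_mem _ ?_ (Submodule.smul_mem _ _ (h i j)))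
    (Submodule.smul_mem _ _ ?_)
  · exact Submodule.sum_mem _ fun k _ => Submodule.sum_mem _ fun l _ => Submodule.smul_mem _ _ (h k l)
  · exact Submodule.sum_mem _ fun k _ => Submodule.sum_mem _ fun l _ => Submodule.smul_mem _ _ (h k l)

/-- If the relations between two-forms hold in `Z`, then the operators `ω_i` satisfy the quadratic
relations. -/
theorem quadG_wOp_eq_zero (hS : IsSphereFamily q Q x) (hQ : Nondeg 𝕜 N q Q)
    (hgen : Algebra.adjoin 𝕜 (Set.range x) = ⊤)
    {ρ : X →ₐ[𝕜] Matrix (Fin N) (Fin N) X} (hρ : ∀ j, ρ (x j) = rhoX 𝕜 q x j)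
    (h1 : ∀ i j, evalTwo 𝕜 N X Z (relQuad q Q (xOp 𝕜 Z x) (uOp q Q x ρ sym)
      (fun l => pairing q 𝕜 (xOp 𝕜 Z x) (wOp q Q x ρ sym) * uOp q Q x ρ sym l) i j) = 0)
    (h2 : evalTwo 𝕜 N X Z (pairing q 𝕜 (uOp q Q x ρ sym) (uOp q Q x ρ sym) + (2 * cL q Q) •
      pairing q 𝕜 (xOp 𝕜 Z x) (fun l => pairing q 𝕜 (xOp 𝕜 Z x) (wOp q Q x ρ sym) *
        uOp q Q x ρ sym l)) = 0) (i j : Fin N) :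
    quadG q Q (wOp q Q x ρ sym) i j = 0 := by
  have hB := wOp_isBimodFamily hS hρ sym
  have hx (k b) : evalTwo 𝕜 N X Z (xOp 𝕜 Z x k * b) = x k • evalTwo 𝕜 N X Z b :=
    evalTwo_leftOp_mul (x k) b
  have h0 (i j) : evalTwo 𝕜 N X Z (quadG q Q (wOp q Q x ρ sym) i j) = 0 :=
    quadG_mem_of_relations hB hQ (LinearMap.ker (evalTwo 𝕜 N X Z))
      (fun k b hb => by
        rw [LinearMap.mem_ker] at hb ⊢
        rw [hx, hb, smul_zero]) h1 h2 i j
  -- So far `G` vanishes only at `1`. Since `G x_k` can be rewritten with the functions to the left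
  -- of `G`, vanishing at `b` for all `i, j` passes to `x_k b`, and so to all of `X`.
  have h3 (a : X) : ∀ b, (∀ i j, evalTwo 𝕜 N X Z (quadG q Q (wOp q Q x ρ sym) i j *
      leftOp 𝕜 N X Z b) = 0) → ∀ i j, evalTwo 𝕜 N X Z (quadG q Q (wOp q Q x ρ sym) i j *
      leftOp 𝕜 N X Z (a * b)) = 0 := by
    have ha : a ∈ Algebra.adjoin 𝕜 (Set.range x) := hgen ▸ Algebra.mem_top
    induction ha using Algebra.adjoin_induction with
    | mem a h =>
      obtain ⟨k, rfl⟩ := h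
      intro b hb i j
      rw [map_mul (leftOp 𝕜 N X Z), ← mul_assoc]
      have := quadG_mul_x hB hQ i j k
      rw [xOp] at this
      rw [this, act_mul]
      simp only [act, map_sum, map_smul, Finset.sum_mul, smul_mul_assoc, mul_assoc, hx, hb,
        smul_zero, Finset.sum_const_zero]
    | algebraMap c =>
      intro b hb i j
      rw [← Algebra.smul_def, map_smul, mul_smul_comm, map_smul, hb, smul_zero]
    | add a a' _ _ h h' =>
      intro b hb i j
      rw [add_mul, map_add, mul_add, map_add, h b hb, h' b hb, add_zero]
    | mul a a' _ _ h h' =>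
      intro b hb i j
      rw [mul_assoc]
      exact h _ (h' b hb) i j
  refine LinearMap.ext fun p => ?_
  -- For degree reasons `G` depends only on the degree-zero component, so its values on `X`
  -- determine it.
  rw [quadG_wOp_mem ρ i j p]
  have h4 : leftOp 𝕜 N X Z (p.1 * 1) (1, 0, 0) = (p.1, 0, 0) := by
    rw [leftOp_apply, mul_one, Prod.smul_mk, Prod.smul_mk, smul_zero, smul_zero, smul_eq_mul,
      mul_one]
  have h5 := h3 p.1 1 (fun i j => by rw [map_one, mul_one]; exact h0 i j) i j
  have h6 : ((quadG q Q (wOp q Q x ρ sym) i j) (p.1, 0, 0)).2.2 = 0 := by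
    rw [← h4]; exact h5
  rw [h6]
  rfl

/-- If the relations between two-forms hold in `Z`, then `η η` commutes with the functions. -/
theorem eta_sq_comm_leftOp (hS : IsSphereFamily q Q x) (hQ : Nondeg 𝕜 N q Q)
    (hgen : Algebra.adjoin 𝕜 (Set.range x) = ⊤)
    {ρ : X →ₐ[𝕜] Matrix (Fin N) (Fin N) X} (hρ : ∀ j, ρ (x j) = rhoX 𝕜 q x j)
    (h : ∀ i j, quadG q Q (wOp q Q x ρ sym) i j = 0) (a : X) :
    Commute (pairing q 𝕜 (xOp 𝕜 Z x) (wOp q Q x ρ sym) *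
      pairing q 𝕜 (xOp 𝕜 Z x) (wOp q Q x ρ sym)) (leftOp 𝕜 N X Z a) := by
  have hB := wOp_isBimodFamily hS hρ sym
  have ha : a ∈ Algebra.adjoin 𝕜 (Set.range x) := hgen ▸ Algebra.mem_top
  induction ha using Algebra.adjoin_induction with
  | mem a h' => obtain ⟨k, rfl⟩ := h'; exact pairing_sq_comm hB hQ h k
  | algebraMap c => rw [AlgHom.commutes]; exact (Algebra.commutes c _).symm
  | add a a' _ _ h h' => rw [map_add]; exact h.add_right h'
  | mul a a' _ _ h h' => rw [map_mul]; exact h.mul_right h'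

/-- For every choice of elements `sym i j` of a module there are operators `x_i`, `ω_i` which
satisfy the commutation relations and a functional `ev` with `ev (dx_i dx_j) = sym i j`. -/
theorem exists_operators {X : Type u} [Ring X] [Algebra 𝕜 X] {Z : Type v} [AddCommGroup Z]
    [Module 𝕜 Z] [Module X Z] [IsScalarTower 𝕜 X Z] {y : Fin N → X}
    (hS : IsSphereFamily q Q y) (hQ : Nondeg 𝕜 N q Q)
    (hgen : Algebra.adjoin 𝕜 (Set.range y) = ⊤)
    {ρ : X →ₐ[𝕜] Matrix (Fin N) (Fin N) X} (hρ : ∀ j, ρ (y j) = rhoX 𝕜 q y j)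
    (sym : Fin N → Fin N → Z) :
    ∃ (B : Type (max u v)) (_ : Ring B) (_ : Algebra 𝕜 B) (f : X →ₐ[𝕜] B) (x w : Fin N → B)
      (ev : B →ₗ[𝕜] Z), (∀ i, f (y i) = x i) ∧ IsBimodFamily q Q x w ∧
      (∀ a b, ev (f a * b) = a • ev b) ∧
      (∀ i j, ev (formU q Q x w i * formU q Q x w j) = sym i j) ∧
      (∀ j, ev (pairing q 𝕜 x w * formU q Q x w j) =
        contr (met 𝕜 q) fun k l => y k • sym l j) ∧
      ((∀ i j, ev (relQuad q Q x (formU q Q x w)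
          (fun l => pairing q 𝕜 x w * formU q Q x w l) i j) = 0) →
        ev (pairing q 𝕜 (formU q Q x w) (formU q Q x w) + (2 * cL q Q) •
          pairing q 𝕜 x (fun l => pairing q 𝕜 x w * formU q Q x w l)) = 0 →
        ∀ a, Commute (pairing q 𝕜 x w * pairing q 𝕜 x w) (f a)) :=
  ⟨Module.End 𝕜 (LowForms N X Z), inferInstance, inferInstance, leftOp 𝕜 N X Z, xOp 𝕜 Z y,
    wOp q Q y ρ sym, evalTwo 𝕜 N X Z, fun _ => rfl, wOp_isBimodFamily hS hρ sym,
    evalTwo_leftOp_mul, evalTwo_uOp hS hQ ρ, evalTwo_pairing_uOp hS hQ ρ, fun h1 h2 a =>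
    eta_sq_comm_leftOp hS hQ hgen hρ (quadG_wOp_eq_zero hS hQ hgen hρ h1 h2) a⟩

end Representation

/-! ### Inner calculi -/

section Inner

variable {𝕜 : Type*} [CommRing 𝕜] {X : Type*} [Ring X] [Algebra 𝕜 X] {B : Type*} [Ring B]
  [Algebra 𝕜 B]

/-- The algebra `B` as a bimodule over `X`. -/
noncomputable def envAct (f : X →ₐ[𝕜] B) : Env 𝕜 X →ₐ[𝕜] Module.End 𝕜 B :=
  Algebra.TensorProduct.lift ((Algebra.lsmul 𝕜 𝕜 B).comp f)
    ((Algebra.lsmul 𝕜 𝕜 B : Bᵐᵒᵖ →ₐ[𝕜] Module.End 𝕜 B).comp (AlgHom.op f))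
    (fun a b => LinearMap.ext fun c => (mul_assoc (f a) c (f b.unop)).symm)

theorem envAct_tmul (f : X →ₐ[𝕜] B) (a : X) (b : Xᵐᵒᵖ) (c : B) :
    envAct f (Env.tmul 𝕜 a b) c = f a * (c * f b.unop) :=
  congrArg (fun g : Module.End 𝕜 B => g c) (Algebra.TensorProduct.lift_tmul _ _ _ a b)

/-- The commutator with `θ`. -/
noncomputable def innerD (f : X →ₐ[𝕜] B) (θ : B) : X →ₗ[𝕜] B :=
  LinearMap.mulLeft 𝕜 θ ∘ₗ f.toLinearMap - LinearMap.mulRight 𝕜 θ ∘ₗ f.toLinearMap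

theorem innerD_apply (f : X →ₐ[𝕜] B) (θ : B) (a : X) : innerD f θ a = θ * f a - f a * θ := rfl

theorem innerD_mul (f : X →ₐ[𝕜] B) (θ : B) (a b : X) :
    innerD f θ (a * b) = innerD f θ a * f b + f a * innerD f θ b := by
  simp only [innerD_apply, map_mul]
  noncomm_ring

/-- When `θ²` commutes with functions, `Da Db = θ (a Db) + (a Db) θ` depends linearly on `a Db`
alone; this is the condition imposed by the universal calculus. -/
theorem sum_innerD_mul_innerD (f : X →ₐ[𝕜] B) {θ : B} (hθ : ∀ a, Commute (θ * θ) (f a)) {n : ℕ}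
    {a b : Fin n → X} (h : ∑ k, f (a k) * innerD f θ (b k) = 0) :
    ∑ k, innerD f θ (a k) * innerD f θ (b k) = 0 := by
  have e (k) : innerD f θ (a k) * innerD f θ (b k) =
      θ * (f (a k) * innerD f θ (b k)) + f (a k) * innerD f θ (b k) * θ := by
    have := (hθ (b k)).eq
    simp only [innerD_apply]
    have h2 : f (a k) * (θ * θ * f (b k)) = f (a k) * (f (b k) * (θ * θ)) := by rw [this]
    simp only [mul_sub, sub_mul, mul_assoc] at h2 ⊢
    rw [h2]
    abel
  simp only [e, Finset.sum_add_distrib, ← Finset.mul_sum, ← Finset.sum_mul, h, mul_zero, zero_mul,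
    add_zero]

end Inner


/-! ### The universal property of `Γ₊` -/

section Lift

variable {𝕜 : Type*} [RCLike 𝕜] {N : ℕ} {q : ℝ} {B : Type*} [Ring B] [Algebra 𝕜 B]

/-- The bimodule `Γ₊` maps to every algebra with a derivation which satisfies the commutation
relations. -/
theorem GammaPlus.exists_lift (f : QSphere 𝕜 N q →ₐ[𝕜] B) (D : QSphere 𝕜 N q →ₗ[𝕜] B)
    (hD : ∀ a b, D (a * b) = D a * f b + f a * D b)
    (hbimod : ∀ i j, D (QSphere.x 𝕜 N q i) * f (QSphere.x 𝕜 N q j) =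
      (∑ k, ∑ l, (matRinv q k l i j : 𝕜) • (f (QSphere.x 𝕜 N q k) * D (QSphere.x 𝕜 N q l)))
      + ((q - 1 : ℝ) : 𝕜) • (f (QSphere.x 𝕜 N q i) * D (QSphere.x 𝕜 N q j))
      + (((q ^ (N : ℤ) - q ^ ((N : ℤ) - 2)) / (1 - q ^ ((N : ℤ) - 1)) : ℝ) : 𝕜) •
          ∑ k, ∑ l, (matK q k l i j : 𝕜) • (f (QSphere.x 𝕜 N q k) * D (QSphere.x 𝕜 N q l))
      + (((1 - q) * (1 + q ^ ((N : ℤ) - 2)) / (1 - q ^ ((N : ℤ) - 1)) : ℝ) : 𝕜) •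
          ∑ k, ∑ l, (metC q k l : 𝕜) • (f (QSphere.x 𝕜 N q i) * f (QSphere.x 𝕜 N q j) *
            f (QSphere.x 𝕜 N q k) * D (QSphere.x 𝕜 N q l))) :
    ∃ g : GammaPlus 𝕜 N q →ₗ[𝕜] B, (∀ a, g (dPlus 𝕜 N q a) = D a) ∧
      (∀ a ω, g (lAct 𝕜 a ω) = f a * g ω) ∧ ∀ ω b, g (rAct 𝕜 ω b) = g ω * f b := by
  let _ : Module (Env 𝕜 (QSphere 𝕜 N q)) B := Module.compHom B (envAct f).toRingHom
  have hs (e : Env 𝕜 (QSphere 𝕜 N q)) (c : B) : e • c = envAct f e c := rfl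
  let L : (QSphere 𝕜 N q →₀ Env 𝕜 (QSphere 𝕜 N q)) →ₗ[Env 𝕜 (QSphere 𝕜 N q)] B :=
    Finsupp.linearCombination (Env 𝕜 (QSphere 𝕜 N q)) D
  have hl (a) (c : B) : lAct 𝕜 a c = f a * c := by
    rw [lAct, hs, envAct_tmul, MulOpposite.unop_one, map_one, mul_one]
  have hr (c : B) (b) : rAct 𝕜 c b = c * f b := by
    rw [rAct, hs, envAct_tmul, MulOpposite.unop_op, map_one, one_mul]
  have hc (c : 𝕜) (b : B) : (algebraMap 𝕜 (Env 𝕜 (QSphere 𝕜 N q)) c) • b = c • b := by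
    rw [hs, AlgHom.commutes]; rfl
  have Lpre (a) : L (preD 𝕜 N q a) = D a := by
    rw [preD, Finsupp.linearCombination_single, one_smul]
  have Lsmul (c : 𝕜) (v) : L (c • v) = c • L v := by
    rw [← hc, ← map_smul, algebraMap_smul]
  have Ll (a v) : L (lAct 𝕜 a v) = f a * L v := by
    rw [← hl, lAct, map_smul]; rfl
  have Lr (v b) : L (rAct 𝕜 v b) = L v * f b := by
    rw [← hr, rAct, map_smul]; rfl
  have hker : Submodule.span (Env 𝕜 (QSphere 𝕜 N q)) {v | GammaPlusRel 𝕜 N q v} ≤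
      LinearMap.ker L := by
    rw [Submodule.span_le]
    intro v hv
    rw [SetLike.mem_coe, LinearMap.mem_ker]
    cases hv with
    | add a b => simp [Lpre]
    | smul c a => simp [Lpre, Lsmul]
    | leibniz a b => simp [Lpre, Ll, Lr, hD]
    | bimod i j =>
      rw [map_sub, sub_eq_zero, Lr, Lpre, hbimod]
      simp only [map_add, map_sum, Lsmul, Ll, Lpre, map_mul]
  let g := Submodule.liftQ _ L hker
  refine ⟨{ toFun := g, map_add' := map_add g, map_smul' := fun c ω => ?_ }, fun a => ?_,
    fun a ω => ?_, fun ω b => ?_⟩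
  · obtain ⟨v, rfl⟩ := Submodule.Quotient.mk_surjective _ ω
    exact Lsmul c v
  · exact Lpre a
  · obtain ⟨v, rfl⟩ := Submodule.Quotient.mk_surjective _ ω
    exact Ll a v
  · obtain ⟨v, rfl⟩ := Submodule.Quotient.mk_surjective _ ω
    exact Lr v b

theorem QSphere.adjoin_x : Algebra.adjoin 𝕜 (Set.range (QSphere.x 𝕜 N q)) = ⊤ := by
  rw [eq_top_iff]
  rintro a -
  induction a using QSphere.induction with
  | algebraMap c => exact Subalgebra.algebraMap_mem _ c
  | x i => exact Algebra.subset_adjoin ⟨i, rfl⟩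
  | add a b ha hb => exact Subalgebra.add_mem _ ha hb
  | mul a b ha hb => exact Subalgebra.mul_mem _ ha hb

/-- An algebra with forms `ω_i` satisfying the commutation relations and the quadratic relations
receives a map from the algebra of forms. -/
theorem SphereForms.exists_lift (hQ : Nondeg 𝕜 N q (qPow 𝕜 N q)) (f : QSphere 𝕜 N q →ₐ[𝕜] B)
    {x w : Fin N → B} (hx : ∀ i, f (QSphere.x 𝕜 N q i) = x i)
    (hB : IsBimodFamily q (qPow 𝕜 N q) x w)
    (hη : ∀ a, Commute (pairing q 𝕜 x w * pairing q 𝕜 x w) (f a)) :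
    ∃ F : SphereForms 𝕜 N q →ₐ[𝕜] B, (∀ a, F (UnivCalc.ofAlg (dPlus 𝕜 N q) a) = f a) ∧
      ∀ i, F (dx 𝕜 N q i) = formU q (qPow 𝕜 N q) x w i := by
  -- With `θ = λ η` the commutator sends `x_i` to `u_i`, and `θ²` commutes with functions because `η
  -- η` does.
  set θ : B := cL q (qPow 𝕜 N q) • pairing q 𝕜 x w with hθ
  have hDx (i) : innerD f θ (QSphere.x 𝕜 N q i) = formU q (qPow 𝕜 N q) x w i := by
    have h := formU_mul_x hB hQ i
    have h' : pairing q 𝕜 x w * x i - x i * pairing q 𝕜 x w =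
        (cL q (qPow 𝕜 N q))⁻¹ • formU q (qPow 𝕜 N q) x w i := by rw [h]; abel
    rw [innerD_apply, hx, hθ, smul_mul_assoc, mul_smul_comm, ← smul_sub]
    exact (congrArg _ h').trans (smul_inv_smul₀ (cL_ne_zero hQ) _)
  have hθ2 (a) : Commute (θ * θ) (f a) := by
    rw [hθ, smul_mul_smul_comm]
    exact (hη a).smul_left _
  obtain ⟨g, hg, hl, hr⟩ := GammaPlus.exists_lift f (innerD f θ) (innerD_mul f θ) (fun i j => by
    simp only [hDx, hx]
    exact (hB.isFormFamily hQ i j).trans (IsFormFamily.iff_coeff hQ x _ i j).symm)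
  refine ⟨UnivCalc.lift f g hl hr (fun n a b h => ?_), fun a => UnivCalc.lift_ofAlg _ _ _ _ _ a,
    fun i => ?_⟩
  · simp only [hg]
    refine sum_innerD_mul_innerD f hθ2 ?_
    have := congrArg g h
    simpa [hl, hg] using this
  · rw [dx, UnivCalc.lift_ofForm, hg, hDx]

end Lift

/-! ### The kernel -/

section Kernel

variable {𝕜 : Type*} [RCLike 𝕜] {N : ℕ} {q : ℝ}

/-- The submodule generated by the coefficient vectors of the relations between two-forms. -/
abbrev relSpan (𝕜 : Type*) [RCLike 𝕜] (N : ℕ) (q : ℝ) :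
    Submodule (QSphere 𝕜 N q) (FreeTwo 𝕜 N q) :=
  Submodule.span (QSphere 𝕜 N q)
    ({v : FreeTwo 𝕜 N q | ∃ i j : Fin N, v = relOne 𝕜 q (symW 𝕜 q) (symEtaW 𝕜 q) i j} ∪
      {relTwo 𝕜 q (symDEta 𝕜 N q) (symEtaW 𝕜 q)})

/-- The map `(a_ij) ↦ ∑ a_ij dx_i ∧ dx_j`. -/
noncomputable def wedgeMap (𝕜 : Type*) [RCLike 𝕜] (N : ℕ) (q : ℝ) :
    FreeTwo 𝕜 N q →ₗ[QSphere 𝕜 N q] SphereForms 𝕜 N q :=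
  Fintype.linearCombination (QSphere 𝕜 N q) fun p : Fin N × Fin N => dx 𝕜 N q p.1 * dx 𝕜 N q p.2

theorem wedgeMap_smul (c : 𝕜) (a : FreeTwo 𝕜 N q) :
    wedgeMap 𝕜 N q (c • a) = c • wedgeMap 𝕜 N q a := by
  rw [UnivCalc.smul_comm_of_scalar, ← map_smul, algebraMap_smul]

theorem wedgeMap_symW (i j : Fin N) :
    wedgeMap 𝕜 N q (symW 𝕜 q i j) = dx 𝕜 N q i * dx 𝕜 N q j := by
  rw [wedgeMap, symW, Fintype.linearCombination_apply_single, one_smul]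

theorem wedgeMap_symEtaW (j : Fin N) :
    wedgeMap 𝕜 N q (symEtaW 𝕜 q j) = etaForm 𝕜 N q * dx 𝕜 N q j := by
  simp only [symEtaW, etaForm, map_sum, wedgeMap_smul, map_smul, wedgeMap_symW, Finset.sum_mul,
    smul_mul_assoc, UnivCalc.smul_def, mul_assoc]

theorem wedgeMap_symDEta : wedgeMap 𝕜 N q (symDEta 𝕜 N q) = dForms 𝕜 N q (etaForm 𝕜 N q) := by
  rw [dForms_etaForm]
  simp only [symDEta, map_sum, wedgeMap_smul, wedgeMap_symW]
  rfl

theorem relSpan_le_ker (hQ : Nondeg 𝕜 N q (qPow 𝕜 N q)) :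
    relSpan 𝕜 N q ≤ LinearMap.ker (wedgeMap 𝕜 N q) := by
  let φ : FreeTwo 𝕜 N q →ₗ[𝕜] SphereForms 𝕜 N q :=
    { toFun := wedgeMap 𝕜 N q
      map_add' := map_add _
      map_smul' := wedgeMap_smul }
  have hφ (a : QSphere 𝕜 N q) (m) : φ (a • m) = a • φ m := map_smul (wedgeMap 𝕜 N q) a m
  rw [Submodule.span_le]
  rintro v (⟨i, j, rfl⟩ | rfl)
  · refine (map_relOne φ hφ _ _ i j).trans ?_
    refine Eq.trans ?_ (relOne_dx hQ i j)
    congr 1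
    · funext k l; exact wedgeMap_symW k l
    · funext l; exact wedgeMap_symEtaW l
  · refine (map_relTwo φ hφ _ _).trans ?_
    refine Eq.trans ?_ (relTwo_dx hQ)
    congr 1
    · exact wedgeMap_symDEta
    · funext l; exact wedgeMap_symEtaW l

/-- The universal property of the module of two-forms: elements `sym i j` of a module which satisfy
the relations are the images of the `dx_i ∧ dx_j`. -/
theorem exists_twoForm_map (hQ : Nondeg 𝕜 N q (qPow 𝕜 N q)) {Z : Type*} [AddCommGroup Z]
    [Module 𝕜 Z] [Module (QSphere 𝕜 N q) Z] [IsScalarTower 𝕜 (QSphere 𝕜 N q) Z]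
    (sym : Fin N → Fin N → Z)
    (h1 : ∀ i j, relOne 𝕜 q sym
      (fun j => contr (met 𝕜 q) fun k l => QSphere.x 𝕜 N q k • sym l j) i j = 0)
    (h2 : relTwo 𝕜 q (contr (met 𝕜 q) sym)
      (fun j => contr (met 𝕜 q) fun k l => QSphere.x 𝕜 N q k • sym l j) = 0) :
    ∃ Ψ : SphereForms 𝕜 N q →ₗ[𝕜] Z, ∀ (a : QSphere 𝕜 N q) (i j : Fin N),
      Ψ (a • (dx 𝕜 N q i * dx 𝕜 N q j)) = a • sym i j := by
  have hS := QSphere.isSphereFamily (𝕜 := 𝕜) (N := N) hQ.pos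
  let ρ := QSphere.lift hQ.pos (rhoX_isSphereFamily hS hQ.pos)
  have hρ : ∀ j, ρ (QSphere.x 𝕜 N q j) = rhoX 𝕜 q (QSphere.x 𝕜 N q) j := fun j =>
    QSphere.lift_x _ _ j
  obtain ⟨B, _, _, f, x, w, ev, hx, hB, hev, hu, hz, hη⟩ :=
    exists_operators hS hQ QSphere.adjoin_x hρ sym
  have hx' (i) (b) : ev (x i * b) = QSphere.x 𝕜 N q i • ev b := by rw [← hx, hev]
  obtain ⟨F, hF, hFu⟩ := SphereForms.exists_lift hQ f hx hB (hη
    (fun i j => by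
      rw [map_relQuad hQ ev hx']
      simp only [hu, hz]
      exact h1 i j)
    (by
      rw [map_relation_trace hQ ev hx']
      have h3 : ev (pairing q 𝕜 (formU q (qPow 𝕜 N q) x w) (formU q (qPow 𝕜 N q) x w)) =
          contr (met 𝕜 q) sym := by
        rw [pairing, contr]
        simp only [map_sum, map_smul, hu]
        rfl
      simp only [h3, hz]
      exact h2))
  refine ⟨ev ∘ₗ F.toLinearMap, fun a i j => ?_⟩
  rw [LinearMap.comp_apply, AlgHom.toLinearMap_apply, UnivCalc.smul_def, map_mul F, map_mul F, hF, hFu,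
    hFu, hev, hu]

/-- The universal property is applied to the quotient of the free module by the relations, where
they hold tautologically. The resulting map sends `∑ a_ij dx_i ∧ dx_j` to the class of `a`, so a
vanishing sum has `a` in the span. -/
theorem ker_le_relSpan (hQ : Nondeg 𝕜 N q (qPow 𝕜 N q)) :
    LinearMap.ker (wedgeMap 𝕜 N q) ≤ relSpan 𝕜 N q := by
  let π : FreeTwo 𝕜 N q →ₗ[𝕜] FreeTwo 𝕜 N q ⧸ relSpan 𝕜 N q :=
    (relSpan 𝕜 N q).mkQ.restrictScalars 𝕜
  have hπ (a : QSphere 𝕜 N q) (m) : π (a • m) = a • π m := map_smul (relSpan 𝕜 N q).mkQ a m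
  have hπ0 (m) : π m = 0 ↔ m ∈ relSpan 𝕜 N q := Submodule.Quotient.mk_eq_zero _
  have hη (j : Fin N) : π (symEtaW 𝕜 q j) =
      contr (met 𝕜 q) fun k l => QSphere.x 𝕜 N q k • π (symW 𝕜 q l j) := by
    simp only [symEtaW, map_sum, map_smul, hπ]
    rfl
  have hd : π (symDEta 𝕜 N q) = contr (met 𝕜 q) fun k l => π (symW 𝕜 q k l) := by
    simp only [symDEta, map_sum, map_smul]
    rfl
  obtain ⟨Ψ, hΨ⟩ := exists_twoForm_map hQ (fun i j => π (symW 𝕜 q i j))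
    (fun i j => by
      simp only [← hη]
      rw [← map_relOne π hπ, hπ0]
      exact Submodule.subset_span (Or.inl ⟨i, j, rfl⟩))
    (by
      simp only [← hη, ← hd]
      rw [← map_relTwo π hπ, hπ0]
      exact Submodule.subset_span (Or.inr rfl))
  intro a ha
  rw [LinearMap.mem_ker, wedgeMap, Fintype.linearCombination_apply] at ha
  have h3 := congrArg Ψ ha
  simp only [map_sum, hΨ, map_zero] at h3
  have h5 : a = ∑ p, a p • symW 𝕜 q p.1 p.2 := by
    funext p
    simp [Finset.sum_apply, symW, Pi.single_apply]
  rw [← hπ0, h5, map_sum]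
  simp only [hπ]
  exact h3

end Kernel

theorem mainTheorem5 {𝕜 : Type*} [RCLike 𝕜] (N : ℕ) (hN : 3 ≤ N) (q : ℝ) (hq : 0 < q)
    (hq1 : q ≠ 1) :
    -- the two families of relations hold in the universal higher order calculus
    (∀ i j : Fin N, relOne 𝕜 q (fun k l => dx 𝕜 N q k * dx 𝕜 N q l)
      (fun l => etaForm 𝕜 N q * dx 𝕜 N q l) i j = 0) ∧
    relTwo 𝕜 q (dForms 𝕜 N q (etaForm 𝕜 N q)) (fun l => etaForm 𝕜 N q * dx 𝕜 N q l) = 0 ∧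
    -- the module of two-forms is generated as a left module by the `dx_i ∧ dx_j`
    (∀ v : SphereForms 𝕜 N q, v ∈ UnivCalc.forms (dPlus 𝕜 N q) 2 ↔
      ∃ a : Fin N × Fin N → QSphere 𝕜 N q,
        v = ∑ p, a p • (dx 𝕜 N q p.1 * dx 𝕜 N q p.2)) ∧
    -- all left-module relations between them are generated by the two families
    (∀ a : Fin N × Fin N → QSphere 𝕜 N q,
      ∑ p, a p • (dx 𝕜 N q p.1 * dx 𝕜 N q p.2) = 0 ↔
        a ∈ Submodule.span (QSphere 𝕜 N q)
          ({v : FreeTwo 𝕜 N q | ∃ i j : Fin N,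
              v = relOne 𝕜 q (symW 𝕜 q) (symEtaW 𝕜 q) i j} ∪
            {relTwo 𝕜 q (symDEta 𝕜 N q) (symEtaW 𝕜 q)})) := by
  have hQ := nondeg (𝕜 := 𝕜) hN hq hq1
  refine ⟨relOne_dx hQ, relTwo_dx hQ, forms_two_iff hQ, fun a => ?_⟩
  rw [← Fintype.linearCombination_apply (QSphere 𝕜 N q)
    (fun p : Fin N × Fin N => dx 𝕜 N q p.1 * dx 𝕜 N q p.2) a]
  exact ⟨fun ha => ker_le_relSpan hQ (LinearMap.mem_ker.2 ha),
    fun ha => LinearMap.mem_ker.1 (relSpan_le_ker hQ ha)⟩
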